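/- \textbf{Setting.} Let $L>0$ and let $\gamma\in C^2([0,L];\mathbb R^3)$ be a simple curve parametrized by arc length. Let $R_0\in C^1([0,L];\mathbb M^{3\times3})$ satisfy $R_0(s)\in SO(3)$ and $R_0(s)e_1=\gamma'(s)$ for all $s\in[0,L]$, and put $\nu_k=R_0e_k$, $k=2,3$. Let $D\subset\mathbb R^2$ be a bounded, open, connected set with Lipschitz boundary, with $\mathcal L^2(D)=1$ and $\int_D\xi\zeta\,d\xi\,d\zeta=\int_D\xi\,d\xi\,d\zeta=\int_D\zeta\,d\xi\,d\zeta=0$. Let $\Omega=(0,L)\times D$, with points $(s,\xi,\zeta)$. For $h>0$ let $\Psi^{(h)}(s,\xi,\zeta)=\gamma(s)+h\xi\,\nu_2(s)+h\zeta\,\nu_3(s)$ and $\nabla_hz=(\partial_sz\,|\,\tfrac1h\partial_\xi z\,|\,\tfrac1h\partial_\zeta z)$. Matrices carry the Euclidean norm, and $\mathrm{dist}$ is the corresponding distance. Let $W:(0,L)\times\mathbb M^{3\times3}\to[0,+\infty]$ be a Carathéodory function (measurable in $s$, continuous in $F$ for a.e. $s$; thus the density depends on $(s,\xi,\zeta)\in\Omega$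 only through $s$) such that: (i) there is $\delta>0$ such that for a.e. $s$ the function $W(s,\cdot)$ is (finite and) of class $C^2$ on $\{F:\mathrm{dist}(F,SO(3))<\delta\}$; (ii) on this set $\partial^2W/\partial F^2$ is a Carathéodory function, and there is $C_1>0$ with $|\frac{\partial^2W}{\partial F^2}(s,F)[G,G]|\le C_1|G|^2$ for a.e. $s$, every $F$ with $\mathrm{dist}(F,SO(3))<\delta$ and every symmetric $G$; (iii) $W(s,RF)=W(s,F)$ for a.e. $s$, every $F$ and every $R\in SO(3)$; (iv) $W(s,R)=0$ for a.e. $s$ and every $R\in SO(3)$; (v) there is $C_2>0$ with $W(s,F)\ge C_2\,\mathrm{dist}^2(F,SO(3))$ for a.e. $s$ and every $F$; (vi) there is $C_3>0$ with $W(s,F)\le C_3\,\mathrm{dist}^2(F,SO(3))$ for a.e. $s$ and every $F$. For $v\in L^2(\Omega;\mathbb R^3)$ let $$J^{(h)}(v)=\int_\Omega W\big(s,\nabla_hv\,(\nabla_h\Psi^{(h)})^{-1}\big)\det(\nabla_h\Psi^{(h)})\,ds\,d\xi\,d\zeta\quad\text{if }v\in W^{1,2}(\Omega;\mathbb R^3),$$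 and $J^{(h)}(v)=+\infty$ otherwise (for small $h$ the matrix $\nabla_h\Psi^{(h)}$ is invertible with positive determinant everywhere on $\Omega$; only small $h$ matter below). Let $$W_0(s,z)=\inf\{W(s,(z\,|\,y_2\,|\,y_3)R_0^T(s)):y_2,y_3\in\mathbb R^3\},$$ and let $W_0^{**}(s,\cdot)$ be the convex envelope of $W_0(s,\cdot)$. Identify $W^{1,2}((0,L);\mathbb R^3)$ with the set of those $v\in L^2(\Omega;\mathbb R^3)$ that are a.e. equal to a $W^{1,2}$ function of $s$ alone, and let $$I(v)=\int_0^LW_0^{**}(s,v'(s))\,ds\quad\text{if }v\in W^{1,2}((0,L);\mathbb R^3),\qquad I(v)=+\infty\quad\text{otherwise in }L^2(\Omega;\mathbb R^3).$$ \textbf{Theorem.} $J^{(h)}$ $\Gamma$-converges to $I$ as $h\to0^+$ in the strong topology of $L^2(\Omega;\mathbb R^3)$; that is: 1. for every $v\in L^2(\Omega;\mathbb R^3)$ and every family $(v^{(h)})_{h>0}\subset L^2(\Omega;\mathbb R^3)$ with $v^{(h)}\to v$ strongly in $L^2(\Omega;\mathbb R^3)$ as $h\to0^+$, one has $I(v)\le\liminf_{h\to0^+}J^{(h)}(v^{(h)})$;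 2. for every $v\in L^2(\Omega;\mathbb R^3)$ there is a family $(v^{(h)})_{h>0}\subset L^2(\Omega;\mathbb R^3)$ with $v^{(h)}\to v$ strongly in $L^2(\Omega;\mathbb R^3)$ as $h\to0^+$ and $\limsup_{h\to0^+}J^{(h)}(v^{(h)})\le I(v)$. -/

import Mathlib

open MeasureTheory Set Filter Topology
open scoped ENNReal NNReal ContDiff

-- Matrices carry the Euclidean (Frobenius) norm `|F|² = ∑ F i j ^ 2`.
attribute [local instance] Matrix.frobeniusNormedAddCommGroup Matrix.frobeniusNormedSpace

noncomputable section

namespace CurvedBeam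

/-- `ℝ³` with its Euclidean norm (target space of the deformations). -/
abbrev E3 : Type := EuclideanSpace ℝ (Fin 3)

/-- Real `3 × 3` matrices. -/
abbrev M3 : Type := Matrix (Fin 3) (Fin 3) ℝ

/-- The rotation group `SO(3)`, as a set of matrices. -/
def SO3 : Set M3 := (Matrix.specialOrthogonalGroup (Fin 3) ℝ : Set M3)

/-- `dist(F, SO(3))`, for the Euclidean norm on matrices. -/
def distSO3 (F : M3) : ℝ := Metric.infDist F SO3

/-- The matrix `(a | b | c)` with columns `a`, `b`, `c`. -/
def cols (a b c : E3) : M3 := Matrix.of fun i j => ![a, b, c] j i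

/-- The `k`-th column `F e_k` of a matrix, as a vector. -/
def column (F : M3) (k : Fin 3) : E3 := WithLp.toLp 2 fun i => F i k

/-! ### Sobolev functions -/

section Sobolev

variable {E : Type*} [NormedAddCommGroup E] [NormedSpace ℝ E] [MeasureSpace E]

/-- `g` is the distributional derivative of `u` on `U` in the direction `e`:
`∫_U (∂_e φ) u = - ∫_U φ g` for all `φ ∈ C_c^∞(U)`. -/
def IsWeakDeriv (U : Set E) (e : E) (u g : E → E3) : Prop :=
  ∀ φ : E → ℝ, ContDiff ℝ ∞ φ → HasCompactSupport φ → tsupport φ ⊆ U →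
    ∫ x in U, (fderiv ℝ φ x e) • u x = -∫ x in U, φ x • g x

end Sobolev

/-! ### Geometry -/

/-- `D` has Lipschitz boundary: near each boundary point, in suitable orthonormal coordinates
`(aξ + bζ, -bξ + aζ)`, `D` is the region below the graph of a Lipschitz function. -/
def HasLipschitzBoundary (D : Set (ℝ × ℝ)) : Prop :=
  ∀ p ∈ frontier D, ∃ r > 0, ∃ a b : ℝ, a ^ 2 + b ^ 2 = 1 ∧
    ∃ (K : ℝ≥0) (φ : ℝ → ℝ), LipschitzWith K φ ∧
      ∀ q ∈ Metric.ball p r, (q ∈ D ↔ -b * q.1 + a * q.2 < φ (a * q.1 + b * q.2))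

/-- The standing assumptions on the cross section `D ⊆ ℝ²`. -/
structure IsCrossSection (D : Set (ℝ × ℝ)) : Prop where
  isOpen : IsOpen D
  isConnected : IsConnected D
  isBounded : Bornology.IsBounded D
  lipschitz : HasLipschitzBoundary D
  integral_mul : ∫ p in D, p.1 * p.2 = 0
  integral_fst : ∫ p in D, p.1 = 0
  integral_snd : ∫ p in D, p.2 = 0
  volume_eq_one : volume D = 1

/-- `γ : [0, L] → ℝ³` is a simple (possibly closed) `C²` curve parametrized by arc length, and
`R₀ ∈ C¹([0, L]; SO(3))` is an orthonormal frame along it with `R₀ e₁ = γ'`. -/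
structure IsFramedCurve (L : ℝ) (γ : ℝ → E3) (R₀ : ℝ → M3) : Prop where
  contDiffOn_curve : ContDiffOn ℝ 2 γ (Icc 0 L)
  injOn_left : InjOn γ (Ico 0 L)
  injOn_right : InjOn γ (Ioc 0 L)
  arcLength : ∀ s ∈ Icc 0 L, ‖derivWithin γ (Icc 0 L) s‖ = 1
  contDiffOn_frame : ContDiffOn ℝ 1 R₀ (Icc 0 L)
  mem_SO3 : ∀ s ∈ Icc 0 L, R₀ s ∈ SO3
  tangent : ∀ s ∈ Icc 0 L, column (R₀ s) 0 = derivWithin γ (Icc 0 L) s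

/-- `Ω = (0, L) × D`, with points `(s, ξ, ζ)`. -/
def Omega (L : ℝ) (D : Set (ℝ × ℝ)) : Set (ℝ × ℝ × ℝ) := Ioo 0 L ×ˢ D

/-- The coordinate directions of `s`, `ξ`, `ζ`. -/
def dir : Fin 3 → ℝ × ℝ × ℝ := ![(1, 0, 0), (0, 1, 0), (0, 0, 1)]

/-- `(g₀ | g₁ / h | g₂ / h)`: the scaled gradient `∇_h z` if `g₀, g₁, g₂` are the partial
derivatives of `z` with respect to `s, ξ, ζ`. -/
def scaledGrad (h : ℝ) (g : Fin 3 → E3) : M3 := cols (g 0) (h⁻¹ • g 1) (h⁻¹ • g 2)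

/-- `Ψ^(h)(s, ξ, ζ) = γ(s) + h ξ ν₂(s) + h ζ ν₃(s)`, where `ν_k = R₀ e_k`. -/
def Psi (γ : ℝ → E3) (R₀ : ℝ → M3) (h : ℝ) (x : ℝ × ℝ × ℝ) : E3 :=
  γ x.1 + (h * x.2.1) • column (R₀ x.1) 1 + (h * x.2.2) • column (R₀ x.1) 2

/-- `∇_h Ψ^(h)` (a classical gradient). -/
def gradPsi (γ : ℝ → E3) (R₀ : ℝ → M3) (h : ℝ) (x : ℝ × ℝ × ℝ) : M3 :=
  scaledGrad h fun k => fderiv ℝ (Psi γ R₀ h) x (dir k)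

/-! ### The stored energy density -/

/-- The second derivative `D²f(F)[G, H]` of (the finite values of) `f`. -/
def secondDeriv (f : M3 → ℝ≥0∞) (F G H : M3) : ℝ :=
  iteratedFDeriv ℝ 2 (fun A => (f A).toReal) F ![G, H]

/-- The assumptions on the stored energy density `W(s, F)`, which depends on the point
`(s, ξ, ζ) ∈ Ω` through `s ∈ (0, L)` only. -/
structure IsStoredEnergy (L : ℝ) (W : ℝ → M3 → ℝ≥0∞) : Prop where
  /-- `W` is a Carathéodory function: measurable in `s` and continuous in `F`. -/
  aemeasurable : ∀ F, AEMeasurable (fun s => W s F) (volume.restrict (Ioo 0 L))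
  continuous : ∀ᵐ s ∂volume.restrict (Ioo 0 L), Continuous (W s)
  /-- Regularity near `SO(3)`: finite and `C²`, the second derivative being a Carathéodory
  function and bounded as a quadratic form on symmetric matrices. -/
  regular : ∃ δ > 0,
    (∀ᵐ s ∂volume.restrict (Ioo 0 L), (∀ F, distSO3 F < δ → W s F ≠ ⊤) ∧
      ContDiffOn ℝ 2 (fun F => (W s F).toReal) {F | distSO3 F < δ}) ∧
    (∀ F, distSO3 F < δ → ∀ G H,
      AEMeasurable (fun s => secondDeriv (W s) F G H) (volume.restrict (Ioo 0 L))) ∧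
    (∀ᵐ s ∂volume.restrict (Ioo 0 L), ∀ G H,
      ContinuousOn (fun F => secondDeriv (W s) F G H) {F | distSO3 F < δ}) ∧
    ∃ C₁ > 0, ∀ᵐ s ∂volume.restrict (Ioo 0 L), ∀ F, distSO3 F < δ →
      ∀ G : M3, G.IsSymm → |secondDeriv (W s) F G G| ≤ C₁ * ‖G‖ ^ 2
  /-- Frame indifference. -/
  frame_indifferent : ∀ᵐ s ∂volume.restrict (Ioo 0 L), ∀ F, ∀ R ∈ SO3, W s (R * F) = W s F
  /-- Rotations have no energy. -/
  zero_on_SO3 : ∀ᵐ s ∂volume.restrict (Ioo 0 L), ∀ R ∈ SO3, W s R = 0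
  /-- Growth from below. -/
  lower_bound : ∃ C₂ > 0, ∀ᵐ s ∂volume.restrict (Ioo 0 L), ∀ F,
    ENNReal.ofReal (C₂ * distSO3 F ^ 2) ≤ W s F
  /-- Growth from above. -/
  upper_bound : ∃ C₃ > 0, ∀ᵐ s ∂volume.restrict (Ioo 0 L), ∀ F,
    W s F ≤ ENNReal.ofReal (C₃ * distSO3 F ^ 2)

/-! ### The functionals -/

/-- `L²(Ω; ℝ³)` with its strong topology. -/
abbrev L2 (L : ℝ) (D : Set (ℝ × ℝ)) : Type := Lp E3 2 (volume.restrict (Omega L D))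

/-- `g = (∂_s v, ∂_ξ v, ∂_ζ v)` in the weak sense on `Ω`, with `g` in `L²`. A function
`v ∈ L²(Ω; ℝ³)` belongs to `W^{1,2}(Ω; ℝ³)` iff such a `g` exists; `g` is unique up to
null sets. -/
def IsWeakGradient (L : ℝ) (D : Set (ℝ × ℝ)) (v : L2 L D) (g : Fin 3 → ℝ × ℝ × ℝ → E3) : Prop :=
  ∀ k, MemLp (g k) 2 (volume.restrict (Omega L D)) ∧ IsWeakDeriv (Omega L D) (dir k) v (g k)

/-- `∫_Ω W(s, A (∇_h Ψ^(h))⁻¹) det (∇_h Ψ^(h)) ds dξ dζ`, where `A` is the scaled gradient built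
from the partial derivatives `g`. (The determinant is positive on `Ω` for small `h`.) -/
def energyOfGradient (L : ℝ) (D : Set (ℝ × ℝ)) (γ : ℝ → E3) (R₀ : ℝ → M3) (W : ℝ → M3 → ℝ≥0∞)
    (h : ℝ) (g : Fin 3 → ℝ × ℝ × ℝ → E3) : ℝ≥0∞ :=
  ∫⁻ x in Omega L D, W x.1 (scaledGrad h (fun k => g k x) * (gradPsi γ R₀ h x)⁻¹) *
    ENNReal.ofReal (gradPsi γ R₀ h x).det

open Classical in
/-- The functional `J^(h)` on `L²(Ω; ℝ³)`: the energy on `W^{1,2}(Ω; ℝ³)`, and `+∞` elsewhere. -/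
def J (L : ℝ) (D : Set (ℝ × ℝ)) (γ : ℝ → E3) (R₀ : ℝ → M3) (W : ℝ → M3 → ℝ≥0∞)
    (h : ℝ) (v : L2 L D) : ℝ≥0∞ :=
  if hv : ∃ g, IsWeakGradient L D v g then energyOfGradient L D γ R₀ W h hv.choose else ⊤

/-- `W₀(s, z) = inf {W(s, (z | y₂ | y₃) R₀(s)ᵀ) : y₂, y₃ ∈ ℝ³}`. -/
def W₀ (R₀ : ℝ → M3) (W : ℝ → M3 → ℝ≥0∞) (s : ℝ) (z : E3) : ℝ≥0∞ :=
  ⨅ (y₂ : E3) (y₃ : E3), W s (cols z y₂ y₃ * (R₀ s).transpose)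

/-- The convex envelope of `f ≥ 0`: the largest convex function below `f`. -/
def convexEnvelope (f : E3 → ℝ≥0∞) (z : E3) : ℝ≥0∞ :=
  ⨆ (g : E3 → ℝ≥0∞) (_ : ConvexOn ℝ≥0 univ g) (_ : ∀ w, g w ≤ f w), g z

/-- `v ∈ L²(Ω; ℝ³)` is (almost everywhere) a function `u` of `s` alone, with
`u ∈ W^{1,2}((0, L); ℝ³)`, and `u'` is the weak derivative of `u`. -/
def IsProfileDeriv (L : ℝ) (D : Set (ℝ × ℝ)) (v : L2 L D) (u' : ℝ → E3) : Prop :=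
  ∃ u : ℝ → E3, MemLp u 2 (volume.restrict (Ioo 0 L)) ∧
    MemLp u' 2 (volume.restrict (Ioo 0 L)) ∧ IsWeakDeriv (Ioo 0 L) 1 u u' ∧
    ∀ᵐ x ∂volume.restrict (Omega L D), v x = u x.1

open Classical in
/-- The limit functional: `I(v) = ∫_0^L W₀**(s, v'(s)) ds` on `W^{1,2}((0, L); ℝ³)`, and `+∞`
elsewhere in `L²(Ω; ℝ³)`. -/
def I (L : ℝ) (D : Set (ℝ × ℝ)) (R₀ : ℝ → M3) (W : ℝ → M3 → ℝ≥0∞) (v : L2 L D) : ℝ≥0∞ :=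
  if hv : ∃ u', IsProfileDeriv L D v u' then
    ∫⁻ s in Ioo 0 L, convexEnvelope (W₀ R₀ W s) (hv.choose s)
  else ⊤

/-- `Γ`-convergence of a family `F h` to `F₀` as `h → 0⁺`, in a topological space: the liminf
inequality and the existence of recovery families. -/
def GammaConverges {X : Type*} [TopologicalSpace X] (F : ℝ → X → ℝ≥0∞) (F₀ : X → ℝ≥0∞) : Prop :=
  (∀ (x : X) (y : ℝ → X), Tendsto y (𝓝[>] 0) (𝓝 x) →
    F₀ x ≤ liminf (fun h => F h (y h)) (𝓝[>] 0)) ∧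
  (∀ x : X, ∃ y : ℝ → X, Tendsto y (𝓝[>] 0) (𝓝 x) ∧
    limsup (fun h => F h (y h)) (𝓝[>] 0) ≤ F₀ x)

end CurvedBeam

end

noncomputable section

namespace CurvedBeam

/-! The energy is not divided by any power of `h`, so only the stretching of the axis survives.
Multiplied on the right by `R₀`, the argument of `W` has columns `∂_s v`, `∂_ξ v / h`, `∂_ζ v / h`,
up to errors of order `h` governed by the bounded functions `shear`. Writing `V` for `W` in these
coordinates, minimisation over the last two columns gives `W₀`.

Lower bound. Quadratic coercivity bounds the three columns in `L²`. Hence the cross-sectional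
derivatives are of order `h`, the limit depends on `s` alone (`exists_profile`), and the first
columns accumulate weakly at its derivative. The energy dominates the integral of `W₀**`, whose
sublevel sets in `L²` are convex and closed. Weak compactness enters only through
`exists_mem_of_eventually_mem`, which produces a point lying in every closed convex set that
eventually contains the sequence; membership in sublevel sets gives the energy inequality, and
membership in preimages of small balls identifies the derivative.

Upper bound. The convex envelope of a finite upper semicontinuous function is the limit of iterated
midpoint splittings (`convexEnvelope_eq_iInf_midpointHull`). One splitting of `z` into `z + d` and
`z - d` is realised by letting a curve alternate between the two on fine stripes: its primitive
hardly moves and its energy tends to the average (`exists_oscillation`). Iterating, selecting the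
two remaining columns measurably and smoothing gives a curve `w` with directors `b`, `d`. The
deformation `w + h (ξ b + ζ d)` then has the desired energy in the limit by dominated convergence,
and a diagonal choice yields the recovery family. -/

instance : (volume : Measure (ℝ × ℝ × ℝ)).IsAddHaarMeasure :=
  Measure.prod.instIsAddHaarMeasure volume volume

/-! ### Weak derivatives -/

section WeakDerivatives

set_option linter.unusedSectionVars false

variable {E : Type*} [NormedAddCommGroup E] [NormedSpace ℝ E] [MeasureSpace E] [BorelSpace E]
  [FiniteDimensional ℝ E] [(volume : Measure E).IsAddHaarMeasure]

theorem integrable_testFunction_smul {U : Set E} {g : E → E3} (hg : IntegrableOn g U) {φ : E → ℝ}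
    (hφ : Continuous φ) (hc : HasCompactSupport φ) :
    Integrable (fun x => φ x • g x) (volume.restrict U) :=
  hg.smul_of_top_right (hφ.memLp_of_hasCompactSupport hc)

theorem integrable_fderiv_testFunction_smul {U : Set E} {g : E → E3} (hg : IntegrableOn g U)
    {φ : E → ℝ} (hφ : ContDiff ℝ ∞ φ) (hc : HasCompactSupport φ) (e : E) :
    Integrable (fun x => fderiv ℝ φ x e • g x) (volume.restrict U) :=
  integrable_testFunction_smul hg ((hφ.continuous_fderiv (by simp)).clm_apply continuous_const)
    (hc.fderiv_apply ℝ e)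

theorem IsWeakDeriv.ae_unique {U : Set E} (hU : IsOpen U) {e : E} {u g g' : E → E3}
    (hg : IntegrableOn g U) (hg' : IntegrableOn g' U)
    (h : IsWeakDeriv U e u g) (h' : IsWeakDeriv U e u g') : g =ᵐ[volume.restrict U] g' := by
  have key : ∀ᵐ x, x ∈ U → g x - g' x = 0 := by
    refine hU.ae_eq_zero_of_integral_contDiff_smul_eq_zero
      (f := fun x => g x - g' x) (hg.sub hg').locallyIntegrableOn ?_
    intro φ hφ hc hs
    rw [← setIntegral_eq_integral_of_forall_compl_eq_zero (s := U)]
    · simp_rw [smul_sub]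
      rw [integral_sub (integrable_testFunction_smul hg hφ.continuous hc)
        (integrable_testFunction_smul hg' hφ.continuous hc), sub_eq_zero]
      exact neg_injective ((h φ hφ hc hs).symm.trans (h' φ hφ hc hs))
    · intro x hx
      rw [image_eq_zero_of_notMem_tsupport (fun h => hx (hs h)), zero_smul]
  rw [Filter.EventuallyEq, ae_restrict_iff' hU.measurableSet]
  filter_upwards [key] with x hx hxU using sub_eq_zero.1 (hx hxU)

theorem isWeakDeriv_of_contDiff {U : Set E} {e : E} {u : E → E3} (hu : ContDiff ℝ 1 u) :
    IsWeakDeriv U e u fun x => fderiv ℝ u x e := by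
  intro φ hφ hc hs
  have hz : ∀ x ∉ U, φ x = 0 := fun x hx =>
    image_eq_zero_of_notMem_tsupport (fun h => hx (hs h))
  have hz' : ∀ x ∉ U, fderiv ℝ φ x e = 0 := fun x hx => by
    have : fderiv ℝ φ x = 0 := by
      by_contra h
      exact hx (hs (support_fderiv_subset ℝ (f := φ) h))
    simp [this]
  rw [setIntegral_eq_integral_of_forall_compl_eq_zero (fun x hx => by simp [hz' x hx]),
    setIntegral_eq_integral_of_forall_compl_eq_zero (fun x hx => by simp [hz x hx])]
  have hdφ : Continuous fun x => fderiv ℝ φ x e :=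
    (hφ.continuous_fderiv (by simp)).clm_apply continuous_const
  have hdu : Continuous fun x => fderiv ℝ u x e :=
    (hu.continuous_fderiv (by simp)).clm_apply continuous_const
  rw [integral_smul_fderiv_eq_neg_fderiv_smul_of_integrable, neg_neg]
  · exact (hdφ.smul hu.continuous).integrable_of_hasCompactSupport
      ((hc.fderiv_apply ℝ e).smul_right)
  · exact (hφ.continuous.smul hdu).integrable_of_hasCompactSupport hc.smul_right
  · exact (hφ.continuous.smul hu.continuous).integrable_of_hasCompactSupport hc.smul_right
  · exact fun x _ => (hφ.differentiable (by simp)).differentiableAt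
  · exact fun x _ => (hu.differentiable (by simp)).differentiableAt

/-- Pairings with a function whose weak derivative vanishes do not see translations. -/
theorem IsWeakDeriv.integral_translate {U : Set E} {e : E} {w : E → E3}
    (hw : IntegrableOn w U) (h : IsWeakDeriv U e w 0) {φ : E → ℝ} (hφ : ContDiff ℝ ∞ φ)
    (hc : HasCompactSupport φ) (hs : ∀ t ∈ Icc (0 : ℝ) 1, ∀ x ∈ tsupport φ, x + t • e ∈ U) :
    ∫ x in U, φ (x - e) • w x = ∫ x in U, φ x • w x := by
  have hdφ : Continuous fun x => fderiv ℝ φ x e :=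
    (hφ.continuous_fderiv (by simp)).clm_apply continuous_const
  obtain ⟨M, hM⟩ := hdφ.bounded_above_of_compact_support (hc.fderiv_apply ℝ e)
  have hcont : ∀ t : ℝ, ContDiff ℝ ∞ fun x => φ (x - t • e) := fun t =>
    hφ.comp (contDiff_id.sub contDiff_const)
  have hcs : ∀ t : ℝ, HasCompactSupport fun x => φ (x - t • e) := fun t =>
    hc.comp_homeomorph (Homeomorph.subRight (t • e))
  have hderiv : ∀ (t : ℝ) x, HasDerivAt (fun t : ℝ => φ (x - t • e) • w x)
      ((-fderiv ℝ φ (x - t • e) e) • w x) t := by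
    intro t x
    have h1 : HasDerivAt (fun t : ℝ => x - t • e) (-e) t := by
      simpa using ((hasDerivAt_id t).smul_const e).const_sub x
    have h2 := ((hφ.differentiable (by simp)).differentiableAt
      (x := x - t • e)).hasFDerivAt.comp_hasDerivAt t h1
    simpa using h2.smul_const (w x)
  have hfd : ∀ (t : ℝ) x, fderiv ℝ (fun x => φ (x - t • e)) x e = fderiv ℝ φ (x - t • e) e := by
    intro t x
    rw [fderiv_comp_sub]
  have hint : ∀ t : ℝ, HasDerivAt (fun t : ℝ => ∫ x in U, φ (x - t • e) • w x)
      (∫ x in U, (-fderiv ℝ φ (x - t • e) e) • w x) t := by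
    intro t
    refine (hasDerivAt_integral_of_dominated_loc_of_deriv_le (s := univ)
      (F := fun (t : ℝ) x => φ (x - t • e) • w x)
      (F' := fun (t : ℝ) x => (-fderiv ℝ φ (x - t • e) e) • w x)
      (bound := fun x => M * ‖w x‖) univ_mem ?_ ?_ ?_ ?_ ?_ ?_).2
    · exact Eventually.of_forall fun t =>
        (integrable_testFunction_smul hw (hcont t).continuous (hcs t)).aestronglyMeasurable
    · exact integrable_testFunction_smul hw (hcont t).continuous (hcs t)
    · have hd : Continuous fun x => -fderiv ℝ φ (x - t • e) e :=
        (hdφ.comp (continuous_id.sub continuous_const)).neg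
      exact hd.aestronglyMeasurable.smul hw.aestronglyMeasurable
    · refine Eventually.of_forall fun x t _ => ?_
      rw [norm_smul, norm_neg]
      exact mul_le_mul_of_nonneg_right (hM _) (norm_nonneg _)
    · exact hw.norm.const_mul M
    · exact Eventually.of_forall fun x t _ => hderiv t x
  -- The translates stay supported in `U`, so they are test functions themselves and the vanishing
  -- weak derivative applies to each of them.
  have hzero : ∀ t ∈ Icc (0 : ℝ) 1, (∫ x in U, (-fderiv ℝ φ (x - t • e) e) • w x) = 0 := by
    intro t ht
    have h1 := h (fun x => φ (x - t • e)) (hcont t) (hcs t) (by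
      intro x hx
      have h2 : tsupport (fun x => φ (x - t • e)) = (Homeomorph.subRight (t • e)) ⁻¹' tsupport φ :=
        tsupport_comp_eq_preimage φ (Homeomorph.subRight (t • e))
      rw [h2] at hx
      have h3 := hs t ht _ hx
      simpa using h3)
    simp_rw [hfd] at h1
    simp_rw [neg_smul]
    rw [integral_neg, h1]
    simp
  have hconst := constant_of_has_deriv_right_zero (a := 0) (b := 1)
    (fun t _ => (hint t).continuousAt.continuousWithinAt)
    (fun t ht => by
      have := (hint t).hasDerivWithinAt (s := Ici t)
      rwa [hzero t (Ico_subset_Icc_self ht)] at this) 1 (right_mem_Icc.2 zero_le_one)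
  simpa using hconst

/-- Dual form of `integral_translate`: shifting `w` instead of the test function shows that `w (x +
e) - w x` is annihilated by all test functions on `V`. Extension of `w` by zero makes the shift
meaningful everywhere. -/
theorem IsWeakDeriv.ae_translate_eq {U V : Set E} (hU : IsOpen U) (hV : IsOpen V) {e : E}
    {w : E → E3} (hw : IntegrableOn w U) (h : IsWeakDeriv U e w 0)
    (hs : ∀ t ∈ Icc (0 : ℝ) 1, ∀ x ∈ V, x + t • e ∈ U) :
    ∀ᵐ x ∂volume.restrict V, w (x + e) = w x := by
  set w' := U.indicator w with hw'
  have hwi : Integrable w' := (integrable_indicator_iff hU.measurableSet).2 hw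
  have hset : ∀ ψ : E → ℝ, ∫ x in U, ψ x • w x = ∫ x, ψ x • w' x := by
    intro ψ
    rw [← integral_indicator hU.measurableSet]
    congr 1
    ext1 x
    by_cases hx : x ∈ U <;> simp [hw', hx]
  have hwt : Integrable fun x => w' (x + e) := hwi.comp_add_right e
  have key : ∀ᵐ x, x ∈ V → w' (x + e) - w' x = 0 := by
    have hsub : Integrable fun x => w' (x + e) - w' x := hwt.sub hwi
    refine hV.ae_eq_zero_of_integral_contDiff_smul_eq_zero
      (hsub.locallyIntegrable.locallyIntegrableOn V) ?_
    intro φ hφ hc hφs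
    have hb := hφ.continuous.memLp_of_hasCompactSupport (p := ∞) (μ := volume) hc
    simp_rw [smul_sub]
    have hb1 : Integrable fun x => φ x • w' (x + e) := hwt.smul_of_top_right hb
    have hb2 : Integrable fun x => φ x • w' x := hwi.smul_of_top_right hb
    rw [integral_sub hb1 hb2, sub_eq_zero]
    have h1 := h.integral_translate hw hφ hc (fun t ht x hx => hs t ht x (hφs hx))
    rw [hset φ, hset fun x => φ (x - e)] at h1
    rw [← h1, ← integral_sub_right_eq_self (fun x => φ x • w' (x + e)) e]
    simp
  rw [ae_restrict_iff' hV.measurableSet]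
  filter_upwards [key] with x hx hxV
  have h1 : x + e ∈ U := by simpa using hs 1 (by simp) x hxV
  have h0 : x ∈ U := by simpa using hs 0 (by simp) x hxV
  simpa [hw', h1, h0, sub_eq_zero] using hx hxV

end WeakDerivatives

/-! ### Functions that are constant on the cross sections -/

/-- Constants on overlapping neighbourhoods agree because a nonempty open set has positive measure.
The resulting assignment is locally constant on the connected set `D`, and the countable cover turns
this into an almost everywhere statement. -/
theorem ae_eq_const_of_locally {D : Set (ℝ × ℝ)} (hc : IsConnected D)
    {ι : Set (ℝ × ℝ)} (hι : ι ⊆ D) (hι' : ι.Countable) {N : ℝ × ℝ → Set (ℝ × ℝ)} (hN : ∀ y ∈ D, IsOpen (N y)) (hmem : ∀ y ∈ D, y ∈ N y)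
    (hcov : D ⊆ ⋃ y ∈ ι, N y)
    {f : ℝ × ℝ → E3} (hf : ∀ y ∈ ι, ∃ c, ∀ᵐ y' ∂volume.restrict (N y), f y' = c) :
    ∃ c, ∀ᵐ y ∂volume.restrict D, f y = c := by
  choose! k hk using hf
  have hcov' : ∀ y : D, ∃ i ∈ ι, (y : ℝ × ℝ) ∈ N i := fun y => by simpa using hcov y.2
  choose j hj hjN using hcov'
  have hloc : IsLocallyConstant fun y : D => k (j y) := by
    rw [IsLocallyConstant.iff_eventually_eq]
    intro x
    have hopen : IsOpen ((fun y : D => (y : ℝ × ℝ)) ⁻¹' N (j x)) :=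
      (hN _ (hι (hj x))).preimage continuous_subtype_val
    filter_upwards [hopen.mem_nhds (hjN x)] with y hy
    have ho : IsOpen (N (j x) ∩ N (j y)) := (hN _ (hι (hj x))).inter (hN _ (hι (hj y)))
    have hne : volume (N (j x) ∩ N (j y)) ≠ 0 :=
      (ho.measure_pos volume ⟨y, hy, hjN y⟩).ne'
    have h1 := ae_restrict_of_ae_restrict_of_subset
      (inter_subset_left (s := N (j x)) (t := N (j y))) (hk _ (hj x))
    have h2 := ae_restrict_of_ae_restrict_of_subset
      (inter_subset_right (s := N (j x)) (t := N (j y))) (hk _ (hj y))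
    have : (ae (volume.restrict (N (j x) ∩ N (j y)))).NeBot := by
      rw [ae_neBot, Ne, Measure.restrict_eq_zero]
      exact hne
    obtain ⟨z, hz1, hz2⟩ := (h1.and h2).exists
    exact hz2.symm.trans hz1
  have : PreconnectedSpace D := isPreconnected_iff_preconnectedSpace.1 hc.isPreconnected
  obtain ⟨y₀, hy₀⟩ := hc.nonempty
  refine ⟨k (j ⟨y₀, hy₀⟩), ?_⟩
  refine ae_restrict_of_ae_restrict_of_subset hcov ?_
  rw [ae_restrict_biUnion_iff _ hι']
  intro i hi
  have hiD := hι hi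
  have h1 := hk i hi
  have ho : IsOpen (N i ∩ N (j ⟨i, hiD⟩)) := (hN _ hiD).inter (hN _ (hι (hj _)))
  have h2 := ae_restrict_of_ae_restrict_of_subset
    (inter_subset_left (s := N i) (t := N (j ⟨i, hiD⟩))) h1
  have h3 := ae_restrict_of_ae_restrict_of_subset
    (inter_subset_right (s := N i) (t := N (j ⟨i, hiD⟩))) (hk _ (hj ⟨i, hiD⟩))
  have : (ae (volume.restrict (N i ∩ N (j ⟨i, hiD⟩)))).NeBot := by
    rw [ae_neBot, Ne, Measure.restrict_eq_zero]
    exact (ho.measure_pos volume ⟨i, hmem i hiD, hjN ⟨i, hiD⟩⟩).ne'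
  obtain ⟨z, hz1, hz2⟩ := (h2.and h3).exists
  have h4 := hloc.apply_eq_of_preconnectedSpace ⟨y₀, hy₀⟩ ⟨i, hiD⟩
  filter_upwards [h1] with x hx
  rw [hx, h4, ← hz1, hz2]

/-- A function on `(0, L) × D` whose cross-sectional weak derivatives vanish depends on the axial
variable only. -/
theorem exists_profile {L : ℝ} {D : Set (ℝ × ℝ)} (hD : IsOpen D) (hc : IsConnected D)
    (hvol : volume D = 1) {w : ℝ × ℝ × ℝ → E3} (hw : IntegrableOn w (Omega L D))
    (h1 : IsWeakDeriv (Omega L D) (dir 1) w 0) (h2 : IsWeakDeriv (Omega L D) (dir 2) w 0) :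
    ∃ u : ℝ → E3, StronglyMeasurable u ∧ ∀ᵐ x ∂volume.restrict (Omega L D), w x = u x.1 := by
  have hΩ : IsOpen (Omega L D) := isOpen_Ioo.prod hD
  obtain ⟨w', hw'm, hww'⟩ : ∃ w', StronglyMeasurable w' ∧ w =ᵐ[volume.restrict (Omega L D)] w' :=
    ⟨_, hw.aestronglyMeasurable.stronglyMeasurable_mk, hw.aestronglyMeasurable.ae_eq_mk⟩
  have hw'i : IntegrableOn w' (Omega L D) := hw.congr hww'
  have hdir : ∀ η : ℝ × ℝ, IsWeakDeriv (Omega L D) ((0 : ℝ), η) w' 0 := by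
    intro η φ hφ hcs hs
    have e : ∀ x, fderiv ℝ φ x ((0 : ℝ), η) • w' x =
        η.1 • (fderiv ℝ φ x (dir 1) • w' x) + η.2 • (fderiv ℝ φ x (dir 2) • w' x) := by
      intro x
      have : ((0 : ℝ), η) = η.1 • dir 1 + η.2 • dir 2 := by
        simp [dir]
      rw [this, map_add, map_smul, map_smul, add_smul, smul_eq_mul, smul_eq_mul, mul_smul, mul_smul]
    have i1 : Integrable (fun x => η.1 • (fderiv ℝ φ x (dir 1) • w' x))
        (volume.restrict (Omega L D)) :=
      (integrable_fderiv_testFunction_smul hw'i hφ hcs (dir 1)).smul η.1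
    have i2 : Integrable (fun x => η.2 • (fderiv ℝ φ x (dir 2) • w' x))
        (volume.restrict (Omega L D)) :=
      (integrable_fderiv_testFunction_smul hw'i hφ hcs (dir 2)).smul η.2
    have z : ∀ k, IsWeakDeriv (Omega L D) (dir k) w 0 →
        ∫ x in Omega L D, fderiv ℝ φ x (dir k) • w' x = 0 := by
      intro k hk
      have := hk φ hφ hcs hs
      simp only [Pi.zero_apply, smul_zero, integral_zero, neg_zero] at this
      rw [← this]
      exact integral_congr_ae (hww'.mono fun x hx => by simp only [hx])
    simp_rw [e]
    rw [integral_add i1 i2, integral_smul, integral_smul, z 1 h1, z 2 h2]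
    simp
  have hball : ∀ y ∈ D, ∃ r > 0, Metric.ball y (2 * r) ⊆ D := by
    intro y hy
    obtain ⟨r, hr, h⟩ := Metric.isOpen_iff.1 hD y hy
    exact ⟨r / 2, by positivity, by rwa [mul_div_cancel₀ _ two_ne_zero]⟩
  choose! r hr hrD using hball
  have hlocal : ∀ y₀ ∈ D, ∀ᵐ s ∂volume.restrict (Ioo 0 L), ∃ c,
      ∀ᵐ y ∂volume.restrict (Metric.ball y₀ (r y₀ / 2)), w' (s, y) = c := by
    intro y₀ hy₀
    set ρ := r y₀
    have hρ : 0 < ρ := hr y₀ hy₀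
    have hV : IsOpen (Ioo 0 L ×ˢ Metric.ball y₀ ρ) := isOpen_Ioo.prod Metric.isOpen_ball
    have ht : ∀ᵐ η ∂volume.restrict (Metric.ball (0 : ℝ × ℝ) ρ),
        ∀ᵐ x ∂volume.restrict (Ioo 0 L ×ˢ Metric.ball y₀ ρ), w' (x + ((0 : ℝ), η)) = w' x := by
      filter_upwards [ae_restrict_mem measurableSet_ball] with η hη
      refine (hdir η).ae_translate_eq hΩ hV hw'i ?_
      rintro t ⟨ht0, ht1⟩ ⟨s, y⟩ ⟨hs, hy⟩
      refine ⟨by simpa using hs, hrD y₀ hy₀ ?_⟩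
      rw [mem_ball_zero_iff] at hη
      simp only [Metric.mem_ball, dist_eq_norm] at hy ⊢
      have e : ((s, y) + t • ((0 : ℝ), η) : ℝ × ℝ × ℝ).2 - y₀ = (y - y₀) + t • η := by
        simp only [Prod.snd_add, Prod.smul_snd]
        abel
      rw [e]
      calc ‖(y - y₀) + t • η‖ ≤ ‖y - y₀‖ + |t| * ‖η‖ := by
            simpa [norm_smul] using norm_add_le (y - y₀) (t • η)
        _ ≤ ‖y - y₀‖ + 1 * ‖η‖ := by
            gcongr
            rwa [abs_of_nonneg ht0]
        _ < 2 * ρ := by linarith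
    have hmeas : MeasurableSet {p : (ℝ × ℝ) × (ℝ × ℝ × ℝ) | w' (p.2 + ((0 : ℝ), p.1)) = w' p.2} := by
      refine StronglyMeasurable.measurableSet_eq_fun ?_ ?_
      · exact hw'm.comp_measurable (measurable_snd.add
          (measurable_const.prodMk measurable_fst))
      · exact hw'm.comp_measurable measurable_snd
    -- Fubini exchanges the quantifiers: almost every point is now good for almost every shift, so
    -- one good base point determines `w'` on a whole ball.
    rw [Measure.ae_ae_comm hmeas] at ht
    have hprod : (volume : Measure (ℝ × ℝ × ℝ)).restrict (Ioo 0 L ×ˢ Metric.ball y₀ ρ) =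
        (volume.restrict (Ioo 0 L)).prod (volume.restrict (Metric.ball y₀ ρ)) :=
      (Measure.prod_restrict _ _).symm
    rw [hprod] at ht
    filter_upwards [Measure.ae_ae_of_ae_prod ht] with s hs
    -- Two points of the ball of radius `ρ / 2` differ by a shift of size less than `ρ`, hence by an
    -- admissible one.
    have hsub : Metric.ball y₀ (ρ / 2) ⊆ Metric.ball y₀ ρ := Metric.ball_subset_ball (by linarith)
    have hs' := ae_restrict_of_ae_restrict_of_subset hsub hs
    have : (ae (volume.restrict (Metric.ball y₀ (ρ / 2)))).NeBot := by
      rw [ae_neBot, Ne, Measure.restrict_eq_zero]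
      exact (Metric.measure_ball_pos volume y₀ (by linarith)).ne'
    obtain ⟨y, hy, hyb⟩ := (hs'.and (ae_restrict_mem measurableSet_ball)).exists
    refine ⟨w' (s, y), ?_⟩
    rw [ae_restrict_iff' measurableSet_ball] at hy ⊢
    have h3 := (measurePreserving_sub_right volume y).quasiMeasurePreserving.ae hy
    filter_upwards [h3] with z hz hzb
    have := hz (by
      rw [mem_ball_zero_iff, ← dist_eq_norm]
      calc dist z y ≤ dist z y₀ + dist y y₀ := dist_triangle_right _ _ _
        _ < ρ := by
          rw [Metric.mem_ball] at hzb hyb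
          linarith)
    simpa using this
  obtain ⟨ι, hι, hιc, hιcov⟩ := TopologicalSpace.countable_cover_nhdsWithin
    (f := fun y => Metric.ball y (r y / 2)) (s := D)
    (fun y hy => mem_nhdsWithin_of_mem_nhds (Metric.ball_mem_nhds _ (half_pos (hr y hy))))
  have hconst : ∀ᵐ s ∂volume.restrict (Ioo 0 L), ∃ c, ∀ᵐ y ∂volume.restrict D, w' (s, y) = c := by
    have : ∀ᵐ s ∂volume.restrict (Ioo 0 L), ∀ y₀ ∈ ι, ∃ c,
        ∀ᵐ y ∂volume.restrict (Metric.ball y₀ (r y₀ / 2)), w' (s, y) = c :=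
      (ae_ball_iff hιc).2 fun y hy => hlocal y (hι hy)
    filter_upwards [this] with s hs
    exact ae_eq_const_of_locally hc hι hιc (fun y _ => Metric.isOpen_ball)
      (fun y hy => Metric.mem_ball_self (half_pos (hr y hy))) hιcov hs
  -- Since `D` has measure one, the average over `D` recovers the constant, and it is measurable in
  -- `s` without any selection.
  refine ⟨fun s => ∫ y in D, w' (s, y), ?_, ?_⟩
  · exact StronglyMeasurable.integral_prod_right (f := fun s y => w' (s, y)) hw'm
  · have hprod : (volume : Measure (ℝ × ℝ × ℝ)).restrict (Omega L D) =
        (volume.restrict (Ioo 0 L)).prod (volume.restrict D) := (Measure.prod_restrict _ _).symm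
    have hum : StronglyMeasurable fun s => ∫ y in D, w' (s, y) :=
      StronglyMeasurable.integral_prod_right (f := fun s y => w' (s, y)) hw'm
    have hae : ∀ᵐ x ∂volume.restrict (Omega L D), w' x = ∫ y in D, w' (x.1, y) := by
      rw [hprod, Measure.ae_prod_iff_ae_ae]
      · filter_upwards [hconst] with s ⟨c, hs⟩
        have : ∫ y in D, w' (s, y) = c := by
          rw [integral_congr_ae hs]
          simp [Measure.real, hvol]
        filter_upwards [hs] with y hy
        rw [hy, this]
      · exact StronglyMeasurable.measurableSet_eq_fun hw'm (hum.comp_measurable measurable_fst)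
    filter_upwards [hww', hae] with x hx1 hx2
    rw [hx1, hx2]

/-! ### Sobolev functions of one variable -/

/-- The primitive vanishes below the support of `q`, and above it equals the total integral; mean
zero is exactly what makes its support compact. -/
theorem exists_testFunction_fderiv_eq {L : ℝ} {q : ℝ → ℝ} (hq : ContDiff ℝ ∞ q)
    (hc : HasCompactSupport q) (hs : tsupport q ⊆ Ioo 0 L) (h0 : ∫ x, q x = 0) :
    ∃ Θ : ℝ → ℝ, ContDiff ℝ ∞ Θ ∧ HasCompactSupport Θ ∧ tsupport Θ ⊆ Ioo 0 L ∧
      ∀ x, fderiv ℝ Θ x 1 = q x := by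
  have hder : ∀ x, HasDerivAt (fun x => ∫ t in (0 : ℝ)..x, q t) (q x) x := fun x =>
    hq.continuous.integral_hasStrictDerivAt 0 x |>.hasDerivAt
  have hderiv : deriv (fun x => ∫ t in (0 : ℝ)..x, q t) = q := funext fun x => (hder x).deriv
  -- `C` is the interval hull of the support: the primitive need not vanish in gaps of the support.
  obtain ⟨C, hK, hCo, hqC, hKs⟩ : ∃ C : Set ℝ, IsCompact C ∧ C.OrdConnected ∧
      tsupport q ⊆ C ∧ C ⊆ Ioo 0 L := by
    rcases (tsupport q).eq_empty_or_nonempty with h | h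
    · exact ⟨∅, isCompact_empty, ordConnected_empty, h.le, empty_subset _⟩
    · obtain ⟨a, ha⟩ := IsCompact.exists_isLeast hc h
      obtain ⟨b, hb⟩ := IsCompact.exists_isGreatest hc h
      exact ⟨Icc a b, isCompact_Icc, ordConnected_Icc, fun x hx => ⟨ha.2 hx, hb.2 hx⟩,
        fun x hx => ⟨(hs ha.1).1.trans_le hx.1, hx.2.trans_lt (hs hb.1).2⟩⟩
  have hsupp : Function.support (fun x => ∫ t in (0 : ℝ)..x, q t) ⊆ C := by
    intro x hx
    by_contra hxK
    apply hx
    by_cases hlow : ∃ k ∈ tsupport q, k ≤ x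
    · obtain ⟨k, hk, hkx⟩ := hlow
      have hup : ∀ k' ∈ tsupport q, k' < x := by
        intro k' hk'
        by_contra hle
        exact hxK (hCo.out (hqC hk) (hqC hk') ⟨hkx, not_lt.1 hle⟩)
      show ∫ t in (0 : ℝ)..x, q t = 0
      rw [intervalIntegral.integral_eq_integral_of_support_subset, h0]
      intro t ht
      have ht' := subset_tsupport q ht
      exact ⟨(hs ht').1, (hup t ht').le⟩
    · push Not at hlow
      refine intervalIntegral.integral_zero_ae (Eventually.of_forall fun t ht => ?_)
      refine image_eq_zero_of_notMem_tsupport fun htq => ?_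
      rcases mem_uIoc.1 ht with ⟨_, h⟩ | ⟨_, h⟩
      · exact absurd (hlow t htq) (not_lt.2 h)
      · exact absurd (hs htq).1 (not_lt.2 h)
  have htsupp : tsupport (fun x => ∫ t in (0 : ℝ)..x, q t) ⊆ C :=
    closure_minimal hsupp hK.isClosed
  refine ⟨fun x => ∫ t in (0 : ℝ)..x, q t, ?_, ?_, htsupp.trans hKs, fun x => ?_⟩
  · rw [contDiff_infty_iff_deriv, hderiv]
    exact ⟨fun x => (hder x).differentiableAt, hq⟩
  · exact HasCompactSupport.of_support_subset_isCompact hK hsupp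
  · rw [(hder x).hasFDerivAt.fderiv]
    simp

/-- Du Bois-Reymond: if `ψ` has integral one, then `φ - (∫ φ) ψ` has mean zero and is the derivative
of a test function. Hence `w` pairs with `φ` as the constant `∫ ψ w` does. -/
theorem ae_eq_const_of_isWeakDeriv_zero {L : ℝ} (hL : 0 < L) {w : ℝ → E3}
    (hw : IntegrableOn w (Ioo 0 L)) (h : IsWeakDeriv (Ioo 0 L) 1 w 0) :
    ∃ c, ∀ᵐ s ∂volume.restrict (Ioo 0 L), w s = c := by
  let b : ContDiffBump (L / 2) := ⟨L / 8, L / 4, by positivity, by linarith⟩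
  set ψ := b.normed volume
  have hψ : ContDiff ℝ ∞ ψ := b.contDiff_normed
  have hψc : HasCompactSupport ψ := b.hasCompactSupport_normed
  have hψs : tsupport ψ ⊆ Ioo 0 L := by
    rw [b.tsupport_normed_eq]
    intro x hx
    have hx' : |x - L / 2| ≤ L / 4 := by simpa [b, Real.dist_eq] using hx
    rw [abs_le] at hx'
    constructor <;> linarith
  have hψ1 : ∫ x, ψ x = 1 := b.integral_normed
  refine ⟨∫ s in Ioo 0 L, ψ s • w s, ?_⟩
  set c := ∫ s in Ioo 0 L, ψ s • w s
  have hcI : IntegrableOn (fun _ : ℝ => c) (Ioo 0 L) := integrable_const c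
  have hset : ∀ φ : ℝ → ℝ, tsupport φ ⊆ Ioo 0 L → ∫ x in Ioo 0 L, φ x = ∫ x, φ x :=
    fun φ hs => setIntegral_eq_integral_of_forall_compl_eq_zero fun x hx =>
      image_eq_zero_of_notMem_tsupport fun h => hx (hs h)
  have key : ∀ᵐ x, x ∈ Ioo 0 L → w x - c = 0 := by
    refine isOpen_Ioo.ae_eq_zero_of_integral_contDiff_smul_eq_zero
      (f := fun x => w x - c) (hw.sub hcI).locallyIntegrableOn ?_
    intro φ hφ hφc hφs
    set m := ∫ x, φ x
    have hψi : Integrable ψ := hψ.continuous.integrable_of_hasCompactSupport hψc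
    have hφi : Integrable φ := hφ.continuous.integrable_of_hasCompactSupport hφc
    obtain ⟨Θ, hΘ, hΘc, hΘs, hΘd⟩ := exists_testFunction_fderiv_eq (L := L)
      (q := fun x => φ x - m * ψ x) (hφ.sub (contDiff_const.mul hψ))
      (hφc.sub hψc.mul_left) (by
        refine (tsupport_sub φ fun x => m * ψ x).trans (union_subset hφs ?_)
        exact (tsupport_mul_subset_right (f := fun _ : ℝ => m) (g := ψ)).trans hψs) (by
        rw [integral_sub hφi (hψi.const_mul m), integral_const_mul, hψ1, mul_one, sub_self])
    have h1 := h Θ hΘ hΘc hΘs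
    simp_rw [hΘd, sub_smul, mul_smul] at h1
    have i1 := integrable_testFunction_smul hw hφ.continuous hφc
    have i2 : Integrable (fun x => m • (ψ x • w x)) (volume.restrict (Ioo 0 L)) :=
      (integrable_testFunction_smul hw hψ.continuous hψc).smul m
    rw [integral_sub i1 i2, integral_smul] at h1
    simp only [Pi.zero_apply, smul_zero, integral_zero, neg_zero, sub_eq_zero] at h1
    rw [← setIntegral_eq_integral_of_forall_compl_eq_zero (s := Ioo 0 L) (fun x hx => by
      rw [image_eq_zero_of_notMem_tsupport (fun h => hx (hφs h)), zero_smul])]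
    simp_rw [smul_sub]
    rw [integral_sub i1 (integrable_testFunction_smul hcI hφ.continuous hφc), h1,
      integral_smul_const, hset φ hφs, sub_self]
  rw [ae_restrict_iff' measurableSet_Ioo]
  filter_upwards [key] with x hx hxU using sub_eq_zero.1 (hx hxU)

theorem norm_intervalIntegral_sub_le {L : ℝ} {g g' : ℝ → E3} (hg : IntegrableOn g (Ioo 0 L))
    (hg' : IntegrableOn g' (Ioo 0 L)) {s : ℝ} (hs : s ∈ Icc 0 L) :
    ‖(∫ t in (0 : ℝ)..s, g t) - ∫ t in (0 : ℝ)..s, g' t‖ ≤ ∫ t in Ioo 0 L, ‖g t - g' t‖ := by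
  have hsub : Ioc 0 s ⊆ Ioc 0 L := Ioc_subset_Ioc_right hs.2
  rw [← integrableOn_Ioc_iff_integrableOn_Ioo] at hg hg'
  have i1 : IntervalIntegrable g volume 0 s :=
    (intervalIntegrable_iff_integrableOn_Ioc_of_le hs.1).2 (hg.mono_set hsub)
  have i2 : IntervalIntegrable g' volume 0 s :=
    (intervalIntegrable_iff_integrableOn_Ioc_of_le hs.1).2 (hg'.mono_set hsub)
  rw [← intervalIntegral.integral_sub i1 i2, intervalIntegral.integral_of_le hs.1,
    ← integral_Ioc_eq_integral_Ioo]
  refine (norm_integral_le_integral_norm _).trans ?_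
  exact setIntegral_mono_set (hg.sub hg').norm (Eventually.of_forall fun x => norm_nonneg _)
    hsub.eventuallyLE

theorem continuousOn_primitive_Icc {L : ℝ} (hL : 0 ≤ L) {g : ℝ → E3}
    (hg : IntegrableOn g (Ioo 0 L)) :
    ContinuousOn (fun s => ∫ t in (0 : ℝ)..s, g t) (Icc 0 L) := by
  rw [← integrableOn_Icc_iff_integrableOn_Ioo] at hg
  have := intervalIntegral.continuousOn_primitive_interval (a := 0) (b := L) (f := g)
    (μ := volume) (by rwa [uIcc_of_le hL])
  rwa [uIcc_of_le hL] at this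

/-- For merely integrable `g` the primitive need not be `C¹`. Both sides of the integration by parts
are continuous in `g` for the `L¹` norm, and the formula is classical for the smooth compactly
supported functions approximating `g`. -/
theorem isWeakDeriv_primitive {L : ℝ} (hL : 0 < L) {g : ℝ → E3} (hg : IntegrableOn g (Ioo 0 L)) :
    IsWeakDeriv (Ioo 0 L) 1 (fun s => ∫ t in (0 : ℝ)..s, g t) g := by
  intro φ hφ hc hs
  have hdφ : Continuous fun x => fderiv ℝ φ x (1 : ℝ) :=
    (hφ.continuous_fderiv (by simp)).clm_apply continuous_const
  obtain ⟨M, hM⟩ := hφ.continuous.bounded_above_of_compact_support hc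
  obtain ⟨M', hM'⟩ := hdφ.bounded_above_of_compact_support (hc.fderiv_apply ℝ 1)
  have hM0 : 0 ≤ M := (norm_nonneg _).trans (hM 0)
  have hM0' : 0 ≤ M' := (norm_nonneg _).trans (hM' 0)
  have hP : ∀ f : ℝ → E3, IntegrableOn f (Ioo 0 L) →
      IntegrableOn (fun s => ∫ t in (0 : ℝ)..s, f t) (Ioo 0 L) := fun f hf =>
    ((continuousOn_primitive_Icc hL.le hf).integrableOn_Icc).mono_set Ioo_subset_Icc_self
  rw [← sub_eq_zero, ← norm_le_zero_iff]
  refine le_of_forall_pos_le_add fun ε hε => ?_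
  -- Replacing `g` by `k` at `L¹` distance `δ` changes the two sides by at most `M' * δ * L` and `M
  -- * δ`; the summand `1` keeps the denominator positive.
  obtain ⟨k, hkc, hk, hkε⟩ := (memLp_one_iff_integrable.2 hg).exist_eLpNorm_sub_le
    ENNReal.one_ne_top le_rfl (ε := ε / (M' * L + M + 1)) (by positivity)
  have hki : IntegrableOn k (Ioo 0 L) :=
    (hk.continuous.integrable_of_hasCompactSupport hkc).integrableOn
  have hdist : ∫ t in Ioo 0 L, ‖g t - k t‖ ≤ ε / (M' * L + M + 1) := by
    rw [eLpNorm_one_eq_lintegral_enorm] at hkε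
    rw [integral_norm_eq_lintegral_enorm (f := fun t => g t - k t)
      (hg.aestronglyMeasurable.sub hki.aestronglyMeasurable)]
    exact ENNReal.toReal_le_of_le_ofReal (by positivity) hkε
  set δ := ∫ t in Ioo 0 L, ‖g t - k t‖ with hδ
  have hδ0 : 0 ≤ δ := integral_nonneg fun _ => norm_nonneg _
  have hder : ∀ x, HasDerivAt (fun s => ∫ t in (0 : ℝ)..s, k t) (k x) x := fun x =>
    hk.continuous.integral_hasStrictDerivAt 0 x |>.hasDerivAt
  have hKw : IsWeakDeriv (Ioo 0 L) 1 (fun s => ∫ t in (0 : ℝ)..s, k t) k := by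
    have h1 : ContDiff ℝ 1 fun s => ∫ t in (0 : ℝ)..s, k t := by
      rw [contDiff_one_iff_deriv]
      refine ⟨fun x => (hder x).differentiableAt, ?_⟩
      rw [show deriv (fun s => ∫ t in (0 : ℝ)..s, k t) = k from funext fun x => (hder x).deriv]
      exact hk.continuous
    have h2 := isWeakDeriv_of_contDiff (U := Ioo 0 L) (e := 1) h1
    have h3 : (fun x => fderiv ℝ (fun s => ∫ t in (0 : ℝ)..s, k t) x 1) = k := by
      ext1 x
      rw [(hder x).hasFDerivAt.fderiv]
      simp
    rwa [h3] at h2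
  have hk0 := hKw φ hφ hc hs
  have e1 : ‖(∫ x in Ioo 0 L, fderiv ℝ φ x 1 • ∫ t in (0 : ℝ)..x, g t) -
      ∫ x in Ioo 0 L, fderiv ℝ φ x 1 • ∫ t in (0 : ℝ)..x, k t‖ ≤ M' * δ * L := by
    rw [← integral_sub (integrable_fderiv_testFunction_smul (hP g hg) hφ hc 1)
      (integrable_fderiv_testFunction_smul (hP k hki) hφ hc 1)]
    have := norm_setIntegral_le_of_norm_le_const (μ := volume) (s := Ioo 0 L) (C := M' * δ)
      (f := fun x => fderiv ℝ φ x 1 • (∫ t in (0 : ℝ)..x, g t) -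
        fderiv ℝ φ x 1 • ∫ t in (0 : ℝ)..x, k t) (by simp) (by
        intro x hx
        rw [← smul_sub, norm_smul]
        exact mul_le_mul (hM' x) (norm_intervalIntegral_sub_le hg hki (Ioo_subset_Icc_self hx))
          (norm_nonneg _) hM0')
    simpa [Measure.real, hL.le] using this
  have e2 : ‖(∫ x in Ioo 0 L, φ x • g x) - ∫ x in Ioo 0 L, φ x • k x‖ ≤ M * δ := by
    rw [← integral_sub (integrable_testFunction_smul hg hφ.continuous hc)
      (integrable_testFunction_smul hki hφ.continuous hc), hδ, ← integral_const_mul]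
    refine norm_integral_le_of_norm_le ((hg.sub hki).norm.const_mul M)
      (Eventually.of_forall fun x => ?_)
    rw [← smul_sub, norm_smul]
    exact mul_le_mul_of_nonneg_right (hM x) (norm_nonneg _)
  have e3 : (∫ x in Ioo 0 L, fderiv ℝ φ x 1 • ∫ t in (0 : ℝ)..x, g t) -
      -∫ x in Ioo 0 L, φ x • g x =
      ((∫ x in Ioo 0 L, fderiv ℝ φ x 1 • ∫ t in (0 : ℝ)..x, g t) -
        ∫ x in Ioo 0 L, fderiv ℝ φ x 1 • ∫ t in (0 : ℝ)..x, k t) +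
      ((∫ x in Ioo 0 L, φ x • g x) - ∫ x in Ioo 0 L, φ x • k x) := by
    rw [hk0]
    abel
  rw [e3, zero_add]
  calc _ ≤ M' * δ * L + M * δ := (norm_add_le _ _).trans (add_le_add e1 e2)
    _ ≤ (M' * L + M + 1) * δ := by nlinarith
    _ ≤ (M' * L + M + 1) * (ε / (M' * L + M + 1)) := by gcongr
    _ = ε := mul_div_cancel₀ _ (by positivity)

/-- A Sobolev function of one variable is the primitive of its weak derivative. -/
theorem IsWeakDeriv.exists_ae_eq_primitive {L : ℝ} (hL : 0 < L) {u g : ℝ → E3}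
    (hu : IntegrableOn u (Ioo 0 L)) (hg : IntegrableOn g (Ioo 0 L))
    (h : IsWeakDeriv (Ioo 0 L) 1 u g) :
    ∃ c, ∀ᵐ s ∂volume.restrict (Ioo 0 L), u s = c + ∫ t in (0 : ℝ)..s, g t := by
  have hP : IntegrableOn (fun s => ∫ t in (0 : ℝ)..s, g t) (Ioo 0 L) :=
    ((continuousOn_primitive_Icc hL.le hg).integrableOn_Icc).mono_set Ioo_subset_Icc_self
  obtain ⟨c, hc⟩ := ae_eq_const_of_isWeakDeriv_zero hL
    (w := fun s => u s - ∫ t in (0 : ℝ)..s, g t) (hu.sub hP) (by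
      intro φ hφ hcs hs
      simp_rw [smul_sub]
      rw [integral_sub (integrable_fderiv_testFunction_smul hu hφ hcs 1)
        (integrable_fderiv_testFunction_smul hP hφ hcs 1), h φ hφ hcs hs,
        isWeakDeriv_primitive hL hg φ hφ hcs hs]
      simp)
  exact ⟨c, hc.mono fun s hs => by rw [← hs]; abel⟩

/-! ### Convexification by iterated midpoint splitting -/

section Convexification

/-- The best average of `f` over the endpoints of a segment centred at `z`. -/
def midpointHull (f : E3 → ℝ≥0∞) (z : E3) : ℝ≥0∞ := ⨅ d : E3, 2⁻¹ * (f (z + d) + f (z - d))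

theorem ENNReal_half_mul_add_self (a : ℝ≥0∞) : 2⁻¹ * (a + a) = a := by
  rw [← two_mul, ← mul_assoc, ENNReal.inv_mul_cancel two_ne_zero ENNReal.ofNat_ne_top, one_mul]

theorem midpointHull_le (f : E3 → ℝ≥0∞) (z : E3) : midpointHull f z ≤ f z :=
  (iInf_le _ 0).trans (by rw [add_zero, sub_zero, ENNReal_half_mul_add_self])

theorem upperSemicontinuous_midpoint {f : E3 → ℝ≥0∞} (hf : UpperSemicontinuous f) :
    UpperSemicontinuous fun p : E3 × E3 => 2⁻¹ * (f (p.1 + p.2) + f (p.1 - p.2)) := by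
  have h1 : UpperSemicontinuous fun p : E3 × E3 => f (p.1 + p.2) + f (p.1 - p.2) :=
    (hf.comp (continuous_fst.add continuous_snd)).add (hf.comp (continuous_fst.sub continuous_snd))
  exact (ENNReal.continuous_const_mul (by simp)).comp_upperSemicontinuous h1
    fun a b h => mul_le_mul_right h _

theorem UpperSemicontinuous.midpointHull {f : E3 → ℝ≥0∞} (hf : UpperSemicontinuous f) :
    UpperSemicontinuous (midpointHull f) :=
  upperSemicontinuous_iInf fun _ =>
    (upperSemicontinuous_midpoint hf).comp (continuous_id.prodMk continuous_const)

/-- Upper semicontinuity makes `{f < c}` open, so it meets the dense sequence. Countable infima keep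
the hulls measurable in `s` and permit measurable selection. -/
theorem iInf_eq_iInf_denseSeq {X : Type*} [TopologicalSpace X] [TopologicalSpace.SeparableSpace X]
    [Nonempty X] {f : X → ℝ≥0∞} (hf : UpperSemicontinuous f) :
    ⨅ x, f x = ⨅ k, f (TopologicalSpace.denseSeq X k) := by
  refine le_antisymm (le_iInf fun k => iInf_le _ _) (le_iInf fun x => ?_)
  refine le_of_forall_gt fun c hc => ?_
  obtain ⟨_, hy, k, rfl⟩ := mem_closure_iff_nhds.1
    (TopologicalSpace.denseRange_denseSeq X x) _ (hf x c hc)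
  exact (iInf_le _ k).trans_lt hy

theorem midpointHull_eq_iInf {f : E3 → ℝ≥0∞} (hf : UpperSemicontinuous f) (z : E3) :
    midpointHull f z = ⨅ k, 2⁻¹ * (f (z + TopologicalSpace.denseSeq E3 k) +
      f (z - TopologicalSpace.denseSeq E3 k)) :=
  iInf_eq_iInf_denseSeq
    ((upperSemicontinuous_midpoint hf).comp (continuous_const.prodMk continuous_id))

theorem upperSemicontinuous_iterate_midpointHull {f : E3 → ℝ≥0∞} (hf : UpperSemicontinuous f)
    (n : ℕ) : UpperSemicontinuous (midpointHull^[n] f) := by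
  induction n with
  | zero => exact hf
  | succ n ih =>
    rw [Function.iterate_succ_apply']
    exact UpperSemicontinuous.midpointHull ih

theorem antitone_iterate_midpointHull (f : E3 → ℝ≥0∞) (z : E3) :
    Antitone fun n => midpointHull^[n] f z := by
  refine antitone_nat_of_succ_le fun n => ?_
  rw [Function.iterate_succ_apply']
  exact midpointHull_le _ _

/-- Both sequences decrease, so their infima can be taken along a common index `n`; splitting at `a`
costs one more step, which the infimum absorbs. -/
theorem iInf_midpointHull_midpoint_le (f : E3 → ℝ≥0∞) (a d : E3) :
    ⨅ n, midpointHull^[n] f a ≤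
      2⁻¹ * ((⨅ n, midpointHull^[n] f (a + d)) + ⨅ n, midpointHull^[n] f (a - d)) := by
  rw [ENNReal.iInf_add_iInf fun i j => ⟨max i j,
      add_le_add (antitone_iterate_midpointHull f _ (le_max_left i j))
        (antitone_iterate_midpointHull f _ (le_max_right i j))⟩,
    ENNReal.mul_iInf_of_ne (by simp) (by simp)]
  refine le_iInf fun n => (iInf_le _ (n + 1)).trans ?_
  rw [Function.iterate_succ_apply']
  exact iInf_le _ d

/-- The difference between `G` and a chord is upper semicontinuous and attains its maximum on `[0,
1]`. The maximiser is the midpoint between its nearest endpoint, where the difference is zero, and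
another point of the interval, where it is at most the maximum. So the maximum is at most half of
itself, hence nonpositive. -/
theorem convexOn_of_midpoint {G : E3 → ℝ} (hG : UpperSemicontinuous G)
    (hmid : ∀ a d, G a ≤ (G (a + d) + G (a - d)) / 2) : ConvexOn ℝ univ G := by
  refine ⟨convex_univ, fun x _ y _ a b ha hb hab => ?_⟩
  set φ : ℝ → ℝ := fun t => G (x + t • (y - x)) + -((1 - t) * G x + t * G y) with hφ
  have hφu : UpperSemicontinuousOn φ (Icc 0 1) := by
    refine UpperSemicontinuous.upperSemicontinuousOn ?_ _
    refine UpperSemicontinuous.add (hG.comp (by fun_prop)) ?_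
    exact Continuous.upperSemicontinuous (by fun_prop)
  obtain ⟨t, ⟨ht0, ht1⟩, hmax⟩ := hφu.exists_isMaxOn ⟨0, by simp⟩ isCompact_Icc
  have h0 : φ 0 = 0 := by simp [hφ]
  have h1 : φ 1 = 0 := by simp [hφ]
  have hφmid : ∀ t r, φ t ≤ (φ (t + r) + φ (t - r)) / 2 := by
    intro t r
    have := hmid (x + t • (y - x)) (r • (y - x))
    have e1 : x + (t + r) • (y - x) = x + t • (y - x) + r • (y - x) := by module
    have e2 : x + (t - r) • (y - x) = x + t • (y - x) - r • (y - x) := by module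
    simp only [hφ, e1, e2]
    linarith
  have hle : φ t ≤ 0 := by
    by_cases ht : t ≤ 1 / 2
    · have h2 := hφmid t t
      have h3 : φ (t + t) ≤ φ t := hmax ⟨by linarith, by linarith⟩
      rw [sub_self, h0] at h2
      linarith
    · have h2 := hφmid t (1 - t)
      have h3 : φ (t - (1 - t)) ≤ φ t := hmax ⟨by linarith, by linarith⟩
      rw [add_sub_cancel, h1] at h2
      linarith
  have hb1 : φ b ≤ 0 := (hmax (show b ∈ Icc (0 : ℝ) 1 from ⟨hb, by linarith⟩)).trans hle
  have e : x + b • (y - x) = a • x + b • y := by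
    rw [show a = 1 - b by linarith]
    module
  simp only [hφ, e, show 1 - b = a by linarith] at hb1
  simp only [smul_eq_mul]
  linarith

theorem upperSemicontinuous_toReal {f : E3 → ℝ≥0∞} (hf : UpperSemicontinuous f)
    (hfin : ∀ z, f z ≠ ⊤) : UpperSemicontinuous fun z => (f z).toReal := by
  intro x c hc
  have h1 : f x < ENNReal.ofReal c := (ENNReal.lt_ofReal_iff_toReal_lt (hfin x)).2 hc
  filter_upwards [hf x _ h1] with y hy
  exact (ENNReal.lt_ofReal_iff_toReal_lt (hfin y)).1 hy

theorem iInf_midpointHull_ne_top {f : E3 → ℝ≥0∞} (hfin : ∀ z, f z ≠ ⊤) (z : E3) : ⨅ n, midpointHull^[n] f z ≠ ⊤ :=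
  ((iInf_le _ 0).trans_lt (hfin z).lt_top).ne

theorem convexOn_toReal_iInf_midpointHull {f : E3 → ℝ≥0∞} (hf : UpperSemicontinuous f)
    (hfin : ∀ z, f z ≠ ⊤) :
    ConvexOn ℝ univ fun z => (⨅ n, midpointHull^[n] f z).toReal := by
  refine convexOn_of_midpoint (upperSemicontinuous_toReal
    (upperSemicontinuous_iInf fun n => upperSemicontinuous_iterate_midpointHull hf n)
    (iInf_midpointHull_ne_top hfin)) fun a d => ?_
  have h := ENNReal.toReal_mono (ENNReal.mul_ne_top (by simp) (ENNReal.add_ne_top.2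
    ⟨iInf_midpointHull_ne_top hfin (a + d), iInf_midpointHull_ne_top hfin (a - d)⟩))
    (iInf_midpointHull_midpoint_le f a d)
  rw [ENNReal.toReal_mul, ENNReal.toReal_add (iInf_midpointHull_ne_top hfin _)
    (iInf_midpointHull_ne_top hfin _)] at h
  simp only [ENNReal.toReal_inv, ENNReal.toReal_ofNat] at h
  linarith

/-- A finite convex function on a finite-dimensional space is locally Lipschitz; so the limit of the
splittings is continuous although each hull is only known to be upper semicontinuous. -/
theorem continuous_iInf_midpointHull {f : E3 → ℝ≥0∞} (hf : UpperSemicontinuous f)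
    (hfin : ∀ z, f z ≠ ⊤) : Continuous fun z => ⨅ n, midpointHull^[n] f z := by
  have h := ENNReal.continuous_ofReal.comp
    (convexOn_toReal_iInf_midpointHull hf hfin).locallyLipschitz.continuous
  refine h.congr fun z => ?_
  exact ENNReal.ofReal_toReal (iInf_midpointHull_ne_top hfin z)

theorem iInf_midpointHull_convex {f : E3 → ℝ≥0∞} (hf : UpperSemicontinuous f)
    (hfin : ∀ z, f z ≠ ⊤) (x y : E3) (a b : ℝ≥0) (hab : a + b = 1) :
    ⨅ n, midpointHull^[n] f (a • x + b • y) ≤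
      a * (⨅ n, midpointHull^[n] f x) + b * ⨅ n, midpointHull^[n] f y := by
  have h := (convexOn_toReal_iInf_midpointHull hf hfin).2 (mem_univ x) (mem_univ y)
    (NNReal.coe_nonneg a) (NNReal.coe_nonneg b) (by rw [← NNReal.coe_add, hab, NNReal.coe_one])
  have hx := iInf_midpointHull_ne_top hfin x
  have hy := iInf_midpointHull_ne_top hfin y
  refine (ENNReal.toReal_le_toReal (iInf_midpointHull_ne_top hfin _) ?_).1 ?_
  · exact ENNReal.add_ne_top.2 ⟨ENNReal.mul_ne_top (by simp) hx, ENNReal.mul_ne_top (by simp) hy⟩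
  · rw [ENNReal.toReal_add (ENNReal.mul_ne_top (by simp) hx) (ENNReal.mul_ne_top (by simp) hy),
      ENNReal.toReal_mul, ENNReal.toReal_mul]
    exact h

/-- For finite upper semicontinuous functions the convex envelope is reached by iterated midpoint
splitting. -/
theorem convexEnvelope_eq_iInf_midpointHull {f : E3 → ℝ≥0∞} (hf : UpperSemicontinuous f)
    (hfin : ∀ z, f z ≠ ⊤) (z : E3) :
    convexEnvelope f z = ⨅ n, midpointHull^[n] f z := by
  refine le_antisymm ?_ ?_
  · refine iSup_le fun g => iSup_le fun hg => iSup_le fun hgf => le_iInf fun n => ?_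
    -- A convex minorant survives every splitting, by its convexity at midpoints.
    have : ∀ n w, g w ≤ midpointHull^[n] f w := by
      intro n
      induction n with
      | zero => exact hgf
      | succ n ih =>
        intro w
        rw [Function.iterate_succ_apply']
        refine le_iInf fun d => ?_
        have h := hg.2 (mem_univ (w + d)) (mem_univ (w - d))
          (zero_le (a := (2⁻¹ : ℝ≥0))) (zero_le (a := (2⁻¹ : ℝ≥0))) (by
            rw [← two_mul]
            exact mul_inv_cancel₀ two_ne_zero)
        have e : (2⁻¹ : ℝ≥0) • (w + d) + (2⁻¹ : ℝ≥0) • (w - d) = w := by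
          simp only [NNReal.smul_def, NNReal.coe_inv, NNReal.coe_ofNat]
          module
        rw [e] at h
        refine h.trans ?_
        rw [← smul_add, ENNReal.smul_def, smul_eq_mul]
        have e2 : ((2⁻¹ : ℝ≥0) : ℝ≥0∞) = 2⁻¹ := by simp
        rw [e2]
        exact mul_le_mul_right (add_le_add (ih _) (ih _)) _
    exact this n z
  -- Conversely, the limit of the splittings is itself an admissible convex minorant.
  · refine le_iSup_of_le (fun z => ⨅ n, midpointHull^[n] f z) (le_iSup_of_le ?_
      (le_iSup_of_le (fun w => iInf_le _ 0) le_rfl))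
    exact ⟨convex_univ, fun x _ y _ a b _ _ hab => iInf_midpointHull_convex hf hfin x y a b hab⟩

end Convexification

/-! ### Matrices and their columns -/

theorem column_apply (F : M3) (k i : Fin 3) : column F k i = F i k := rfl

@[simp] theorem cols_column (F : M3) : cols (column F 0) (column F 1) (column F 2) = F := by
  ext i j
  fin_cases j <;> rfl

@[simp] theorem column_cols_zero (a b c : E3) : column (cols a b c) 0 = a := rfl
@[simp] theorem column_cols_one (a b c : E3) : column (cols a b c) 1 = b := rfl
@[simp] theorem column_cols_two (a b c : E3) : column (cols a b c) 2 = c := rfl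

theorem norm_sq_eq_column (F : M3) :
    ‖F‖ ^ 2 = ‖column F 0‖ ^ 2 + ‖column F 1‖ ^ 2 + ‖column F 2‖ ^ 2 := by
  have h : ‖F‖ ^ 2 = ∑ i, ∑ j, ‖F i j‖ ^ 2 := by
    rw [Matrix.frobenius_norm_def, ← Real.sqrt_eq_rpow, Real.sq_sqrt (by positivity)]
    norm_cast
  rw [h]
  simp only [EuclideanSpace.norm_sq_eq, column_apply, Fin.sum_univ_three]
  ring

theorem norm_le_sum_column (F : M3) : ‖F‖ ≤ ‖column F 0‖ + ‖column F 1‖ + ‖column F 2‖ := by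
  refine (sq_le_sq₀ (norm_nonneg _) (by positivity)).1 ?_
  rw [norm_sq_eq_column]
  nlinarith [norm_nonneg (column F 0), norm_nonneg (column F 1), norm_nonneg (column F 2),
    mul_nonneg (norm_nonneg (column F 0)) (norm_nonneg (column F 1)),
    mul_nonneg (norm_nonneg (column F 0)) (norm_nonneg (column F 2)),
    mul_nonneg (norm_nonneg (column F 1)) (norm_nonneg (column F 2))]

theorem continuous_column (k : Fin 3) : Continuous fun F : M3 => column F k := by
  unfold column
  fun_prop

theorem continuous_cols : Continuous fun p : E3 × E3 × E3 => cols p.1 p.2.1 p.2.2 := by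
  refine continuous_matrix fun i j => ?_
  fin_cases j <;> simp [cols] <;> fun_prop

theorem SO3_mul_transpose {R : M3} (hR : R ∈ SO3) : R * R.transpose = 1 := by
  have h := (Matrix.mem_specialOrthogonalGroup_iff.1 hR).1
  exact (Matrix.mem_orthogonalGroup_iff (Fin 3) ℝ).1 h

theorem SO3_transpose_mul {R : M3} (hR : R ∈ SO3) : R.transpose * R = 1 := by
  have h := (Matrix.mem_specialOrthogonalGroup_iff.1 hR).1
  exact (Matrix.mem_orthogonalGroup_iff' (Fin 3) ℝ).1 h

theorem SO3_det {R : M3} (hR : R ∈ SO3) : R.det = 1 :=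
  (Matrix.mem_specialOrthogonalGroup_iff.1 hR).2

theorem norm_column_SO3 {R : M3} (hR : R ∈ SO3) (k : Fin 3) : ‖column R k‖ = 1 := by
  have h := congrFun (congrFun (SO3_transpose_mul hR) k) k
  rw [Matrix.mul_apply] at h
  have h2 : ‖column R k‖ ^ 2 = 1 := by
    rw [EuclideanSpace.norm_sq_eq]
    simp only [Matrix.transpose_apply, Matrix.one_apply_eq] at h
    rw [← h]
    refine Finset.sum_congr rfl fun i _ => ?_
    rw [column_apply, Real.norm_eq_abs, sq_abs, sq]
  exact (pow_eq_one_iff_of_nonneg (norm_nonneg _) two_ne_zero).1 h2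

theorem norm_SO3_le {R : M3} (hR : R ∈ SO3) : ‖R‖ ≤ 3 := by
  refine (norm_le_sum_column R).trans ?_
  rw [norm_column_SO3 hR, norm_column_SO3 hR, norm_column_SO3 hR]
  norm_num

theorem norm_transpose_SO3_le {R : M3} (hR : R ∈ SO3) : ‖R.transpose‖ ≤ 3 := by
  rw [Matrix.frobenius_norm_transpose]
  exact norm_SO3_le hR

theorem one_mem_SO3 : (1 : M3) ∈ SO3 := (Matrix.specialOrthogonalGroup (Fin 3) ℝ).one_mem

theorem distSO3_nonneg (F : M3) : 0 ≤ distSO3 F := Metric.infDist_nonneg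

theorem distSO3_le (F : M3) : distSO3 F ≤ ‖F‖ + 3 := by
  refine (Metric.infDist_le_dist_of_mem one_mem_SO3).trans ?_
  rw [dist_eq_norm]
  exact (norm_sub_le _ _).trans (by linarith [norm_SO3_le one_mem_SO3])

theorem norm_le_distSO3 (F : M3) : ‖F‖ ≤ distSO3 F + 3 := by
  refine le_of_forall_pos_le_add fun ε hε => ?_
  obtain ⟨R, hR, h⟩ := (Metric.infDist_lt_iff ⟨1, one_mem_SO3⟩).1
    (lt_add_of_pos_right (distSO3 F) hε)
  rw [dist_eq_norm] at h
  have := norm_le_insert' F R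
  linarith [norm_SO3_le hR]

theorem enorm_sq_eq_ofReal (z : E3) : ‖z‖ₑ ^ 2 = ENNReal.ofReal (‖z‖ ^ 2) := by
  rw [ENNReal.ofReal_pow (norm_nonneg _), ofReal_norm]

/-! ### Regular representatives of the stored energy -/

/-- A Carathéodory integrand of quadratic growth, in terms of the columns of the deformation
gradient in the moving frame. -/
structure IsRegularPotential (V : ℝ → E3 × E3 × E3 → ℝ≥0∞) : Prop where
  measurable : ∀ p, Measurable fun s => V s p
  continuous : ∀ s, Continuous (V s)
  bound : ∃ C : ℝ≥0, ∀ s p, V s p ≤ C * (1 + ‖p.1‖ₑ ^ 2 + ‖p.2.1‖ₑ ^ 2 + ‖p.2.2‖ₑ ^ 2)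

theorem IsRegularPotential.measurable_uncurry {V : ℝ → E3 × E3 × E3 → ℝ≥0∞}
    (hV : IsRegularPotential V) : Measurable fun q : (E3 × E3 × E3) × ℝ => V q.2 q.1 :=
  measurable_uncurry_of_continuous_of_measurable (u := fun p s => V s p) hV.continuous
    hV.measurable

/-- The hypotheses on `W` hold only for almost every `s`. Setting the density to zero on a
measurable null set removes the bad `s`: those where continuity or the growth bound fails, or where
`W` differs from a measurable representative at one of countably many dense matrices. Measurability
at the remaining matrices follows by continuity. -/
theorem IsStoredEnergy.exists_regular {L : ℝ} {W : ℝ → M3 → ℝ≥0∞} (hW : IsStoredEnergy L W) :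
    ∃ V : ℝ → E3 × E3 × E3 → ℝ≥0∞, (∀ p, Measurable fun s => V s p) ∧ (∀ s, Continuous (V s)) ∧
      (∃ C > 0, ∀ s p, V s p ≤ ENNReal.ofReal (C * distSO3 (cols p.1 p.2.1 p.2.2) ^ 2)) ∧
      ∀ᵐ s ∂volume.restrict (Ioo 0 L), ∀ F, W s F = V s (column F 0, column F 1, column F 2) := by
  obtain ⟨C, hC, hCW⟩ := hW.upper_bound
  let X := E3 × E3 × E3
  let q : X → M3 := fun p => cols p.1 p.2.1 p.2.2
  let x : ℕ → X := TopologicalSpace.denseSeq X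
  have hx : DenseRange x := TopologicalSpace.denseRange_denseSeq X
  let m : ℕ → ℝ → ℝ≥0∞ := fun k => (hW.aemeasurable (q (x k))).mk
  have hm : ∀ k, Measurable (m k) := fun k => (hW.aemeasurable (q (x k))).measurable_mk
  have hgood : ∀ᵐ s ∂volume.restrict (Ioo 0 L), (∀ k, W s (q (x k)) = m k s) ∧
      Continuous (W s) ∧ ∀ F, W s F ≤ ENNReal.ofReal (C * distSO3 F ^ 2) := by
    filter_upwards [ae_all_iff.2 fun k => (hW.aemeasurable (q (x k))).ae_eq_mk, hW.continuous, hCW]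
      with s h1 h2 h3 using ⟨h1, h2, h3⟩
  obtain ⟨N, hNsub, hNm, hN0⟩ := exists_measurable_superset_of_null (ae_iff.1 hgood)
  have hN : ∀ s ∉ N, (∀ k, W s (q (x k)) = m k s) ∧
      Continuous (W s) ∧ ∀ F, W s F ≤ ENNReal.ofReal (C * distSO3 F ^ 2) := fun s hs => by
    by_contra h
    exact hs (hNsub h)
  classical
  let V : ℝ → X → ℝ≥0∞ := fun s p => if s ∈ N then 0 else W s (q p)
  have hVc : ∀ s, Continuous (V s) := by
    intro s
    by_cases hs : s ∈ N
    · simp only [V, hs, if_true]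
      exact continuous_const
    · simp only [V, hs, if_false]
      exact (hN s hs).2.1.comp continuous_cols
  refine ⟨V, fun p => ?_, hVc, ⟨C, hC, fun s p => ?_⟩, ?_⟩
  · obtain ⟨y, hyx, hyp⟩ := mem_closure_iff_seq_limit.1 (hx p)
    choose k hk using hyx
    refine measurable_of_tendsto_metrizable (f := fun j s => V s (y j)) (fun j => ?_)
      (tendsto_pi_nhds.2 fun s => ((hVc s).tendsto p).comp hyp)
    have e : (fun s => V s (y j)) = fun s => if s ∈ N then 0 else m (k j) s := by
      ext1 s
      by_cases hs : s ∈ N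
      · simp [V, hs]
      · simp only [V, hs, if_false]
        rw [← hk j, (hN s hs).1]
    rw [e]
    exact Measurable.ite hNm measurable_const (hm _)
  · by_cases hs : s ∈ N
    · simp [V, hs]
    · simp only [V, hs, if_false]
      exact (hN s hs).2.2 _
  · have : ∀ᵐ s ∂volume.restrict (Ioo 0 L), s ∉ N := measure_eq_zero_iff_ae_notMem.1 hN0
    filter_upwards [this] with s hs F
    simp [V, hs, q]

/-- In frame coordinates the free columns of `W₀` are simply the last two arguments of `V`.
Extending the frame constantly beyond `[0, L]` makes it continuous on the whole line, so that `V` is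
regular for every `s`. -/
theorem exists_regularPotential {L : ℝ} (hL : 0 < L) {γ : ℝ → E3} {R₀ : ℝ → M3}
    (hγ : IsFramedCurve L γ R₀) {W : ℝ → M3 → ℝ≥0∞} (hW : IsStoredEnergy L W) :
    ∃ V : ℝ → E3 × E3 × E3 → ℝ≥0∞, IsRegularPotential V ∧
      ∀ᵐ s ∂volume.restrict (Ioo 0 L), ∀ F,
        W s F = V s (column (F * R₀ s) 0, column (F * R₀ s) 1, column (F * R₀ s) 2) := by
  obtain ⟨V, hVm, hVc, ⟨C, hC, hVb⟩, hVW⟩ := hW.exists_regular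
  let R : ℝ → M3 := fun s => R₀ (projIcc 0 L hL.le s)
  have hRc : Continuous R :=
    (continuousOn_iff_continuous_domRestrict.1 hγ.contDiffOn_frame.continuousOn).comp
      continuous_projIcc
  have hR : ∀ s, R s ∈ SO3 := fun s => hγ.mem_SO3 _ (projIcc 0 L hL.le s).2
  let Q : ℝ → E3 × E3 × E3 → M3 := fun s p => cols p.1 p.2.1 p.2.2 * (R s).transpose
  let c : M3 → E3 × E3 × E3 := fun F => (column F 0, column F 1, column F 2)
  have hc : Continuous c :=
    (continuous_column 0).prodMk ((continuous_column 1).prodMk (continuous_column 2))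
  have hQ1 : ∀ s, Continuous (Q s) := fun s => continuous_cols.matrix_mul continuous_const
  have hQ2 : ∀ p, Continuous fun s => Q s p := fun p =>
    continuous_const.matrix_mul hRc.matrix_transpose
  have hju : Measurable fun q : (E3 × E3 × E3) × ℝ => V q.2 q.1 :=
    measurable_uncurry_of_continuous_of_measurable (u := fun p s => V s p) hVc hVm
  refine ⟨fun s p => V s (c (Q s p)), ⟨fun p => ?_, fun s => ?_, ?_⟩, ?_⟩
  · exact hju.comp ((hc.comp (hQ2 p)).measurable.prodMk measurable_id)
  · exact (hVc s).comp (hc.comp (hQ1 s))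
  -- Rotations have norm at most `3`, so the distance is at most `3 a + 3` with `a` the norm of the
  -- columns, and `(3 a + 3)² ≤ 18 (1 + a²)`.
  · refine ⟨Real.toNNReal (18 * C), fun s p => (hVb s _).trans ?_⟩
    have e : cols (c (Q s p)).1 (c (Q s p)).2.1 (c (Q s p)).2.2 = Q s p := cols_column _
    rw [e]
    have h1 : ‖Q s p‖ ≤ 3 * ‖cols p.1 p.2.1 p.2.2‖ := by
      refine (Matrix.frobenius_norm_mul _ _).trans ?_
      rw [mul_comm]
      exact mul_le_mul_of_nonneg_right (norm_transpose_SO3_le (hR s)) (norm_nonneg _)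
    have h2 : distSO3 (Q s p) ≤ 3 * ‖cols p.1 p.2.1 p.2.2‖ + 3 :=
      (distSO3_le _).trans (by linarith)
    have h3 : distSO3 (Q s p) ^ 2 ≤ (3 * ‖cols p.1 p.2.1 p.2.2‖ + 3) ^ 2 :=
      pow_le_pow_left₀ (distSO3_nonneg _) h2 2
    have h4 := norm_sq_eq_column (cols p.1 p.2.1 p.2.2)
    simp only [column_cols_zero, column_cols_one, column_cols_two] at h4
    have h5 : C * distSO3 (Q s p) ^ 2 ≤
        18 * C * (1 + ‖p.1‖ ^ 2 + ‖p.2.1‖ ^ 2 + ‖p.2.2‖ ^ 2) := by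
      have : distSO3 (Q s p) ^ 2 ≤ 18 * (1 + ‖p.1‖ ^ 2 + ‖p.2.1‖ ^ 2 + ‖p.2.2‖ ^ 2) := by
        nlinarith [sq_nonneg (‖cols p.1 p.2.1 p.2.2‖ - 1)]
      nlinarith
    refine (ENNReal.ofReal_le_ofReal h5).trans ?_
    rw [ENNReal.ofReal_mul (by positivity), ENNReal.ofReal_add (by positivity) (by positivity),
      ENNReal.ofReal_add (by positivity) (by positivity),
      ENNReal.ofReal_add (by positivity) (by positivity), enorm_sq_eq_ofReal, enorm_sq_eq_ofReal,
      enorm_sq_eq_ofReal, ENNReal.ofReal_one]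
    exact le_rfl
  · filter_upwards [hVW, ae_restrict_mem measurableSet_Ioo] with s hs hsI F
    have hRs : R s = R₀ s := by
      simp only [R, projIcc_of_mem hL.le (Ioo_subset_Icc_self hsI)]
    have e : Q s (column (F * R₀ s) 0, column (F * R₀ s) 1, column (F * R₀ s) 2) = F := by
      simp only [Q, cols_column]
      rw [hRs, Matrix.mul_assoc, SO3_mul_transpose (hγ.mem_SO3 s (Ioo_subset_Icc_self hsI)),
        Matrix.mul_one]
    rw [e, hs F]

/-! ### The reduced density and its convexification -/

/-- The energy density minimised over the cross-sectional columns. -/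
def fiberMin (V : ℝ → E3 × E3 × E3 → ℝ≥0∞) (s : ℝ) (z : E3) : ℝ≥0∞ := ⨅ y : E3 × E3, V s (z, y)

/-- The limit density, written as the limit of iterated midpoint splittings. -/
def relaxedDensity (V : ℝ → E3 × E3 × E3 → ℝ≥0∞) (s : ℝ) (z : E3) : ℝ≥0∞ :=
  ⨅ n, midpointHull^[n] (fiberMin V s) z

namespace IsRegularPotential

theorem upperSemicontinuous_fiberMin {V : ℝ → E3 × E3 × E3 → ℝ≥0∞}
    (hV : IsRegularPotential V) (s : ℝ) : UpperSemicontinuous (fiberMin V s) :=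
  upperSemicontinuous_iInf fun _ =>
    ((hV.continuous s).comp (continuous_id.prodMk continuous_const)).upperSemicontinuous

theorem fiberMin_eq {V : ℝ → E3 × E3 × E3 → ℝ≥0∞}
    (hV : IsRegularPotential V) (s : ℝ) (z : E3) :
    fiberMin V s z = ⨅ k, V s (z, TopologicalSpace.denseSeq (E3 × E3) k) :=
  iInf_eq_iInf_denseSeq
    ((hV.continuous s).comp (continuous_const.prodMk continuous_id)).upperSemicontinuous

theorem fiberMin_le {V : ℝ → E3 × E3 × E3 → ℝ≥0∞}
    (hV : IsRegularPotential V) : ∃ C : ℝ≥0, ∀ s z, fiberMin V s z ≤ C * (1 + ‖z‖ₑ ^ 2) := by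
  obtain ⟨C, hC⟩ := hV.bound
  exact ⟨C, fun s z => (iInf_le _ 0).trans ((hC s _).trans (by simp))⟩

theorem fiberMin_ne_top {V : ℝ → E3 × E3 × E3 → ℝ≥0∞}
    (hV : IsRegularPotential V) (s : ℝ) (z : E3) : fiberMin V s z ≠ ⊤ := by
  obtain ⟨C, hC⟩ := hV.fiberMin_le
  refine ((hC s z).trans_lt ?_).ne
  exact ENNReal.mul_lt_top (by simp) (ENNReal.add_lt_top.2 ⟨by simp, ENNReal.pow_lt_top (by simp)⟩)

/-- Joint measurability is needed because the hulls are evaluated along curves `s ↦ z s`. At each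
stage upper semicontinuity reduces the infimum over directions to a countable one. -/
theorem measurable_midpointHull {V : ℝ → E3 × E3 × E3 → ℝ≥0∞}
    (hV : IsRegularPotential V) (n : ℕ) :
    Measurable fun q : E3 × ℝ => midpointHull^[n] (fiberMin V q.2) q.1 := by
  induction n with
  | zero =>
    simp only [Function.iterate_zero, id_eq, hV.fiberMin_eq]
    refine Measurable.iInf fun k => ?_
    exact hV.measurable_uncurry.comp
      ((measurable_fst.prodMk measurable_const).prodMk measurable_snd)
  | succ n ih =>
    have e : (fun q : E3 × ℝ => midpointHull^[n + 1] (fiberMin V q.2) q.1) =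
        fun q => ⨅ k, 2⁻¹ * (midpointHull^[n] (fiberMin V q.2)
            (q.1 + TopologicalSpace.denseSeq E3 k) +
          midpointHull^[n] (fiberMin V q.2) (q.1 - TopologicalSpace.denseSeq E3 k)) := by
      ext1 q
      rw [Function.iterate_succ_apply', midpointHull_eq_iInf
        (upperSemicontinuous_iterate_midpointHull (hV.upperSemicontinuous_fiberMin q.2) n)]
    rw [e]
    refine Measurable.iInf fun k => Measurable.const_mul (Measurable.add ?_ ?_) _
    · exact ih.comp ((measurable_fst.add_const _).prodMk measurable_snd)
    · exact ih.comp ((measurable_fst.sub_const _).prodMk measurable_snd)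

theorem measurable_relaxedDensity {V : ℝ → E3 × E3 × E3 → ℝ≥0∞}
    (hV : IsRegularPotential V) : Measurable fun q : E3 × ℝ => relaxedDensity V q.2 q.1 :=
  Measurable.iInf hV.measurable_midpointHull

theorem continuous_relaxedDensity {V : ℝ → E3 × E3 × E3 → ℝ≥0∞}
    (hV : IsRegularPotential V) (s : ℝ) : Continuous (relaxedDensity V s) :=
  continuous_iInf_midpointHull (hV.upperSemicontinuous_fiberMin s) (hV.fiberMin_ne_top s)

theorem convexEnvelope_fiberMin {V : ℝ → E3 × E3 × E3 → ℝ≥0∞}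
    (hV : IsRegularPotential V) (s : ℝ) (z : E3) :
    convexEnvelope (fiberMin V s) z = relaxedDensity V s z :=
  convexEnvelope_eq_iInf_midpointHull (hV.upperSemicontinuous_fiberMin s) (hV.fiberMin_ne_top s) z

theorem relaxedDensity_convex {V : ℝ → E3 × E3 × E3 → ℝ≥0∞}
    (hV : IsRegularPotential V) (s : ℝ) (x y : E3) (a b : ℝ≥0) (hab : a + b = 1) :
    relaxedDensity V s (a • x + b • y) ≤ a * relaxedDensity V s x + b * relaxedDensity V s y :=
  iInf_midpointHull_convex (hV.upperSemicontinuous_fiberMin s) (hV.fiberMin_ne_top s) x y a b hab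

end IsRegularPotential

theorem midpointHull_iterate_le (f : E3 → ℝ≥0∞) (n : ℕ) (z : E3) : midpointHull^[n] f z ≤ f z :=
  antitone_iterate_midpointHull f z (Nat.zero_le n)

theorem relaxedDensity_le (V : ℝ → E3 × E3 × E3 → ℝ≥0∞) (s : ℝ) (p : E3 × E3 × E3) :
    relaxedDensity V s p.1 ≤ V s p :=
  (iInf_le _ 0).trans (iInf_le _ p.2)

/-- Near-optimal measurable selection from a sequence of functions. -/
theorem exists_measurable_selection {α : Type*} [MeasurableSpace α] {μ : Measure α}
    {f : ℕ → α → ℝ≥0∞} (hf : ∀ k, Measurable (f k)) (hfin : ∫⁻ a, f 0 a ∂μ ≠ ⊤) {ε : ℝ≥0∞}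
    (hε : ε ≠ 0) :
    ∃ k : α → ℕ, Measurable k ∧ (∃ N, ∀ a, k a ≤ N) ∧
      ∫⁻ a, f (k a) a ∂μ ≤ ∫⁻ a, ⨅ i, f i a ∂μ + ε := by
  have hcomp : ∀ k : α → ℕ, Measurable k → Measurable fun a => f (k a) a := fun k hk =>
    (measurable_from_prod_countable_right (f := fun p : ℕ × α => f p.1 p.2) hf).comp
      (hk.prodMk measurable_id)
  -- The index `k j` realises the minimum of the first `j + 1` functions, and is measurable since
  -- only finitely many comparisons are involved.
  have hex : ∀ j, ∃ k : α → ℕ, Measurable k ∧ (∀ a, k a ≤ j) ∧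
      ∀ a, f (k a) a = ⨅ i : Fin (j + 1), f i a := by
    intro j
    induction j with
    | zero => exact ⟨fun _ => 0, measurable_const, fun _ => le_rfl, fun a => by simp⟩
    | succ j ih =>
      obtain ⟨k, hk, hkj, hkf⟩ := ih
      classical
      refine ⟨fun a => if f (j + 1) a < f (k a) a then j + 1 else k a,
        Measurable.ite (measurableSet_lt (hf _) (hcomp k hk)) measurable_const hk, fun a => ?_,
        fun a => ?_⟩
      · dsimp only
        split_ifs
        · exact le_rfl
        · exact (hkj a).trans (Nat.le_succ j)
      · have e : (⨅ i : Fin (j + 1 + 1), f i a) = min (⨅ i : Fin (j + 1), f i a) (f (j + 1) a) := by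
          refine le_antisymm (le_min (le_iInf fun i => iInf_le (fun i : Fin (j + 1 + 1) => f i a)
            i.castSucc) ?_) (le_iInf fun i => ?_)
          · exact (iInf_le (fun i : Fin (j + 1 + 1) => f i a) (Fin.last (j + 1))).trans
              (by simp)
          · induction i using Fin.lastCases with
            | last => exact min_le_right _ _
            | cast i => exact (min_le_left _ _).trans (iInf_le (fun i : Fin (j + 1) => f i a) i)
        rw [e, ← hkf a]
        dsimp only
        split_ifs with h
        · exact (min_eq_right h.le).symm
        · exact (min_eq_left (not_lt.1 h)).symm
  choose k hk hkj hkf using hex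
  have hanti : Antitone fun j a => f (k j a) a := by
    intro i j hij a
    dsimp only
    rw [hkf, hkf]
    exact le_iInf fun l =>
      iInf_le (fun l : Fin (j + 1) => f l a) (Fin.castLE (Nat.succ_le_succ hij) l)
  have hinf : ∀ a, ⨅ j, f (k j a) a = ⨅ i, f i a := by
    intro a
    refine le_antisymm (le_iInf fun i => (iInf_le _ i).trans ?_) (le_iInf fun j => iInf_le _ _)
    rw [hkf]
    exact (iInf_le (fun l : Fin (i + 1) => f l a) (Fin.last i)).trans (by simp)
  have h0 : ∀ a, f (k 0 a) a = f 0 a := fun a => by simp [hkf]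
  -- The running minima decrease to the infimum; convergence of the integrals along a decreasing
  -- sequence needs the finite integral of `f 0`.
  have hlim : ∫⁻ a, ⨅ i, f i a ∂μ = ⨅ j, ∫⁻ a, f (k j a) a ∂μ := by
    rw [← lintegral_iInf (fun j => hcomp _ (hk j)) hanti (by simpa only [h0] using hfin)]
    simp only [hinf]
  have hfin' : ∫⁻ a, ⨅ i, f i a ∂μ ≠ ⊤ :=
    ((lintegral_mono fun a => iInf_le _ 0).trans_lt hfin.lt_top).ne
  have hlt : ⨅ j, ∫⁻ a, f (k j a) a ∂μ < ∫⁻ a, ⨅ i, f i a ∂μ + ε := by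
    rw [← hlim]
    exact ENNReal.lt_add_right hfin' hε
  obtain ⟨j, hj⟩ := iInf_lt_iff.1 hlt
  exact ⟨k j, hk j, ⟨j, hkj j⟩, hj.le⟩

theorem lintegral_enorm_sq {α F : Type*} [MeasurableSpace α] [NormedAddCommGroup F]
    (μ : Measure α) (f : α → F) : ∫⁻ a, ‖f a‖ₑ ^ 2 ∂μ = eLpNorm f 2 μ ^ 2 := by
  rw [eLpNorm_eq_lintegral_rpow_enorm_toReal two_ne_zero ENNReal.ofNat_ne_top,
    ← ENNReal.rpow_natCast, ← ENNReal.rpow_mul]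
  simp

/-! ### Fast oscillations -/

/-- The union of every second interval of length `1 / m`. -/
def stripes (m : ℕ) : Set ℝ := {s | Even ⌊m * s⌋}

theorem measurableSet_stripes (m : ℕ) : MeasurableSet (stripes m) :=
  (Int.measurable_floor.comp (measurable_const_mul (m : ℝ))) (MeasurableSet.of_discrete (s := {i | Even i}))

/-- A shift by one stripe width exchanges the stripes with their complement; this is why stripes
capture half of an integral. -/
theorem add_mem_stripes_iff {m : ℕ} (hm : m ≠ 0) (s : ℝ) :
    s + (m : ℝ)⁻¹ ∈ stripes m ↔ s ∉ stripes m := by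
  have e : (m : ℝ) * (s + (m : ℝ)⁻¹) = m * s + 1 := by
    rw [mul_add, mul_inv_cancel₀ (Nat.cast_ne_zero.2 hm)]
  simp only [stripes, mem_ofPred_eq, e, Int.floor_add_one]
  exact Int.even_add_one

/-- Restricting to stripes takes half of an integral, up to an `L¹` modulus of continuity. -/
theorem norm_integral_stripes_sub_le {F : Type*} [NormedAddCommGroup F] [NormedSpace ℝ F]
    {f : ℝ → F} (hf : Integrable f) {m : ℕ} (hm : m ≠ 0) :
    ‖(2 : ℝ) • (∫ s in stripes m, f s) - ∫ s, f s‖ ≤ ∫ s, ‖f (s + (m : ℝ)⁻¹) - f s‖ := by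
  have hft : Integrable fun s => f (s + (m : ℝ)⁻¹) := hf.comp_add_right _
  have h1 : ∫ s in (stripes m)ᶜ, f s = ∫ s in stripes m, f (s + (m : ℝ)⁻¹) := by
    rw [← integral_indicator (measurableSet_stripes m).compl,
      ← integral_indicator (measurableSet_stripes m),
      ← integral_add_right_eq_self ((stripes m)ᶜ.indicator f) (m : ℝ)⁻¹]
    congr 1
    ext1 s
    by_cases hs : s ∈ stripes m
    · rw [indicator_of_mem hs, indicator_of_mem]
      rw [mem_compl_iff, add_mem_stripes_iff hm]
      exact not_not.2 hs
    · rw [indicator_of_notMem hs, indicator_of_notMem]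
      rw [mem_compl_iff, add_mem_stripes_iff hm]
      exact not_not.2 hs
  rw [← integral_add_compl (measurableSet_stripes m) hf, h1, two_smul, add_sub_add_left_eq_sub,
    ← integral_sub hf.integrableOn hft.integrableOn]
  refine (norm_integral_le_integral_norm _).trans ?_
  have hrev : ∀ s, ‖f s - f (s + (m : ℝ)⁻¹)‖ = ‖f (s + (m : ℝ)⁻¹) - f s‖ := fun s =>
    norm_sub_rev _ _
  simp_rw [hrev]
  exact setIntegral_le_integral (hft.sub hf).norm (Eventually.of_forall fun s => norm_nonneg _)

/-- Continuity of translations in `L¹`, as a case of the continuity of composition with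
measure-preserving maps. -/
theorem tendsto_integral_norm_translate_sub {F : Type*} [NormedAddCommGroup F] {f : ℝ → F}
    (hf : Integrable f) :
    Tendsto (fun m : ℕ => ∫ s, ‖f (s + (m : ℝ)⁻¹) - f s‖) atTop (𝓝 0) := by
  let g : ℝ → C(ℝ, ℝ) := (ContinuousMap.mk fun p : ℝ × ℝ => p.2 + p.1).curry
  have hg : Continuous g := (ContinuousMap.mk fun p : ℝ × ℝ => p.2 + p.1).curry.continuous
  have hgm : ∀ a, MeasurePreserving (g a) (volume : Measure ℝ) volume := fun a =>
    measurePreserving_add_right volume a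
  set u : Lp F 1 (volume : Measure ℝ) := hf.toL1 f with hu
  have hlim : Tendsto (fun m : ℕ => g ((m : ℝ)⁻¹)) atTop (𝓝 (g 0)) :=
    (hg.tendsto 0).comp tendsto_inv_atTop_nhds_zero_nat
  have h := Filter.Tendsto.compMeasurePreservingLp (tendsto_const_nhds (x := u)) hlim
    (fun m => hgm _) (hgm 0) ENNReal.one_ne_top
  have h0 : Lp.compMeasurePreserving (g 0) (hgm 0) u = u := by
    apply Lp.ext
    refine (Lp.coeFn_compMeasurePreserving u (hgm 0)).trans (Eventually.of_forall fun s => ?_)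
    simp [g]
  rw [h0, tendsto_iff_norm_sub_tendsto_zero] at h
  refine h.congr fun m => ?_
  rw [L1.norm_eq_integral_norm]
  have e1 := Lp.coeFn_compMeasurePreserving u (hgm ((m : ℝ)⁻¹))
  have e2 : u =ᵐ[volume] f := hf.coeFn_toL1
  have e3 := (hgm ((m : ℝ)⁻¹)).quasiMeasurePreserving.ae_eq_comp e2
  refine integral_congr_ae ?_
  filter_upwards [Lp.coeFn_sub (Lp.compMeasurePreserving (g ((m : ℝ)⁻¹)) (hgm _) u) u, e1, e2, e3]
    with s h1 h2 h3 h4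
  rw [h1, Pi.sub_apply, h2, h3, h4]
  rfl

theorem tendsto_integral_stripes {F : Type*} [NormedAddCommGroup F] [NormedSpace ℝ F]
    {f : ℝ → F} (hf : Integrable f) :
    Tendsto (fun m : ℕ => (2 : ℝ) • ∫ s in stripes m, f s) atTop (𝓝 (∫ s, f s)) := by
  rw [tendsto_iff_norm_sub_tendsto_zero]
  refine squeeze_zero' (Eventually.of_forall fun m => norm_nonneg _) ?_
    (tendsto_integral_norm_translate_sub hf)
  filter_upwards [eventually_ne_atTop 0] with m hm using norm_integral_stripes_sub_le hf hm

/-- Bounded functions oscillating on stripes have uniformly small primitives. -/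
theorem norm_integral_stripes_Iio_sub_le {F : Type*} [NormedAddCommGroup F] [NormedSpace ℝ F]
    {f : ℝ → F} (hf : Integrable f) {M : ℝ} (hM : ∀ s, ‖f s‖ ≤ M) {m : ℕ} (hm : m ≠ 0) (t : ℝ) :
    ‖(2 : ℝ) • (∫ s in stripes m ∩ Iio t, f s) - ∫ s in Iio t, f s‖ ≤
      (∫ s, ‖f (s + (m : ℝ)⁻¹) - f s‖) + M * (m : ℝ)⁻¹ := by
  have hη : (0 : ℝ) ≤ (m : ℝ)⁻¹ := by positivity
  have h := norm_integral_stripes_sub_le (hf.indicator (measurableSet_Iio (a := t))) hm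
  rw [setIntegral_indicator measurableSet_Iio, integral_indicator measurableSet_Iio] at h
  refine h.trans ?_
  have hi1 : Integrable fun s => ‖f (s + (m : ℝ)⁻¹) - f s‖ := ((hf.comp_add_right _).sub hf).norm
  -- Cutting off at `t` affects the shift only at points less than `1 / m` below `t`, where the
  -- integrand is at most `M`.
  have hi2 : Integrable ((Ico (t - (m : ℝ)⁻¹) t).indicator fun _ => M) :=
    (integrable_indicator_iff measurableSet_Ico).2 (integrableOn_const (by simp))
  have hM' : ∫ s, (Ico (t - (m : ℝ)⁻¹) t).indicator (fun _ => M) s = M * (m : ℝ)⁻¹ := by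
    rw [integral_indicator measurableSet_Ico, setIntegral_const]
    simp [Measure.real, mul_comm]
  rw [← hM', ← integral_add hi1 hi2]
  refine integral_mono_of_nonneg (Eventually.of_forall fun s => norm_nonneg _) (hi1.add hi2)
    (Eventually.of_forall fun s => ?_)
  have hM0 : 0 ≤ M := (norm_nonneg _).trans (hM 0)
  have hind : 0 ≤ (Ico (t - (m : ℝ)⁻¹) t).indicator (fun _ => M) s :=
    indicator_nonneg (fun _ _ => hM0) s
  show ‖(Iio t).indicator f (s + (m : ℝ)⁻¹) - (Iio t).indicator f s‖ ≤
    ‖f (s + (m : ℝ)⁻¹) - f s‖ + (Ico (t - (m : ℝ)⁻¹) t).indicator (fun _ => M) s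
  rcases lt_or_ge (s + (m : ℝ)⁻¹) t with h1 | h1
  · rw [indicator_of_mem (mem_Iio.2 h1), indicator_of_mem (mem_Iio.2 (by linarith))]
    linarith
  · rw [indicator_of_notMem (s := Iio t) (by simpa using h1)]
    rcases lt_or_ge s t with h2 | h2
    · rw [indicator_of_mem (s := Iio t) (mem_Iio.2 h2),
        indicator_of_mem (s := Ico _ t) ⟨by linarith, h2⟩, zero_sub, norm_neg]
      linarith [hM s, norm_nonneg (f (s + (m : ℝ)⁻¹) - f s)]
    · rw [indicator_of_notMem (s := Iio t) (by simpa using h2), sub_self, norm_zero]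
      positivity

/-! ### Relaxation in one variable -/

theorem intervalIntegral_eq_integral_Iio {L : ℝ} (g : ℝ → E3) {t : ℝ} (ht : t ∈ Icc 0 L) :
    ∫ s in (0 : ℝ)..t, g s = ∫ s in Iio t, (Ioo 0 L).indicator g s := by
  rw [intervalIntegral.integral_of_le ht.1, integral_Ioc_eq_integral_Ioo,
    setIntegral_indicator measurableSet_Ioo]
  congr 2
  ext s
  simp only [mem_Ioo, mem_inter_iff, mem_Iio]
  exact ⟨fun h => ⟨h.2, h.1, h.2.trans_le ht.2⟩, fun h => ⟨h.2.1, h.1⟩⟩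

theorem lintegral_quadratic_ne_top {α F : Type*} [MeasurableSpace α] [NormedAddCommGroup F]
    {μ : Measure α} [IsFiniteMeasure μ] {w : α → F} (hw : MemLp w 2 μ) (C : ℝ≥0) :
    ∫⁻ s, C * (1 + ‖w s‖ₑ ^ 2) ∂μ ≠ ⊤ := by
  rw [lintegral_const_mul' _ _ ENNReal.coe_ne_top, lintegral_add_left measurable_const,
    lintegral_enorm_sq]
  refine ENNReal.mul_ne_top ENNReal.coe_ne_top (ENNReal.add_ne_top.2 ⟨?_, ?_⟩)
  · simp
  · exact ENNReal.pow_ne_top hw.eLpNorm_ne_top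

theorem IsRegularPotential.lintegral_midpointHull_ne_top {V : ℝ → E3 × E3 × E3 → ℝ≥0∞}
    (hV : IsRegularPotential V) {μ : Measure ℝ} [IsFiniteMeasure μ] {w : ℝ → E3} (hw : MemLp w 2 μ)
    (n : ℕ) : ∫⁻ s, midpointHull^[n] (fiberMin V s) (w s) ∂μ ≠ ⊤ := by
  obtain ⟨C, hC⟩ := hV.fiberMin_le
  refine ((lintegral_mono fun s => ?_).trans_lt (lintegral_quadratic_ne_top hw C).lt_top).ne
  exact (midpointHull_iterate_le _ n _).trans (hC s _)

theorem exists_bound_comp_nat {F : Type*} [NormedAddCommGroup F] {α : Type*} (x : ℕ → F)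
    {k : α → ℕ} {N : ℕ} (hk : ∀ a, k a ≤ N) : ∃ M, ∀ a, ‖x (k a)‖ ≤ M :=
  ⟨∑ i ∈ Finset.range (N + 1), ‖x i‖, fun a =>
    Finset.single_le_sum (f := fun i => ‖x i‖) (fun _ _ => norm_nonneg _)
      (Finset.mem_range.2 (Nat.lt_succ_of_le (hk a)))⟩

/-- Realises one splitting. A direction `d s`, almost optimal for the next hull at `z s`, is
selected measurably; the new curve is `z + d` on fine stripes and `z - d` off them. The fluctuation
averages out in the primitive, uniformly in the endpoint, while the energy tends to the mean of the
energies of `z + d` and `z - d`. -/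
theorem IsRegularPotential.exists_oscillation {V : ℝ → E3 × E3 × E3 → ℝ≥0∞}
    (hV : IsRegularPotential V) {L : ℝ} {z : ℝ → E3} (hz : Measurable z)
    (hz2 : MemLp z 2 (volume.restrict (Ioo 0 L))) (n : ℕ) {ε : ℝ} (hε : 0 < ε) :
    ∃ z' : ℝ → E3, Measurable z' ∧ MemLp z' 2 (volume.restrict (Ioo 0 L)) ∧
      (∀ t ∈ Icc 0 L, ‖(∫ s in (0 : ℝ)..t, z' s) - ∫ s in (0 : ℝ)..t, z s‖ ≤ ε) ∧
      ∫⁻ s in Ioo 0 L, midpointHull^[n] (fiberMin V s) (z' s) ≤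
        (∫⁻ s in Ioo 0 L, midpointHull^[n + 1] (fiberMin V s) (z s)) + ENNReal.ofReal ε := by
  set μ := (volume : Measure ℝ).restrict (Ioo 0 L) with hμ
  set H : ℝ → E3 → ℝ≥0∞ := fun s => midpointHull^[n] (fiberMin V s) with hH
  have hHm : ∀ w : ℝ → E3, Measurable w → Measurable fun s => H s (w s) := fun w hw =>
    (hV.measurable_midpointHull n).comp (hw.prodMk measurable_id)
  have hHfin : ∀ w : ℝ → E3, MemLp w 2 μ → ∫⁻ s, H s (w s) ∂μ ≠ ⊤ := fun w hw =>
    hV.lintegral_midpointHull_ne_top hw n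
  have hHtop : ∀ s w, H s w ≠ ⊤ := fun s w =>
    ((midpointHull_iterate_le _ n w).trans_lt (hV.fiberMin_ne_top s w).lt_top).ne
  let δ := TopologicalSpace.denseSeq E3
  -- The selected index is bounded, so `d` takes finitely many values; this gives the bound needed
  -- for uniformly small primitives and keeps `z + d` and `z - d` in `L²`.
  obtain ⟨k, hk, ⟨N, hkN⟩, hsel⟩ := exists_measurable_selection (μ := μ)
    (f := fun k s => 2⁻¹ * (H s (z s + δ k) + H s (z s - δ k)))
    (fun k => ((hHm _ (hz.add_const _)).add (hHm _ (hz.sub_const _))).const_mul _)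
    (by
      rw [lintegral_const_mul' _ _ (by simp), lintegral_add_left (hHm _ (hz.add_const _))]
      exact ENNReal.mul_ne_top (by simp) (ENNReal.add_ne_top.2
        ⟨hHfin _ (hz2.add (memLp_const _)), hHfin _ (hz2.sub (memLp_const _))⟩))
    (ε := ENNReal.ofReal (ε / 2)) (by simpa using hε)
  have hinf : ∀ s, ⨅ k, 2⁻¹ * (H s (z s + δ k) + H s (z s - δ k)) =
      midpointHull^[n + 1] (fiberMin V s) (z s) := fun s => by
    rw [Function.iterate_succ_apply', midpointHull_eq_iInf
      (upperSemicontinuous_iterate_midpointHull (hV.upperSemicontinuous_fiberMin s) n)]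
  simp only [hinf] at hsel
  set d : ℝ → E3 := fun s => δ (k s) with hd
  have hdm : Measurable d := (measurable_from_nat (f := δ)).comp hk
  obtain ⟨M, hM⟩ : ∃ M, ∀ s, ‖d s‖ ≤ M := exists_bound_comp_nat δ hkN
  have hd2 : MemLp d 2 μ :=
    MemLp.of_bound hdm.aestronglyMeasurable M (Eventually.of_forall hM)
  have hM0 : 0 ≤ M := (norm_nonneg _).trans (hM 0)
  have hp := hHfin _ (hz2.add hd2)
  have hm := hHfin _ (hz2.sub hd2)
  have hpm := hHm _ (hz.add hdm)
  have hmm := hHm _ (hz.sub hdm)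
  simp only [Pi.add_apply, Pi.sub_apply] at hp hm hpm hmm
  set Fp : ℝ → ℝ := fun s => (H s (z s + d s)).toReal with hFp
  set Fm : ℝ → ℝ := fun s => (H s (z s - d s)).toReal with hFm
  have hFpi : Integrable Fp μ := integrable_toReal_of_lintegral_ne_top hpm.aemeasurable hp
  have hFmi : Integrable Fm μ := integrable_toReal_of_lintegral_ne_top hmm.aemeasurable hm
  have hD : Integrable ((Ioo 0 L).indicator d) :=
    (integrable_indicator_iff measurableSet_Ioo).2 (hd2.integrable (by norm_num))
  have hDM : ∀ s, ‖(Ioo 0 L).indicator d s‖ ≤ M := fun s =>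
    (norm_indicator_le_norm_self _ _).trans (hM s)
  classical
  set z' : ℕ → ℝ → E3 := fun m s => if s ∈ stripes m then z s + d s else z s - d s with hz'
  have hz'm : ∀ m, Measurable (z' m) := fun m =>
    Measurable.ite (measurableSet_stripes m) (hz.add hdm) (hz.sub hdm)
  have hz'2 : ∀ m, MemLp (z' m) 2 μ := fun m => by
    have h1 : MemLp (fun s => z' m s - z s) 2 μ := by
      refine MemLp.of_bound ((hz'm m).sub hz).aestronglyMeasurable M (Eventually.of_forall fun s => ?_)
      by_cases hs : s ∈ stripes m
      · simpa [hz', hs] using hM s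
      · simpa [hz', hs] using hM s
    convert h1.add hz2 using 1
    ext1 s
    simp
  have hprim : ∀ m ≠ 0, ∀ t ∈ Icc 0 L,
      ‖(∫ s in (0 : ℝ)..t, z' m s) - ∫ s in (0 : ℝ)..t, z s‖ ≤
        (∫ s, ‖(Ioo 0 L).indicator d (s + (m : ℝ)⁻¹) - (Ioo 0 L).indicator d s‖) +
          M * (m : ℝ)⁻¹ := by
    intro m hm0 t ht
    refine le_of_eq_of_le (congrArg _ ?_) (norm_integral_stripes_Iio_sub_le hD hDM hm0 t)
    have i1 : Integrable ((Ioo 0 L).indicator (z' m)) :=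
      (integrable_indicator_iff measurableSet_Ioo).2 ((hz'2 m).integrable (by norm_num))
    have i2 : Integrable ((Ioo 0 L).indicator z) :=
      (integrable_indicator_iff measurableSet_Ioo).2 (hz2.integrable (by norm_num))
    rw [intervalIntegral_eq_integral_Iio _ ht, intervalIntegral_eq_integral_Iio _ ht,
      ← integral_sub i1.integrableOn i2.integrableOn, ← integral_smul]
    have e1 : ∫ s in stripes m ∩ Iio t, (2 : ℝ) • (Ioo 0 L).indicator d s =
        ∫ s in Iio t, (stripes m).indicator (fun s => (2 : ℝ) • (Ioo 0 L).indicator d s) s := by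
      rw [setIntegral_indicator (measurableSet_stripes m), inter_comm]
    rw [e1, ← integral_sub]
    · congr 1
      ext1 s
      by_cases h1 : s ∈ Ioo 0 L
      · by_cases h2 : s ∈ stripes m
        · simp only [hz', h1, h2, indicator_of_mem, if_true]
          module
        · simp only [hz', h1, h2, indicator_of_mem, if_false, not_false_iff, indicator_of_notMem]
          module
      · by_cases h2 : s ∈ stripes m <;> simp [h1, h2]
    · exact ((hD.smul (2 : ℝ)).indicator (measurableSet_stripes m)).integrableOn
    · exact hD.integrableOn
  have hprimlim : Tendsto (fun m : ℕ => (∫ s, ‖(Ioo 0 L).indicator d (s + (m : ℝ)⁻¹) -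
      (Ioo 0 L).indicator d s‖) + M * (m : ℝ)⁻¹) atTop (𝓝 0) := by
    simpa using (tendsto_integral_norm_translate_sub hD).add
      (tendsto_inv_atTop_nhds_zero_nat.const_mul M)
  have hG : Integrable ((Ioo 0 L).indicator fun s => Fp s - Fm s) :=
    (integrable_indicator_iff measurableSet_Ioo).2 (hFpi.sub hFmi)
  -- The energy is that of `z - d` plus the integral of `Fp - Fm` over the stripes, and the latter
  -- tends to half of the full integral.
  have hen : ∀ m, (∫⁻ s, H s (z' m s) ∂μ).toReal =
      (∫ s in stripes m, (Ioo 0 L).indicator (fun s => Fp s - Fm s) s) + ∫ s, Fm s ∂μ := by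
    intro m
    have hi : Integrable ((stripes m).indicator fun s => Fp s - Fm s) μ :=
      (hFpi.sub hFmi).indicator (measurableSet_stripes m)
    rw [← integral_toReal (hHm _ (hz'm m)).aemeasurable
      (Eventually.of_forall fun s => (hHtop s _).lt_top), ← integral_indicator
      (measurableSet_stripes m), indicator_indicator, inter_comm, ← indicator_indicator,
      integral_indicator measurableSet_Ioo, ← hμ, ← integral_add
      hi hFmi]
    congr 1
    ext1 s
    by_cases h2 : s ∈ stripes m
    · simp [hz', h2, hFp]
    · simp [hz', h2, hFm]
  have hsum : ∫⁻ s, 2⁻¹ * (H s (z s + d s) + H s (z s - d s)) ∂μ =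
      2⁻¹ * (∫⁻ s, H s (z s + d s) ∂μ + ∫⁻ s, H s (z s - d s) ∂μ) := by
    rw [lintegral_const_mul' _ _ (by simp), lintegral_add_left hpm]
  have hen' : (∫⁻ s, 2⁻¹ * (H s (z s + d s) + H s (z s - d s)) ∂μ).toReal =
      (∫ s, (Ioo 0 L).indicator (fun s => Fp s - Fm s) s) / 2 + ∫ s, Fm s ∂μ := by
    rw [hsum, ENNReal.toReal_mul, ENNReal.toReal_add hp hm, integral_indicator measurableSet_Ioo,
      ← hμ, integral_sub hFpi hFmi, hFp, hFm,
      integral_toReal hpm.aemeasurable (Eventually.of_forall fun s => (hHtop s _).lt_top),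
      integral_toReal hmm.aemeasurable (Eventually.of_forall fun s => (hHtop s _).lt_top)]
    simp only [ENNReal.toReal_inv, ENNReal.toReal_ofNat]
    ring
  have henlim : Tendsto (fun m => (∫⁻ s, H s (z' m s) ∂μ).toReal) atTop
      (𝓝 (∫⁻ s, 2⁻¹ * (H s (z s + d s) + H s (z s - d s)) ∂μ).toReal) := by
    simp only [hen, hen']
    refine Tendsto.add_const _ ?_
    have := (tendsto_integral_stripes hG).const_mul (1 / 2)
    simp only [smul_eq_mul] at this
    refine (this.congr fun m => ?_).trans_eq ?_
    · ring
    · ring_nf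
  have hev : ∀ᶠ m in atTop, (∫⁻ s, H s (z' m s) ∂μ).toReal <
      (∫⁻ s, 2⁻¹ * (H s (z s + d s) + H s (z s - d s)) ∂μ).toReal + ε / 2 :=
    henlim.eventually_lt_const (by linarith)
  obtain ⟨m, hm1, hm2, hm0⟩ := (hev.and
    ((hprimlim.eventually_lt_const hε).and (eventually_ne_atTop 0))).exists
  refine ⟨z' m, hz'm m, hz'2 m, fun t ht => (hprim m hm0 t ht).trans hm2.le, ?_⟩
  have hfs : ∫⁻ s, 2⁻¹ * (H s (z s + d s) + H s (z s - d s)) ∂μ ≠ ⊤ := by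
    rw [hsum]
    exact ENNReal.mul_ne_top (by simp) (ENNReal.add_ne_top.2 ⟨hp, hm⟩)
  calc ∫⁻ s, H s (z' m s) ∂μ = ENNReal.ofReal (∫⁻ s, H s (z' m s) ∂μ).toReal :=
        (ENNReal.ofReal_toReal (hHfin _ (hz'2 m))).symm
    _ ≤ ENNReal.ofReal ((∫⁻ s, 2⁻¹ * (H s (z s + d s) + H s (z s - d s)) ∂μ).toReal + ε / 2) :=
        ENNReal.ofReal_le_ofReal hm1.le
    _ = (∫⁻ s, 2⁻¹ * (H s (z s + d s) + H s (z s - d s)) ∂μ) + ENNReal.ofReal (ε / 2) := by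
        rw [ENNReal.ofReal_add ENNReal.toReal_nonneg (by positivity), ENNReal.ofReal_toReal hfs]
    _ ≤ _ := by
        refine (add_le_add_left hsel _).trans ?_
        rw [add_assoc, ← ENNReal.ofReal_add (by positivity) (by positivity), add_halves]

theorem IsRegularPotential.exists_iterated_oscillation {V : ℝ → E3 × E3 × E3 → ℝ≥0∞}
    (hV : IsRegularPotential V) {L : ℝ} (n : ℕ) {z : ℝ → E3} (hz : Measurable z)
    (hz2 : MemLp z 2 (volume.restrict (Ioo 0 L))) {ε : ℝ} (hε : 0 < ε) :
    ∃ z' : ℝ → E3, Measurable z' ∧ MemLp z' 2 (volume.restrict (Ioo 0 L)) ∧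
      (∀ t ∈ Icc 0 L, ‖(∫ s in (0 : ℝ)..t, z' s) - ∫ s in (0 : ℝ)..t, z s‖ ≤ ε) ∧
      ∫⁻ s in Ioo 0 L, fiberMin V s (z' s) ≤
        (∫⁻ s in Ioo 0 L, midpointHull^[n] (fiberMin V s) (z s)) + ENNReal.ofReal ε := by
  induction n generalizing z ε with
  | zero => exact ⟨z, hz, hz2, fun t _ => by simp [hε.le], le_self_add⟩
  | succ n ih =>
    obtain ⟨z₁, hz₁, hz₁2, hp₁, he₁⟩ := hV.exists_oscillation hz hz2 n (half_pos hε)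
    obtain ⟨z₂, hz₂, hz₂2, hp₂, he₂⟩ := ih hz₁ hz₁2 (half_pos hε)
    refine ⟨z₂, hz₂, hz₂2, fun t ht => ?_, ?_⟩
    · refine (norm_sub_le_norm_sub_add_norm_sub _ (∫ s in (0 : ℝ)..t, z₁ s) _).trans ?_
      linarith [hp₁ t ht, hp₂ t ht]
    · refine he₂.trans ((add_le_add_left he₁ _).trans ?_)
      rw [add_assoc, ← ENNReal.ofReal_add (by positivity) (by positivity), add_halves]

/-- Three errors of size `ε / 3`: stopping the decreasing sequence of hulls at a finite `n`,
realising these `n` splittings by oscillations, and selecting almost optimal values of the remaining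
two columns. -/
theorem IsRegularPotential.exists_relaxation {V : ℝ → E3 × E3 × E3 → ℝ≥0∞}
    (hV : IsRegularPotential V) {L : ℝ} {z : ℝ → E3} (hz : Measurable z)
    (hz2 : MemLp z 2 (volume.restrict (Ioo 0 L))) {ε : ℝ} (hε : 0 < ε) :
    ∃ p : ℝ → E3 × E3 × E3, Measurable p ∧ MemLp p 2 (volume.restrict (Ioo 0 L)) ∧
      (∀ t ∈ Icc 0 L, ‖(∫ s in (0 : ℝ)..t, (p s).1) - ∫ s in (0 : ℝ)..t, z s‖ ≤ ε) ∧
      ∫⁻ s in Ioo 0 L, V s (p s) ≤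
        (∫⁻ s in Ioo 0 L, relaxedDensity V s (z s)) + ENNReal.ofReal ε := by
  set μ := (volume : Measure ℝ).restrict (Ioo 0 L) with hμ
  have hlim : ∫⁻ s, relaxedDensity V s (z s) ∂μ =
      ⨅ n, ∫⁻ s, midpointHull^[n] (fiberMin V s) (z s) ∂μ :=
    lintegral_iInf (fun n => (hV.measurable_midpointHull n).comp (hz.prodMk measurable_id))
      (fun i j hij s => antitone_iterate_midpointHull _ _ hij)
      (hV.lintegral_midpointHull_ne_top hz2 0)
  have hfin : ∫⁻ s, relaxedDensity V s (z s) ∂μ ≠ ⊤ := by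
    rw [hlim]
    exact ((iInf_le _ 0).trans_lt (hV.lintegral_midpointHull_ne_top hz2 0).lt_top).ne
  have hlt := ENNReal.lt_add_right (b := ENNReal.ofReal (ε / 3)) hfin (by simpa using hε)
  rw [hlim] at hlt
  obtain ⟨n, hn⟩ := iInf_lt_iff.1 hlt
  rw [← hlim] at hn
  obtain ⟨z', hz', hz'2, hprim, hen⟩ := hV.exists_iterated_oscillation n hz hz2
    (show 0 < ε / 3 by positivity)
  let δ := TopologicalSpace.denseSeq (E3 × E3)
  have hδ0 : ∫⁻ s, V s (z' s, δ 0) ∂μ ≠ ⊤ := by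
    obtain ⟨C, hC⟩ := hV.bound
    refine ((lintegral_mono fun s => hC s _).trans_lt ?_).ne
    simp only [add_assoc]
    rw [lintegral_const_mul' _ _ ENNReal.coe_ne_top, lintegral_add_left measurable_const,
      lintegral_add_right _ measurable_const, lintegral_enorm_sq]
    refine ENNReal.mul_lt_top ENNReal.coe_lt_top (ENNReal.add_lt_top.2 ⟨by simp, ?_⟩)
    refine ENNReal.add_lt_top.2 ⟨ENNReal.pow_lt_top hz'2.eLpNorm_lt_top, ?_⟩
    rw [lintegral_const]
    exact ENNReal.mul_lt_top (ENNReal.add_lt_top.2 ⟨ENNReal.pow_lt_top (by simp),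
      ENNReal.pow_lt_top (by simp)⟩) (measure_lt_top _ _)
  obtain ⟨k, hk, ⟨N, hkN⟩, hsel⟩ := exists_measurable_selection (μ := μ)
    (f := fun k s => V s (z' s, δ k))
    (fun k => hV.measurable_uncurry.comp ((hz'.prodMk measurable_const).prodMk measurable_id)) hδ0
    (ε := ENNReal.ofReal (ε / 3)) (by simpa using hε)
  simp only [δ, ← hV.fiberMin_eq] at hsel
  have hy : Measurable fun s => δ (k s) := (measurable_from_nat (f := δ)).comp hk
  obtain ⟨M, hM⟩ := exists_bound_comp_nat δ hkN
  have hy2 : MemLp (fun s => δ (k s)) 2 μ :=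
    MemLp.of_bound hy.aestronglyMeasurable M (Eventually.of_forall hM)
  refine ⟨fun s => (z' s, δ (k s)), hz'.prodMk hy, ?_, fun t ht => ?_, ?_⟩
  · exact memLp_prod_iff.2 ⟨hz'2, hy2⟩
  · exact (hprim t ht).trans (by linarith)
  · refine hsel.trans ((add_le_add_left (hen.trans (add_le_add_left hn.le _)) _).trans ?_)
    rw [add_assoc, add_assoc, ← ENNReal.ofReal_add (by positivity) (by positivity),
      ← ENNReal.ofReal_add (by positivity) (by positivity)]
    refine add_le_add_right (ENNReal.ofReal_le_ofReal ?_) _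
    linarith

theorem ENNReal_add_sq_le (a b : ℝ≥0∞) : (a + b) ^ 2 ≤ 2 * (a ^ 2 + b ^ 2) := by
  have h := ENNReal.rpow_add_le_mul_rpow_add_rpow a b one_le_two
  norm_num at h
  exact h

/-- Quadratic growth makes the energy upper semicontinuous along `L²` approximations. Along an
almost everywhere convergent subsequence the energy density is split into a part dominated by a
fixed integrable function and a multiple of the squared `L²` error. -/
theorem IsRegularPotential.exists_smooth_near {V : ℝ → E3 × E3 × E3 → ℝ≥0∞}
    (hV : IsRegularPotential V) {L : ℝ} {p : ℝ → E3 × E3 × E3} (hp : Measurable p)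
    (hp2 : MemLp p 2 (volume.restrict (Ioo 0 L))) {ε : ℝ} (hε : 0 < ε) :
    ∃ p' : ℝ → E3 × E3 × E3, ContDiff ℝ ∞ p' ∧ HasCompactSupport p' ∧
      ∫ s in Ioo 0 L, ‖(p' s).1 - (p s).1‖ ≤ ε ∧
      ∫⁻ s in Ioo 0 L, V s (p' s) ≤ (∫⁻ s in Ioo 0 L, V s (p s)) + ENNReal.ofReal ε := by
  set μ := (volume : Measure ℝ).restrict (Ioo 0 L) with hμ
  obtain ⟨C, hC⟩ := hV.bound
  have hC' : ∀ s q, V s q ≤ (3 * C : ℝ≥0) * (1 + ‖q‖ₑ ^ 2) := by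
    intro s q
    refine (hC s q).trans ?_
    have h1 : ‖q.1‖ₑ ≤ ‖q‖ₑ := enorm_le_iff_norm_le.2 (norm_fst_le q)
    have h2 : ‖q.2.1‖ₑ ≤ ‖q‖ₑ :=
      enorm_le_iff_norm_le.2 ((norm_fst_le q.2).trans (norm_snd_le q))
    have h3 : ‖q.2.2‖ₑ ≤ ‖q‖ₑ :=
      enorm_le_iff_norm_le.2 ((norm_snd_le q.2).trans (norm_snd_le q))
    calc (C : ℝ≥0∞) * (1 + ‖q.1‖ₑ ^ 2 + ‖q.2.1‖ₑ ^ 2 + ‖q.2.2‖ₑ ^ 2)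
        ≤ C * (1 + ‖q‖ₑ ^ 2 + ‖q‖ₑ ^ 2 + ‖q‖ₑ ^ 2) := by gcongr
      _ ≤ C * (3 + ‖q‖ₑ ^ 2 + ‖q‖ₑ ^ 2 + ‖q‖ₑ ^ 2) := by
          gcongr
          norm_num
      _ = (3 * C : ℝ≥0) * (1 + ‖q‖ₑ ^ 2) := by
          push_cast
          ring
  have hsm : ∀ k : ℕ, ∃ g : ℝ → E3 × E3 × E3, HasCompactSupport g ∧ ContDiff ℝ ∞ g ∧
      eLpNorm (p - g) 2 μ ≤ ENNReal.ofReal (1 / ((k : ℝ) + 1)) := fun k =>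
    hp2.exist_eLpNorm_sub_le (by simp) (by norm_num) (by positivity)
  choose g hgc hgs hgε using hsm
  have hg0 : Tendsto (fun k => eLpNorm (g k - p) 2 μ) atTop (𝓝 0) := by
    have h1 : Tendsto (fun k : ℕ => ENNReal.ofReal (1 / ((k : ℝ) + 1))) atTop (𝓝 0) := by
      simpa using ENNReal.tendsto_ofReal tendsto_one_div_add_atTop_nhds_zero_nat
    refine tendsto_of_tendsto_of_tendsto_of_le_of_le tendsto_const_nhds h1
      (fun _ => zero_le) fun k => ?_
    rw [eLpNorm_sub_comm]
    exact hgε k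
  have hgm : ∀ k, AEStronglyMeasurable (g k) μ := fun k => (hgs k).continuous.aestronglyMeasurable
  obtain ⟨φ, hφ, hae⟩ := (tendstoInMeasure_of_tendsto_eLpNorm two_ne_zero hgm
    hp.aestronglyMeasurable hg0).exists_seq_tendsto_ae
  have hg0' := hg0.comp hφ.tendsto_atTop
  have hVg : ∀ k, Measurable fun s => V s (g (φ k) s) := fun k =>
    hV.measurable_uncurry.comp ((hgs _).continuous.measurable.prodMk measurable_id)
  -- `B` comes from the growth bound and `‖g‖² ≤ 2 ‖p‖² + 2 ‖g - p‖²`: whatever exceeds `B` is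
  -- controlled by the approximation error alone.
  set B : ℝ → ℝ≥0∞ := fun s => (3 * C : ℝ≥0) * (1 + 2 * ‖p s‖ₑ ^ 2) with hB
  have hBm : Measurable B := (((hp.enorm.pow_const 2).const_mul 2).const_add 1).const_mul _
  have hBfin : ∫⁻ s, B s ∂μ ≠ ⊤ := by
    rw [hB, lintegral_const_mul' _ _ ENNReal.coe_ne_top, lintegral_add_left measurable_const,
      lintegral_const_mul' _ _ (by simp), lintegral_enorm_sq]
    exact ENNReal.mul_ne_top ENNReal.coe_ne_top (ENNReal.add_ne_top.2 ⟨by simp,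
      ENNReal.mul_ne_top (by simp) (ENNReal.pow_ne_top hp2.eLpNorm_ne_top)⟩)
  have hsplit : ∀ k s, V s (g (φ k) s) ≤
      min (V s (g (φ k) s)) (B s) + (3 * C : ℝ≥0) * (2 * ‖(g (φ k) - p) s‖ₑ ^ 2) := by
    intro k s
    have h1 : V s (g (φ k) s) ≤ B s + (3 * C : ℝ≥0) * (2 * ‖(g (φ k) - p) s‖ₑ ^ 2) := by
      refine (hC' s _).trans ?_
      rw [hB]
      dsimp only
      rw [← mul_add, add_assoc, ← mul_add]
      have h2 : ‖g (φ k) s‖ₑ ≤ ‖p s‖ₑ + ‖(g (φ k) - p) s‖ₑ := by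
        have := enorm_add_le (p s) ((g (φ k) - p) s)
        simpa using this
      gcongr
      calc ‖g (φ k) s‖ₑ ^ 2 ≤ (‖p s‖ₑ + ‖(g (φ k) - p) s‖ₑ) ^ 2 := by gcongr
        _ ≤ _ := ENNReal_add_sq_le _ _
    rcases le_total (V s (g (φ k) s)) (B s) with h | h
    · rw [min_eq_left h]
      exact le_self_add
    · rw [min_eq_right h]
      exact h1
  have hmin : Tendsto (fun k => ∫⁻ s, min (V s (g (φ k) s)) (B s) ∂μ) atTop
      (𝓝 (∫⁻ s, min (V s (p s)) (B s) ∂μ)) := by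
    refine tendsto_lintegral_of_dominated_convergence B (fun k => (hVg k).min hBm)
      (fun k => Eventually.of_forall fun s => min_le_right _ _) hBfin ?_
    filter_upwards [hae] with s hs
    exact (((hV.continuous s).tendsto _).comp hs).min tendsto_const_nhds
  have hr : Tendsto (fun k => ∫⁻ s, (3 * C : ℝ≥0) * (2 * ‖(g (φ k) - p) s‖ₑ ^ 2) ∂μ) atTop
      (𝓝 0) := by
    have e : ∀ k, ∫⁻ s, (3 * C : ℝ≥0) * (2 * ‖(g (φ k) - p) s‖ₑ ^ 2) ∂μ =
        (3 * C : ℝ≥0) * (2 * eLpNorm (g (φ k) - p) 2 μ ^ 2) := fun k => by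
      rw [lintegral_const_mul' _ _ ENNReal.coe_ne_top, lintegral_const_mul' _ _ (by simp),
        lintegral_enorm_sq]
    simp only [e]
    have h1 := ENNReal.Tendsto.const_mul (a := ((3 * C : ℝ≥0) : ℝ≥0∞)) (ENNReal.Tendsto.const_mul
      (a := 2) (ENNReal.Tendsto.pow (n := 2) hg0') (Or.inr (by simp)))
      (Or.inr ENNReal.coe_ne_top)
    simpa using h1
  have hVfin : ∫⁻ s, V s (p s) ∂μ ≠ ⊤ :=
    ((lintegral_mono fun s => hC' s _).trans_lt (lintegral_quadratic_ne_top hp2 _).lt_top).ne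
  have hlt : ∫⁻ s, min (V s (p s)) (B s) ∂μ + 0 < ∫⁻ s, V s (p s) ∂μ + ENNReal.ofReal ε := by
    rw [add_zero]
    refine (lintegral_mono fun s => min_le_left _ _).trans_lt ?_
    exact ENNReal.lt_add_right hVfin (by simpa using hε)
  have hL1 : Tendsto (fun k => eLpNorm (g (φ k) - p) 1 μ) atTop (𝓝 0) := by
    have h1 : Tendsto (fun k => eLpNorm (g (φ k) - p) 2 μ *
        μ univ ^ (1 / (1 : ℝ≥0∞).toReal - 1 / (2 : ℝ≥0∞).toReal)) atTop (𝓝 0) := by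
      have := ENNReal.Tendsto.mul_const hg0'
        (b := μ univ ^ (1 / (1 : ℝ≥0∞).toReal - 1 / (2 : ℝ≥0∞).toReal)) (Or.inr (by
          refine ENNReal.rpow_ne_top_of_nonneg (by norm_num) (measure_ne_top _ _)))
      simpa using this
    refine tendsto_of_tendsto_of_tendsto_of_le_of_le tendsto_const_nhds h1
      (fun _ => zero_le) fun k => ?_
    exact eLpNorm_le_eLpNorm_mul_rpow_measure_univ (by norm_num)
      ((hgm _).sub hp.aestronglyMeasurable)
  obtain ⟨k, hk1, hk2⟩ := (((hmin.add hr).eventually_lt_const hlt).and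
    (hL1.eventually_lt_const (show 0 < ENNReal.ofReal ε by simpa using hε))).exists
  refine ⟨g (φ k), hgs _, hgc _, ?_, ?_⟩
  · rw [integral_norm_eq_lintegral_enorm (f := fun s => (g (φ k) s).1 - (p s).1)
      (((hgs _).continuous.fst.aestronglyMeasurable).sub hp.fst.aestronglyMeasurable)]
    refine ENNReal.toReal_le_of_le_ofReal hε.le ?_
    refine le_trans ?_ hk2.le
    rw [eLpNorm_one_eq_lintegral_enorm]
    refine lintegral_mono fun s => ?_
    exact enorm_le_iff_norm_le.2 (norm_fst_le ((g (φ k) - p) s))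
  · refine (lintegral_mono fun s => hsplit k s).trans ?_
    rw [lintegral_add_left ((hVg k).min hBm)]
    exact hk1.le

/-- Smooth maps whose energy is close to the relaxed energy of `z`, with first component close to
`z` in the sense of primitives. -/
theorem IsRegularPotential.exists_smooth_recovery {V : ℝ → E3 × E3 × E3 → ℝ≥0∞}
    (hV : IsRegularPotential V) {L : ℝ} {z : ℝ → E3}
    (hz2 : MemLp z 2 (volume.restrict (Ioo 0 L))) {ε : ℝ} (hε : 0 < ε) :
    ∃ p : ℝ → E3 × E3 × E3, ContDiff ℝ ∞ p ∧ HasCompactSupport p ∧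
      (∀ t ∈ Icc 0 L, ‖(∫ s in (0 : ℝ)..t, (p s).1) - ∫ s in (0 : ℝ)..t, z s‖ ≤ ε) ∧
      ∫⁻ s in Ioo 0 L, V s (p s) ≤
        (∫⁻ s in Ioo 0 L, relaxedDensity V s (z s)) + ENNReal.ofReal ε := by
  obtain ⟨z', hz'm, hzz'⟩ : ∃ z', StronglyMeasurable z' ∧ z =ᵐ[volume.restrict (Ioo 0 L)] z' :=
    ⟨_, hz2.1.stronglyMeasurable_mk, hz2.1.ae_eq_mk⟩
  have hz'2 : MemLp z' 2 (volume.restrict (Ioo 0 L)) := hz2.ae_eq hzz'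
  obtain ⟨q, hq, hq2, hqp, hqe⟩ := hV.exists_relaxation hz'm.measurable hz'2 (half_pos hε)
  obtain ⟨p, hps, hpc, hpq, hpe⟩ := hV.exists_smooth_near hq hq2 (half_pos hε)
  refine ⟨p, hps, hpc, fun t ht => ?_, ?_⟩
  · have h1 : IntegrableOn (fun s => (p s).1) (Ioo 0 L) :=
      (hps.continuous.fst.integrableOn_Icc).mono_set Ioo_subset_Icc_self
    have h2 : IntegrableOn (fun s => (q s).1) (Ioo 0 L) := hq2.fst.integrable (by norm_num)
    have e : ∫ s in (0 : ℝ)..t, z s = ∫ s in (0 : ℝ)..t, z' s := by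
      rw [← sub_eq_zero, ← norm_le_zero_iff]
      refine (norm_intervalIntegral_sub_le (hz2.integrable (by norm_num))
        (hz'2.integrable (by norm_num)) ht).trans_eq ?_
      rw [integral_congr_ae (g := fun _ => (0 : ℝ)) (hzz'.mono fun s hs => by simp [hs])]
      simp
    rw [e]
    refine (norm_sub_le_norm_sub_add_norm_sub _ (∫ s in (0 : ℝ)..t, (q s).1) _).trans ?_
    linarith [hqp t ht, (norm_intervalIntegral_sub_le h1 h2 ht).trans hpq]
  · have e : ∫⁻ s in Ioo 0 L, relaxedDensity V s (z s) =
        ∫⁻ s in Ioo 0 L, relaxedDensity V s (z' s) :=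
      lintegral_congr_ae (hzz'.mono fun s hs => by simp only [hs])
    rw [e]
    refine hpe.trans ((add_le_add_left hqe _).trans ?_)
    rw [add_assoc, ← ENNReal.ofReal_add (by positivity) (by positivity), add_halves]

/-! ### Geometry of the thin beam -/

/-- The `k`-th frame coordinate of `ξ ν₂' + ζ ν₃'`. -/
def shear (L : ℝ) (R₀ : ℝ → M3) (k : Fin 3) (x : ℝ × ℝ × ℝ) : ℝ :=
  ∑ i, R₀ x.1 i k * (x.2.1 * derivWithin (fun s => column (R₀ s) 1) (Icc 0 L) x.1 i +
    x.2.2 * derivWithin (fun s => column (R₀ s) 2) (Icc 0 L) x.1 i)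

/-- The columns of `A (∇_h Ψ^(h))⁻¹ R₀`, where `A` is the scaled gradient built from `g`. -/
def framedGrad (β : Fin 3 → ℝ × ℝ × ℝ → ℝ) (h : ℝ) (g : Fin 3 → ℝ × ℝ × ℝ → E3)
    (x : ℝ × ℝ × ℝ) : E3 × E3 × E3 :=
  ((1 + h * β 0 x)⁻¹ • (g 0 x - (β 1 x) • g 1 x - (β 2 x) • g 2 x), h⁻¹ • g 1 x, h⁻¹ • g 2 x)

theorem contDiffOn_column {L : ℝ} {γ : ℝ → E3} {R₀ : ℝ → M3} (hγ : IsFramedCurve L γ R₀)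
    (k : Fin 3) : ContDiffOn ℝ 1 (fun s => column (R₀ s) k) (Icc 0 L) := by
  let l : M3 →ₗ[ℝ] E3 :=
    { toFun := fun F => column F k
      map_add' := fun _ _ => rfl
      map_smul' := fun _ _ => rfl }
  exact (LinearMap.toContinuousLinearMap l).contDiff.comp_contDiffOn hγ.contDiffOn_frame

theorem gradPsi_eq {L : ℝ} {γ : ℝ → E3} {R₀ : ℝ → M3} (hγ : IsFramedCurve L γ R₀) {h : ℝ}
    (hh : h ≠ 0) {x : ℝ × ℝ × ℝ} (hx : x.1 ∈ Ioo 0 L) :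
    gradPsi γ R₀ h x = cols
      (column (R₀ x.1) 0 +
        h • (x.2.1 • derivWithin (fun s => column (R₀ s) 1) (Icc 0 L) x.1 +
          x.2.2 • derivWithin (fun s => column (R₀ s) 2) (Icc 0 L) x.1))
      (column (R₀ x.1) 1) (column (R₀ x.1) 2) := by
  have hI : Icc 0 L ∈ 𝓝 x.1 := Icc_mem_nhds hx.1 hx.2
  have hν : ∀ k, HasDerivAt (fun s => column (R₀ s) k)
      (derivWithin (fun s => column (R₀ s) k) (Icc 0 L) x.1) x.1 := fun k =>
    (((contDiffOn_column hγ k).differentiableOn one_ne_zero x.1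
      (Ioo_subset_Icc_self hx)).hasDerivWithinAt).hasDerivAt hI
  have hγ' : HasDerivAt γ (column (R₀ x.1) 0) x.1 := by
    rw [hγ.tangent x.1 (Ioo_subset_Icc_self hx)]
    exact ((hγ.contDiffOn_curve.differentiableOn two_ne_zero x.1
      (Ioo_subset_Icc_self hx)).hasDerivWithinAt).hasDerivAt hI
  have hf1 : HasFDerivAt (fun x : ℝ × ℝ × ℝ => x.1) (ContinuousLinearMap.fst ℝ ℝ (ℝ × ℝ)) x :=
    hasFDerivAt_fst
  have hf2 : HasFDerivAt (fun x : ℝ × ℝ × ℝ => h * x.2.1)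
      (h • (ContinuousLinearMap.fst ℝ ℝ ℝ).comp (ContinuousLinearMap.snd ℝ ℝ (ℝ × ℝ))) x :=
    ((ContinuousLinearMap.fst ℝ ℝ ℝ).comp
      (ContinuousLinearMap.snd ℝ ℝ (ℝ × ℝ))).hasFDerivAt.const_mul h
  have hf3 : HasFDerivAt (fun x : ℝ × ℝ × ℝ => h * x.2.2)
      (h • (ContinuousLinearMap.snd ℝ ℝ ℝ).comp (ContinuousLinearMap.snd ℝ ℝ (ℝ × ℝ))) x :=
    ((ContinuousLinearMap.snd ℝ ℝ ℝ).comp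
      (ContinuousLinearMap.snd ℝ ℝ (ℝ × ℝ))).hasFDerivAt.const_mul h
  have hΨ := ((hγ'.hasFDerivAt.comp x hf1).add (hf2.smul ((hν 1).hasFDerivAt.comp x hf1))).add
    (hf3.smul ((hν 2).hasFDerivAt.comp x hf1))
  have e : fderiv ℝ (Psi γ R₀ h) x = _ := hΨ.fderiv
  unfold gradPsi scaledGrad
  rw [e]
  congr 1
  · ext i
    simp [dir]
    ring
  · ext i
    simp [dir, hh]
  · ext i
    simp [dir, hh]

/-- The last two columns of the scaled gradient are the frame vectors themselves, so in the moving
frame the matrix differs from the identity in its first column only. Determinant and inverse become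
explicit. -/
theorem transpose_mul_gradPsi {L : ℝ} {γ : ℝ → E3} {R₀ : ℝ → M3} (hγ : IsFramedCurve L γ R₀)
    {h : ℝ} (hh : h ≠ 0) {x : ℝ × ℝ × ℝ} (hx : x.1 ∈ Ioo 0 L) :
    (R₀ x.1).transpose * gradPsi γ R₀ h x =
      !![1 + h * shear L R₀ 0 x, 0, 0; h * shear L R₀ 1 x, 1, 0; h * shear L R₀ 2 x, 0, 1] := by
  have hR := SO3_transpose_mul (hγ.mem_SO3 x.1 (Ioo_subset_Icc_self hx))
  have hRe : ∀ i j, ∑ k, R₀ x.1 k i * R₀ x.1 k j = (1 : M3) i j := fun i j => by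
    rw [← hR, Matrix.mul_apply]
    rfl
  rw [gradPsi_eq hγ hh hx]
  ext i j
  rw [Matrix.mul_apply]
  fin_cases j
  · have : ∀ k : Fin 3, (R₀ x.1).transpose i k * cols
        (column (R₀ x.1) 0 +
          h • (x.2.1 • derivWithin (fun s => column (R₀ s) 1) (Icc 0 L) x.1 +
            x.2.2 • derivWithin (fun s => column (R₀ s) 2) (Icc 0 L) x.1))
        (column (R₀ x.1) 1) (column (R₀ x.1) 2) k 0 = R₀ x.1 k i * R₀ x.1 k 0 +
        h * (R₀ x.1 k i * (x.2.1 * derivWithin (fun s => column (R₀ s) 1) (Icc 0 L) x.1 k +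
          x.2.2 * derivWithin (fun s => column (R₀ s) 2) (Icc 0 L) x.1 k)) := by
      intro k
      simp only [cols, Matrix.of_apply, Matrix.cons_val_zero, Matrix.transpose_apply,
        PiLp.add_apply, PiLp.smul_apply, smul_eq_mul, column_apply]
      ring
    simp only [Fin.zero_eta, this]
    rw [Finset.sum_add_distrib, hRe, ← Finset.mul_sum]
    fin_cases i <;> simp [shear, Matrix.one_apply]
  · refine (hRe i 1).trans ?_
    fin_cases i <;> simp [Matrix.one_apply]
  · refine (hRe i 2).trans ?_
    fin_cases i <;> simp [Matrix.one_apply]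

theorem det_gradPsi {L : ℝ} {γ : ℝ → E3} {R₀ : ℝ → M3} (hγ : IsFramedCurve L γ R₀) {h : ℝ}
    (hh : h ≠ 0) {x : ℝ × ℝ × ℝ} (hx : x.1 ∈ Ioo 0 L) :
    (gradPsi γ R₀ h x).det = 1 + h * shear L R₀ 0 x := by
  have h1 := congrArg Matrix.det (transpose_mul_gradPsi hγ hh hx)
  rw [Matrix.det_mul, Matrix.det_transpose, SO3_det (hγ.mem_SO3 x.1 (Ioo_subset_Icc_self hx)),
    one_mul] at h1
  rw [h1, Matrix.det_fin_three]
  simp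

/-- No inverse is computed: multiplying the claimed matrix by the triangular form of
`transpose_mul_gradPsi` gives back the scaled gradient. -/
theorem scaledGrad_mul_inv_gradPsi {L : ℝ} {γ : ℝ → E3} {R₀ : ℝ → M3} (hγ : IsFramedCurve L γ R₀)
    {h : ℝ} (hh : h ≠ 0) {x : ℝ × ℝ × ℝ} (hx : x.1 ∈ Ioo 0 L)
    (hd : 1 + h * shear L R₀ 0 x ≠ 0) (g : Fin 3 → ℝ × ℝ × ℝ → E3) :
    scaledGrad h (fun k => g k x) * (gradPsi γ R₀ h x)⁻¹ * R₀ x.1 =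
      cols (framedGrad (shear L R₀) h g x).1 (framedGrad (shear L R₀) h g x).2.1
        (framedGrad (shear L R₀) h g x).2.2 := by
  have hR := hγ.mem_SO3 x.1 (Ioo_subset_Icc_self hx)
  have hdet : IsUnit (gradPsi γ R₀ h x).det := by
    rw [det_gradPsi hγ hh hx]
    exact hd.isUnit
  set B := cols (framedGrad (shear L R₀) h g x).1 (framedGrad (shear L R₀) h g x).2.1
        (framedGrad (shear L R₀) h g x).2.2 with hB
  have key : B * (R₀ x.1).transpose * gradPsi γ R₀ h x = scaledGrad h fun k => g k x := by
    rw [Matrix.mul_assoc, transpose_mul_gradPsi hγ hh hx]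
    ext i j
    rw [Matrix.mul_apply, Fin.sum_univ_three]
    fin_cases j
    · simp [hB, cols, framedGrad, scaledGrad]
      field_simp
      ring
    · simp [hB, cols, framedGrad, scaledGrad]
    · simp [hB, cols, framedGrad, scaledGrad]
  rw [← key, Matrix.mul_nonsing_inv_cancel_right _ _ hdet, Matrix.mul_assoc, SO3_transpose_mul hR,
    Matrix.mul_one]

theorem continuousOn_shear {L : ℝ} (hL : 0 < L) {D : Set (ℝ × ℝ)} {γ : ℝ → E3} {R₀ : ℝ → M3}
    (hγ : IsFramedCurve L γ R₀) (k : Fin 3) : ContinuousOn (shear L R₀ k) (Icc 0 L ×ˢ D) := by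
  have hfst : ContinuousOn (fun x : ℝ × ℝ × ℝ => x.1) (Icc 0 L ×ˢ D) := continuousOn_fst
  have hmaps : MapsTo (fun x : ℝ × ℝ × ℝ => x.1) (Icc 0 L ×ˢ D) (Icc 0 L) := fun x hx => hx.1
  have hd : ∀ j i, ContinuousOn (fun x : ℝ × ℝ × ℝ =>
      derivWithin (fun s => column (R₀ s) j) (Icc 0 L) x.1 i) (Icc 0 L ×ˢ D) := fun j i => by
    have h1 := ((contDiffOn_column hγ j).continuousOn_derivWithin (uniqueDiffOn_Icc hL)
      le_rfl).comp hfst hmaps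
    exact (by fun_prop : Continuous fun v : E3 => v i).comp_continuousOn h1
  have hR : ∀ i, ContinuousOn (fun x : ℝ × ℝ × ℝ => R₀ x.1 i k) (Icc 0 L ×ˢ D) := fun i => by
    have h1 := ((contDiffOn_column hγ k).continuousOn).comp hfst hmaps
    exact (by fun_prop : Continuous fun v : E3 => v i).comp_continuousOn h1
  unfold shear
  refine continuousOn_finsetSum _ fun i _ => (hR i).mul (ContinuousOn.add ?_ ?_)
  · exact (by fun_prop : Continuous fun x : ℝ × ℝ × ℝ => x.2.1).continuousOn.mul (hd 1 i)
  · exact (by fun_prop : Continuous fun x : ℝ × ℝ × ℝ => x.2.2).continuousOn.mul (hd 2 i)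

theorem exists_shear_bound {L : ℝ} (hL : 0 < L) {D : Set (ℝ × ℝ)} (hD : Bornology.IsBounded D)
    {γ : ℝ → E3} {R₀ : ℝ → M3} (hγ : IsFramedCurve L γ R₀) :
    ∃ M > 0, ∀ k, ∀ x ∈ Omega L D, |shear L R₀ k x| ≤ M := by
  have hK : IsCompact (Icc 0 L ×ˢ closure D) := isCompact_Icc.prod hD.isCompact_closure
  have hb : ∀ k, ∃ M, ∀ x ∈ Icc 0 L ×ˢ closure D, ‖shear L R₀ k x‖ ≤ M := fun k =>
    hK.exists_bound_of_continuousOn (continuousOn_shear hL hγ k)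
  choose M hM using hb
  refine ⟨|M 0| + |M 1| + |M 2| + 1, by positivity, fun k x hx => ?_⟩
  have h1 := hM k x ⟨Ioo_subset_Icc_self hx.1, subset_closure hx.2⟩
  rw [Real.norm_eq_abs] at h1
  have h2 : |M k| ≤ |M 0| + |M 1| + |M 2| + 1 := by
    have := abs_nonneg (M 0)
    have := abs_nonneg (M 1)
    have := abs_nonneg (M 2)
    fin_cases k <;> simp <;> linarith
  exact h1.trans ((le_abs_self _).trans h2)

/-- The smallness `h * M < 1` keeps the determinant `1 + h * shear` positive, so the gradient of
`Psi` is invertible at every point of `Omega`. -/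
theorem energyOfGradient_eq {L : ℝ} {D : Set (ℝ × ℝ)} (hD : IsOpen D) {γ : ℝ → E3} {R₀ : ℝ → M3}
    (hγ : IsFramedCurve L γ R₀) {W : ℝ → M3 → ℝ≥0∞} {V : ℝ → E3 × E3 × E3 → ℝ≥0∞}
    (hVW : ∀ᵐ s ∂volume.restrict (Ioo 0 L), ∀ F,
      W s F = V s (column (F * R₀ s) 0, column (F * R₀ s) 1, column (F * R₀ s) 2))
    {M : ℝ} (hM : ∀ k, ∀ x ∈ Omega L D, |shear L R₀ k x| ≤ M) {h : ℝ} (hh : 0 < h)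
    (hhM : h * M < 1) (g : Fin 3 → ℝ × ℝ × ℝ → E3) :
    energyOfGradient L D γ R₀ W h g = ∫⁻ x in Omega L D,
      V x.1 (framedGrad (shear L R₀) h g x) * ENNReal.ofReal (1 + h * shear L R₀ 0 x) := by
  have hΩ : MeasurableSet (Omega L D) := (isOpen_Ioo.prod hD).measurableSet
  have hprod : (volume : Measure (ℝ × ℝ × ℝ)).restrict (Omega L D) =
      (volume.restrict (Ioo 0 L)).prod (volume.restrict D) := (Measure.prod_restrict _ _).symm
  have hae : ∀ᵐ x ∂volume.restrict (Omega L D), ∀ F, W x.1 F =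
      V x.1 (column (F * R₀ x.1) 0, column (F * R₀ x.1) 1, column (F * R₀ x.1) 2) := by
    rw [hprod]
    exact Measure.quasiMeasurePreserving_fst.ae hVW
  refine lintegral_congr_ae ?_
  filter_upwards [hae, ae_restrict_mem hΩ] with x hx hxΩ
  have hpos : 0 < 1 + h * shear L R₀ 0 x := by
    have := (abs_le.1 (hM 0 x hxΩ)).1
    nlinarith
  rw [hx, det_gradPsi hγ hh.ne' hxΩ.1, scaledGrad_mul_inv_gradPsi hγ hh.ne' hxΩ.1 hpos.ne']
  simp

/-! ### Functional-analytic tools for the lower bound -/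

/-- A substitute for weak compactness. The elements of least norm in the closed convex hulls of the
tails have increasing bounded norms, so by the parallelogram law they form a Cauchy sequence. Their
limit lies in the closed convex hull of every tail. -/
theorem exists_mem_of_eventually_mem {H : Type*} [NormedAddCommGroup H] [InnerProductSpace ℝ H]
    [CompleteSpace H] {z : ℕ → H} {B : ℝ} (hB : ∀ n, ‖z n‖ ≤ B) :
    ∃ p, ∀ K : Set H, IsClosed K → Convex ℝ K → (∀ᶠ n in atTop, z n ∈ K) → p ∈ K := by
  set K : ℕ → Set H := fun n => closedConvexHull ℝ (z '' Ici n) with hK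
  have hKc : ∀ n, Convex ℝ (K n) := fun n => convex_closedConvexHull
  have hKcl : ∀ n, IsClosed (K n) := fun n => isClosed_closedConvexHull
  have hzK : ∀ n, z n ∈ K n := fun n => subset_closedConvexHull ⟨n, mem_Ici.2 le_rfl, rfl⟩
  have hKanti : ∀ n m, n ≤ m → K m ⊆ K n := fun n m hnm =>
    (closedConvexHull ℝ).monotone (image_mono (Ici_subset_Ici.2 hnm))
  have hmin : ∀ n, ∃ p ∈ K n, ∀ w ∈ K n, ‖p‖ ≤ ‖w‖ := by
    intro n
    obtain ⟨p, hp, hpm⟩ := exists_norm_eq_iInf_of_complete_convex ⟨z n, hzK n⟩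
      (hKcl n).isComplete (hKc n) 0
    refine ⟨p, hp, fun w hw => ?_⟩
    rw [zero_sub, norm_neg] at hpm
    rw [hpm]
    refine (ciInf_le ⟨0, ?_⟩ (⟨w, hw⟩ : K n)).trans_eq (by simp)
    rintro _ ⟨w, rfl⟩
    exact norm_nonneg _
  choose p hp hpmin using hmin
  have hmono : Monotone fun n => ‖p n‖ ^ 2 := fun n m hnm =>
    pow_le_pow_left₀ (norm_nonneg _) (hpmin n _ (hKanti n m hnm (hp m))) 2
  have hbdd : BddAbove (range fun n => ‖p n‖ ^ 2) := by
    refine ⟨B ^ 2, ?_⟩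
    rintro _ ⟨n, rfl⟩
    exact pow_le_pow_left₀ (norm_nonneg _) ((hpmin n _ (hzK n)).trans (hB n)) 2
  have hlim := tendsto_atTop_ciSup hmono hbdd
  set A := ⨆ n, ‖p n‖ ^ 2
  have hcauchy : CauchySeq p := by
    -- The midpoint of `p n` and `p m` belongs to `K n`, so its norm is at least `‖p n‖`. The
    -- parallelogram law gives `‖p n - p m‖² ≤ 2 (‖p m‖² - ‖p n‖²)`.
    refine cauchySeq_of_le_tendsto_0' (fun n => √(2 * (A - ‖p n‖ ^ 2))) (fun n m hnm => ?_) ?_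
    · have hmid : (2⁻¹ : ℝ) • p n + (2⁻¹ : ℝ) • p m ∈ K n :=
        hKc n (hp n) (hKanti n m hnm (hp m)) (by norm_num) (by norm_num) (by norm_num)
      have h1 := hpmin n _ hmid
      rw [← smul_add, norm_smul, Real.norm_of_nonneg (by norm_num)] at h1
      have h2 := parallelogram_law_with_norm ℝ (p n) (p m)
      have h3 : ‖p m‖ ^ 2 ≤ A := le_ciSup hbdd m
      rw [dist_eq_norm]
      refine Real.le_sqrt_of_sq_le ?_
      nlinarith [norm_nonneg (p n), norm_nonneg (p n + p m)]
    · have : Tendsto (fun n => √(2 * (A - ‖p n‖ ^ 2))) atTop (𝓝 √(2 * (A - A))) :=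
        ((hlim.const_sub A).const_mul 2).sqrt
      simpa using this
  obtain ⟨q, hq⟩ := cauchySeq_tendsto_of_complete hcauchy
  refine ⟨q, fun C hC hCc hev => ?_⟩
  obtain ⟨n, hn⟩ := eventually_atTop.1 hev
  have hsub : K n ⊆ C := closedConvexHull_min (by
    rintro _ ⟨m, hm, rfl⟩
    exact hn m hm) hCc hC
  refine hsub ((hKcl n).mem_of_tendsto hq ?_)
  filter_upwards [eventually_ge_atTop n] with m hm using hKanti n m hm (hp m)

/-! ### The product measure on `Omega` and pairings in `L²` -/

theorem volume_Omega {L : ℝ} {D : Set (ℝ × ℝ)} (hvol : volume D = 1) :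
    (volume : Measure (ℝ × ℝ × ℝ)) (Omega L D) = ENNReal.ofReal L := by
  rw [Omega, Measure.volume_eq_prod, Measure.prod_prod, hvol, Real.volume_Ioo, sub_zero, mul_one]

theorem isFiniteMeasure_Omega (L : ℝ) {D : Set (ℝ × ℝ)} (hvol : volume D = 1) :
    IsFiniteMeasure ((volume : Measure (ℝ × ℝ × ℝ)).restrict (Omega L D)) :=
  ⟨by rw [Measure.restrict_apply_univ, volume_Omega hvol]; exact ENNReal.ofReal_lt_top⟩

theorem restrict_Omega (L : ℝ) (D : Set (ℝ × ℝ)) :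
    (volume : Measure (ℝ × ℝ × ℝ)).restrict (Omega L D) =
      (volume.restrict (Ioo 0 L)).prod (volume.restrict D) :=
  (Measure.prod_restrict _ _).symm

theorem measurePreserving_fst_Omega (L : ℝ) {D : Set (ℝ × ℝ)} (hvol : volume D = 1) :
    MeasurePreserving Prod.fst ((volume : Measure (ℝ × ℝ × ℝ)).restrict (Omega L D))
      (volume.restrict (Ioo 0 L)) := by
  rw [restrict_Omega]
  have : IsProbabilityMeasure (volume.restrict D) := ⟨by rw [Measure.restrict_apply_univ, hvol]⟩
  exact measurePreserving_fst

/-- `P` need not be measurable: for almost every `s` the section has full measure in a probability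
space, hence contains a point. -/
theorem ae_fst_Omega {L : ℝ} {D : Set (ℝ × ℝ)} (hvol : volume D = 1) {P : ℝ → Prop}
    (h : ∀ᵐ x ∂volume.restrict (Omega L D), P x.1) : ∀ᵐ s ∂volume.restrict (Ioo 0 L), P s := by
  rw [restrict_Omega] at h
  have : IsProbabilityMeasure (volume.restrict D) := ⟨by rw [Measure.restrict_apply_univ, hvol]⟩
  filter_upwards [Measure.ae_ae_of_ae_prod h] with s hs
  exact hs.exists.choose_spec

theorem L2.integrableOn {L : ℝ} {D : Set (ℝ × ℝ)} (hvol : volume D = 1) (v : L2 L D) :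
    IntegrableOn v (Omega L D) :=
  have := isFiniteMeasure_Omega L hvol
  (Lp.memLp v).integrable (by norm_num)

/-- Pairing with a bounded function, as a continuous linear map on `L²`. -/
theorem exists_pairing {L : ℝ} {D : Set (ℝ × ℝ)} (hvol : volume D = 1) {ψ : ℝ × ℝ × ℝ → ℝ}
    (hψ : Continuous ψ) (hc : HasCompactSupport ψ) :
    ∃ ℓ : L2 L D →L[ℝ] E3, ∀ p, ℓ p = ∫ x in Omega L D, ψ x • p x := by
  have := isFiniteMeasure_Omega L hvol
  obtain ⟨M, hM⟩ := hψ.bounded_above_of_compact_support hc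
  have hM0 : 0 ≤ M := (norm_nonneg _).trans (hM 0)
  have hi : ∀ p : L2 L D, Integrable (fun x => ψ x • p x) (volume.restrict (Omega L D)) := fun p =>
    integrable_testFunction_smul (L2.integrableOn hvol p) hψ hc
  let ℓ : L2 L D →ₗ[ℝ] E3 :=
    { toFun := fun p => ∫ x in Omega L D, ψ x • p x
      map_add' := fun p q => by
        rw [← integral_add (hi p) (hi q)]
        refine integral_congr_ae ?_
        filter_upwards [Lp.coeFn_add p q] with x hx
        rw [hx, Pi.add_apply, smul_add]
      map_smul' := fun c p => by
        rw [RingHom.id_apply, ← integral_smul]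
        refine integral_congr_ae ?_
        filter_upwards [Lp.coeFn_smul c p] with x hx
        rw [hx, Pi.smul_apply, smul_comm] }
  set μ := (volume : Measure (ℝ × ℝ × ℝ)).restrict (Omega L D)
  set c := (μ univ ^ (1 / (1 : ℝ≥0∞).toReal - 1 / (2 : ℝ≥0∞).toReal)).toReal
  refine ⟨ℓ.mkContinuous (M * c) fun p => ?_, fun p => rfl⟩
  have h1 : ∫ x, ‖p x‖ ∂μ ≤ ‖p‖ * c := by
    rw [integral_norm_eq_lintegral_enorm (Lp.aestronglyMeasurable p), Lp.norm_def,
      ← ENNReal.toReal_mul, ← eLpNorm_one_eq_lintegral_enorm]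
    refine ENNReal.toReal_mono (ENNReal.mul_ne_top (Lp.eLpNorm_ne_top p)
      (ENNReal.rpow_ne_top_of_nonneg (by norm_num) (measure_ne_top _ _))) ?_
    exact eLpNorm_le_eLpNorm_mul_rpow_measure_univ (by norm_num) (Lp.aestronglyMeasurable p)
  calc ‖∫ x, ψ x • p x ∂μ‖ ≤ ∫ x, M * ‖p x‖ ∂μ := by
        refine norm_integral_le_of_norm_le ((L2.integrableOn hvol p).norm.const_mul M)
          (Eventually.of_forall fun x => ?_)
        rw [norm_smul]
        exact mul_le_mul_of_nonneg_right (hM x) (norm_nonneg _)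
    _ ≤ M * (‖p‖ * c) := by
        rw [integral_const_mul]
        exact mul_le_mul_of_nonneg_left h1 hM0
    _ = M * c * ‖p‖ := by ring

/-! ### Sublevel sets of the relaxed energy -/

theorem IsRegularPotential.aemeasurable_relaxedDensity {V : ℝ → E3 × E3 × E3 → ℝ≥0∞}
    (hV : IsRegularPotential V) {μ : Measure (ℝ × ℝ × ℝ)} {p : ℝ × ℝ × ℝ → E3}
    (hp : AEStronglyMeasurable p μ) : AEMeasurable (fun x => relaxedDensity V x.1 (p x)) μ :=
  Measurable.comp_aemeasurable (g := fun q : E3 × ℝ => relaxedDensity V q.2 q.1)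
    (f := fun x => (p x, x.1)) hV.measurable_relaxedDensity
    (hp.aemeasurable.prodMk measurable_fst.aemeasurable)

theorem IsRegularPotential.convex_sublevel {V : ℝ → E3 × E3 × E3 → ℝ≥0∞}
    (hV : IsRegularPotential V) (L : ℝ) (D : Set (ℝ × ℝ)) (c : ℝ≥0∞) :
    Convex ℝ {p : L2 L D | ∫⁻ x in Omega L D, relaxedDensity V x.1 (p x) ≤ c} := by
  intro p hp q hq a b ha hb hab
  lift a to ℝ≥0 using ha
  lift b to ℝ≥0 using hb
  have hab' : a + b = 1 := by exact_mod_cast hab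
  have hle : ∀ᵐ x ∂volume.restrict (Omega L D),
      relaxedDensity V x.1 (((a : ℝ) • p + (b : ℝ) • q : L2 L D) x) ≤
        a * relaxedDensity V x.1 (p x) + b * relaxedDensity V x.1 (q x) := by
    filter_upwards [Lp.coeFn_add ((a : ℝ) • p) ((b : ℝ) • q), Lp.coeFn_smul (a : ℝ) p,
      Lp.coeFn_smul (b : ℝ) q] with x h1 h2 h3
    rw [h1, Pi.add_apply, h2, h3]
    exact hV.relaxedDensity_convex x.1 (p x) (q x) a b hab'
  refine (lintegral_mono_ae hle).trans ?_
  rw [lintegral_add_left' ((hV.aemeasurable_relaxedDensity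
    (Lp.aestronglyMeasurable p)).const_mul _), lintegral_const_mul' _ _ ENNReal.coe_ne_top,
    lintegral_const_mul' _ _ ENNReal.coe_ne_top]
  calc _ ≤ (a : ℝ≥0∞) * c + b * c := by
        gcongr
        · exact hp
        · exact hq
    _ = c := by
        rw [← add_mul, ← ENNReal.coe_add, hab', ENNReal.coe_one, one_mul]

/-- Fatou's lemma along an almost everywhere convergent subsequence. Together with convexity, this
takes the place of weak lower semicontinuity. -/
theorem IsRegularPotential.isClosed_sublevel {V : ℝ → E3 × E3 × E3 → ℝ≥0∞}
    (hV : IsRegularPotential V) (L : ℝ) (D : Set (ℝ × ℝ)) (c : ℝ≥0∞) :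
    IsClosed {p : L2 L D | ∫⁻ x in Omega L D, relaxedDensity V x.1 (p x) ≤ c} := by
  refine IsSeqClosed.isClosed fun p q hp hpq => ?_
  obtain ⟨φ, -, hφ⟩ := (tendstoInMeasure_of_tendsto_Lp hpq).exists_seq_tendsto_ae
  calc ∫⁻ x in Omega L D, relaxedDensity V x.1 (q x)
      ≤ ∫⁻ x in Omega L D, liminf (fun n => relaxedDensity V x.1 (p (φ n) x)) atTop := by
        refine lintegral_mono_ae ?_
        filter_upwards [hφ] with x hx
        exact (((hV.continuous_relaxedDensity x.1).tendsto _).comp hx).liminf_eq.ge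
    _ ≤ liminf (fun n => ∫⁻ x in Omega L D, relaxedDensity V x.1 (p (φ n) x)) atTop :=
        lintegral_liminf_le' fun n => hV.aemeasurable_relaxedDensity (Lp.aestronglyMeasurable _)
    _ ≤ c := by
        refine (liminf_le_liminf (Eventually.of_forall fun n => hp (φ n))).trans ?_
        simp

theorem exists_testFunction_integral_eq_one {D : Set (ℝ × ℝ)} (hD : IsOpen D) (hne : D.Nonempty) :
    ∃ ψ : ℝ × ℝ → ℝ, ContDiff ℝ ∞ ψ ∧ HasCompactSupport ψ ∧ tsupport ψ ⊆ D ∧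
      ∫ y in D, ψ y = 1 := by
  obtain ⟨y, hy⟩ := hne
  obtain ⟨r, hr, hrD⟩ := Metric.isOpen_iff.1 hD y hy
  let b : ContDiffBump y := ⟨r / 4, r / 2, by positivity, by linarith⟩
  have hs : tsupport (b.normed volume) ⊆ D := by
    rw [b.tsupport_normed_eq]
    exact (Metric.closedBall_subset_ball (by show r / 2 < r; linarith)).trans hrD
  refine ⟨b.normed volume, b.contDiff_normed, b.hasCompactSupport_normed, hs, ?_⟩
  rw [setIntegral_eq_integral_of_forall_compl_eq_zero fun x hx =>
    image_eq_zero_of_notMem_tsupport fun h => hx (hs h)]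
  exact b.integral_normed

/-- The weak axial derivative of a function of the axial variable. -/
theorem IsWeakDeriv.of_comp_fst {L : ℝ} {D : Set (ℝ × ℝ)} (hD : IsOpen D) (hne : D.Nonempty)
    {u u' : ℝ → E3} (hu : IntegrableOn u (Ioo 0 L)) (hu' : IntegrableOn u' (Ioo 0 L))
    (hvol : volume D = 1)
    (h : IsWeakDeriv (Omega L D) (dir 0) (fun x => u x.1) fun x => u' x.1) :
    IsWeakDeriv (Ioo 0 L) 1 u u' := by
  intro φ hφ hc hs
  obtain ⟨ψ, hψ, hψc, hψs, hψ1⟩ := exists_testFunction_integral_eq_one hD hne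
  -- Testing with a product whose cross-sectional factor has integral one removes the variables of
  -- `D` by Fubini.
  set Φ : ℝ × ℝ × ℝ → ℝ := fun x => φ x.1 * ψ x.2 with hΦ
  have hsupp : tsupport Φ ⊆ tsupport φ ×ˢ tsupport ψ := by
    refine closure_minimal (fun x hx => ?_) ((isClosed_tsupport φ).prod (isClosed_tsupport ψ))
    rw [Function.mem_support] at hx
    exact ⟨subset_tsupport _ (left_ne_zero_of_mul hx), subset_tsupport _ (right_ne_zero_of_mul hx)⟩
  have hΦc : HasCompactSupport Φ :=
    (IsCompact.prod hc hψc).of_isClosed_subset (isClosed_tsupport _) hsupp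
  have hΦd : ContDiff ℝ ∞ Φ := (hφ.comp contDiff_fst).mul (hψ.comp contDiff_snd)
  have hder : ∀ x, fderiv ℝ Φ x (dir 0) = fderiv ℝ φ x.1 1 * ψ x.2 := by
    intro x
    have h1 : HasFDerivAt (fun x : ℝ × ℝ × ℝ => φ x.1)
        ((fderiv ℝ φ x.1).comp (ContinuousLinearMap.fst ℝ ℝ (ℝ × ℝ))) x :=
      ((hφ.differentiable (by simp)).differentiableAt.hasFDerivAt).comp x hasFDerivAt_fst
    have h2 : HasFDerivAt (fun x : ℝ × ℝ × ℝ => ψ x.2)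
        ((fderiv ℝ ψ x.2).comp (ContinuousLinearMap.snd ℝ ℝ (ℝ × ℝ))) x :=
      ((hψ.differentiable (by simp)).differentiableAt.hasFDerivAt).comp x hasFDerivAt_snd
    have e : fderiv ℝ Φ x = _ := (h1.mul h2).fderiv
    rw [e]
    simp [dir, mul_comm]
    exact Or.inr (map_zero (fderiv ℝ ψ x.2))
  have hmp := measurePreserving_fst_Omega L hvol
  have hsplit : ∀ (f : ℝ → ℝ) (w : ℝ → E3), Continuous f → HasCompactSupport f →
      IntegrableOn w (Ioo 0 L) →
      ∫ x in Omega L D, (f x.1 * ψ x.2) • w x.1 = ∫ s in Ioo 0 L, f s • w s := by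
    intro f w hf hfc hw
    have hw' : Integrable (fun x : ℝ × ℝ × ℝ => w x.1) (volume.restrict (Omega L D)) :=
      hmp.integrable_comp_of_integrable hw
    have hi : Integrable (fun x : ℝ × ℝ × ℝ => (f x.1 * ψ x.2) • w x.1)
        (volume.restrict (Omega L D)) := by
      obtain ⟨M, hM⟩ := hf.bounded_above_of_compact_support hfc
      obtain ⟨M', hM'⟩ := hψ.continuous.bounded_above_of_compact_support hψc
      refine hw'.smul_of_top_right (memLp_top_of_bound ((hf.comp continuous_fst).mul
        (hψ.continuous.comp continuous_snd)).aestronglyMeasurable (M * M')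
        (Eventually.of_forall fun x => ?_))
      show ‖f x.1 * ψ x.2‖ ≤ M * M'
      rw [norm_mul]
      exact mul_le_mul (hM _) (hM' _) (norm_nonneg _) ((norm_nonneg _).trans (hM 0))
    rw [restrict_Omega] at hi ⊢
    rw [integral_prod _ hi]
    refine integral_congr_ae (Eventually.of_forall fun s => ?_)
    dsimp only
    simp_rw [mul_comm (f s), mul_smul]
    rw [integral_smul_const, hψ1, one_smul]
  have h3 := h Φ hΦd hΦc (hsupp.trans (prod_mono hs hψs))
  simp only [hder] at h3
  simp only [hΦ] at h3
  rwa [hsplit (fun s => fderiv ℝ φ s 1) u ((hφ.continuous_fderiv (by simp)).clm_apply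
    continuous_const) (hc.fderiv_apply ℝ 1) hu, hsplit φ u' hφ.continuous hc hu'] at h3

/-! ### Lower bound -/

theorem column_cols_mul_transpose_mul {R : M3} (hR : R ∈ SO3) (p : E3 × E3 × E3) :
    (column (cols p.1 p.2.1 p.2.2 * R.transpose * R) 0,
      column (cols p.1 p.2.1 p.2.2 * R.transpose * R) 1,
      column (cols p.1 p.2.1 p.2.2 * R.transpose * R) 2) = p := by
  rw [Matrix.mul_assoc, SO3_transpose_mul hR, Matrix.mul_one, column_cols_zero, column_cols_one,
    column_cols_two]

theorem ae_W₀_eq_fiberMin {L : ℝ} {γ : ℝ → E3} {R₀ : ℝ → M3} (hγ : IsFramedCurve L γ R₀)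
    {W : ℝ → M3 → ℝ≥0∞} {V : ℝ → E3 × E3 × E3 → ℝ≥0∞}
    (hVW : ∀ᵐ s ∂volume.restrict (Ioo 0 L), ∀ F,
      W s F = V s (column (F * R₀ s) 0, column (F * R₀ s) 1, column (F * R₀ s) 2)) :
    ∀ᵐ s ∂volume.restrict (Ioo 0 L), W₀ R₀ W s = fiberMin V s := by
  filter_upwards [hVW, ae_restrict_mem measurableSet_Ioo] with s hs hsI
  funext z
  have hR := hγ.mem_SO3 s (Ioo_subset_Icc_self hsI)
  rw [W₀, fiberMin, iInf_prod]
  refine iInf_congr fun y₂ => iInf_congr fun y₃ => ?_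
  rw [hs, column_cols_mul_transpose_mul hR (z, y₂, y₃)]

/-- The growth condition from below, in terms of the columns. -/
theorem exists_coercive {L : ℝ} {γ : ℝ → E3} {R₀ : ℝ → M3} (hγ : IsFramedCurve L γ R₀)
    {W : ℝ → M3 → ℝ≥0∞} (hW : IsStoredEnergy L W) {V : ℝ → E3 × E3 × E3 → ℝ≥0∞}
    (hVW : ∀ᵐ s ∂volume.restrict (Ioo 0 L), ∀ F,
      W s F = V s (column (F * R₀ s) 0, column (F * R₀ s) 1, column (F * R₀ s) 2)) :
    ∃ K : ℝ≥0, ∀ᵐ s ∂volume.restrict (Ioo 0 L), ∀ p,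
      ‖p.1‖ₑ ^ 2 + ‖p.2.1‖ₑ ^ 2 + ‖p.2.2‖ₑ ^ 2 ≤ K * (1 + V s p) := by
  obtain ⟨C, hC, hlow⟩ := hW.lower_bound
  refine ⟨(162 + 18 / C).toNNReal, ?_⟩
  filter_upwards [hVW, hlow, ae_restrict_mem measurableSet_Ioo] with s hs hl hsI p
  have hR := hγ.mem_SO3 s (Ioo_subset_Icc_self hsI)
  set F : M3 := cols p.1 p.2.1 p.2.2 * (R₀ s).transpose with hF
  have hVF : W s F = V s p := by rw [hs, hF, column_cols_mul_transpose_mul hR p]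
  have hFR : F * R₀ s = cols p.1 p.2.1 p.2.2 := by
    rw [hF, Matrix.mul_assoc, SO3_transpose_mul hR, Matrix.mul_one]
  have h1 : ‖F * R₀ s‖ ≤ ‖F‖ * 3 := (Matrix.frobenius_norm_mul _ _).trans
    (mul_le_mul_of_nonneg_left (norm_SO3_le hR) (norm_nonneg _))
  have h2 := norm_le_distSO3 F
  have h3 := distSO3_nonneg F
  -- With `d` the distance to the rotations, `‖F‖ ≤ d + 3` and the factor `3` for the frame give `9
  -- (d + 3)² ≤ 162 + 18 d²`.
  have h4 : ‖p.1‖ ^ 2 + ‖p.2.1‖ ^ 2 + ‖p.2.2‖ ^ 2 ≤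
      (162 + 18 / C) * (1 + C * distSO3 F ^ 2) := by
    have h5 := norm_sq_eq_column (F * R₀ s)
    rw [hFR, column_cols_zero, column_cols_one, column_cols_two, ← hFR] at h5
    have h6 : 18 / C * (C * distSO3 F ^ 2) = 18 * distSO3 F ^ 2 := by field_simp
    have h7 : 0 ≤ 18 / C := by positivity
    have h8 : 0 ≤ C * distSO3 F ^ 2 := by positivity
    have h9 : ‖F * R₀ s‖ ^ 2 ≤ (3 * (distSO3 F + 3)) ^ 2 :=
      pow_le_pow_left₀ (norm_nonneg _) (by linarith) 2
    nlinarith [sq_nonneg (distSO3 F - 3)]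
  calc ‖p.1‖ₑ ^ 2 + ‖p.2.1‖ₑ ^ 2 + ‖p.2.2‖ₑ ^ 2
      = ENNReal.ofReal (‖p.1‖ ^ 2 + ‖p.2.1‖ ^ 2 + ‖p.2.2‖ ^ 2) := by
        rw [enorm_sq_eq_ofReal, enorm_sq_eq_ofReal, enorm_sq_eq_ofReal,
          ENNReal.ofReal_add (by positivity) (by positivity),
          ENNReal.ofReal_add (by positivity) (by positivity)]
    _ ≤ ENNReal.ofReal ((162 + 18 / C) * (1 + C * distSO3 F ^ 2)) := ENNReal.ofReal_le_ofReal h4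
    _ = ENNReal.ofReal (162 + 18 / C) * (1 + ENNReal.ofReal (C * distSO3 F ^ 2)) := by
        rw [ENNReal.ofReal_mul (by positivity), ENNReal.ofReal_add zero_le_one (by positivity),
          ENNReal.ofReal_one]
    _ ≤ _ := by
        rw [← hVF]
        exact mul_le_mul_right (add_le_add_right (hl F) 1) _

/-- Weak derivatives pass to limits of vanishing perturbations of weakly convergent sequences. -/
theorem IsWeakDeriv.of_tendsto {L : ℝ} {D : Set (ℝ × ℝ)} (hvol : volume D = 1)
    {e : ℝ × ℝ × ℝ} {y z : ℕ → L2 L D} {v p : L2 L D} {g : ℕ → ℝ × ℝ × ℝ → E3}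
    (hy : Tendsto y atTop (𝓝 v)) (hg : ∀ n, IntegrableOn (g n) (Omega L D))
    (hd : ∀ n, IsWeakDeriv (Omega L D) e (y n) (g n))
    (hp : ∀ K : Set (L2 L D), IsClosed K → Convex ℝ K → (∀ᶠ n in atTop, z n ∈ K) → p ∈ K)
    {h : ℕ → ℝ} (hh : Tendsto h atTop (𝓝 0)) {G : ℕ → ℝ × ℝ × ℝ → ℝ≥0∞} {B : ℝ≥0∞} (hB : B ≠ ⊤)
    (hG : ∀ n, ∫⁻ x in Omega L D, G n x ≤ B)
    (hz : ∀ n, ∀ᵐ x ∂volume.restrict (Omega L D),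
      ‖z n x - g n x‖ₑ ≤ ENNReal.ofReal (h n) * G n x) :
    IsWeakDeriv (Omega L D) e v p := by
  intro φ hφ hc hs
  obtain ⟨ℓ, hℓ⟩ := exists_pairing (L := L) hvol hφ.continuous hc
  obtain ⟨ℓ', hℓ'⟩ := exists_pairing (L := L) hvol
    ((hφ.continuous_fderiv (by simp)).clm_apply (continuous_const (y := e))) (hc.fderiv_apply ℝ e)
  rw [← hℓ, ← hℓ']
  obtain ⟨M, hM⟩ := hφ.continuous.bounded_above_of_compact_support hc
  have hgn : ∀ n, ∫ x in Omega L D, φ x • g n x = -ℓ' (y n) := fun n => by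
    rw [hℓ', hd n φ hφ hc hs, neg_neg]
  have hdiff : Tendsto (fun n => ℓ (z n) - ∫ x in Omega L D, φ x • g n x) atTop (𝓝 0) := by
    have hbd : ∀ n, ‖ℓ (z n) - ∫ x in Omega L D, φ x • g n x‖ₑ ≤
        ENNReal.ofReal M * (ENNReal.ofReal (h n) * B) := by
      intro n
      rw [hℓ, ← integral_sub
        (integrable_testFunction_smul (L2.integrableOn hvol (z n)) hφ.continuous hc)
        (integrable_testFunction_smul (hg n) hφ.continuous hc)]
      calc _ ≤ ∫⁻ x in Omega L D, ‖φ x • z n x - φ x • g n x‖ₑ := enorm_integral_le_lintegral_enorm _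
        _ ≤ ∫⁻ x in Omega L D, ENNReal.ofReal M * (ENNReal.ofReal (h n) * G n x) := by
            refine lintegral_mono_ae ?_
            filter_upwards [hz n] with x hx
            rw [← smul_sub, enorm_smul]
            gcongr
            rw [← ofReal_norm]
            exact ENNReal.ofReal_le_ofReal (hM x)
        _ ≤ _ := by
            rw [lintegral_const_mul' _ _ ENNReal.ofReal_ne_top,
              lintegral_const_mul' _ _ ENNReal.ofReal_ne_top]
            gcongr
            exact hG n
    have h0 : Tendsto (fun n => ENNReal.ofReal M * (ENNReal.ofReal (h n) * B)) atTop (𝓝 0) := by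
      have h1 : Tendsto (fun n => ENNReal.ofReal (h n)) atTop (𝓝 0) := by
        simpa using ENNReal.tendsto_ofReal hh
      have h2 := ENNReal.Tendsto.const_mul (a := ENNReal.ofReal M)
        (ENNReal.Tendsto.mul_const (b := B) h1 (Or.inr hB)) (Or.inr ENNReal.ofReal_ne_top)
      simpa using h2
    rw [tendsto_zero_iff_enorm_tendsto_zero]
    exact tendsto_of_tendsto_of_tendsto_of_le_of_le tendsto_const_nhds h0 (fun _ => zero_le) hbd
  have hlim : Tendsto (fun n => ℓ (z n)) atTop (𝓝 (-ℓ' v)) := by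
    have h1 : Tendsto (fun n => -ℓ' (y n)) atTop (𝓝 (-ℓ' v)) :=
      ((ℓ'.continuous.tendsto v).comp hy).neg
    simpa [hgn] using hdiff.add h1
  -- Preimages of closed balls under `ℓ` are closed and convex, so `p` inherits every limit of a
  -- continuous linear map along `z`.
  have hmem : ∀ ε > 0, dist (ℓ p) (-ℓ' v) ≤ ε := fun ε hε =>
    hp (ℓ ⁻¹' Metric.closedBall (-ℓ' v) ε) (Metric.isClosed_closedBall.preimage ℓ.continuous)
      ((convex_closedBall _ _).linear_preimage ℓ.toLinearMap)
      (hlim (Metric.closedBall_mem_nhds _ hε))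
  rw [dist_le_zero.1 (le_of_forall_gt_imp_ge_of_dense hmem), neg_neg]

/-- `I` evaluates a derivative picked by choice; this makes its value independent of the pick. -/
theorem IsProfileDeriv.ae_unique {L : ℝ} {D : Set (ℝ × ℝ)} (hvol : volume D = 1) {v : L2 L D}
    {u₁ u₂ : ℝ → E3} (h₁ : IsProfileDeriv L D v u₁) (h₂ : IsProfileDeriv L D v u₂) :
    u₁ =ᵐ[volume.restrict (Ioo 0 L)] u₂ := by
  obtain ⟨w₁, -, hm₁, hd₁, hv₁⟩ := h₁
  obtain ⟨w₂, -, hm₂, hd₂, hv₂⟩ := h₂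
  have hw : w₁ =ᵐ[volume.restrict (Ioo 0 L)] w₂ := by
    refine ae_fst_Omega hvol ?_
    filter_upwards [hv₁, hv₂] with x h1 h2
    rw [← h1, h2]
  refine IsWeakDeriv.ae_unique isOpen_Ioo (hm₁.integrable (by norm_num))
    (hm₂.integrable (by norm_num)) hd₁ fun φ hφ hc hs => ?_
  rw [← hd₂ φ hφ hc hs]
  refine integral_congr_ae ?_
  filter_upwards [hw] with s hs
  rw [hs]

theorem I_eq {L : ℝ} {D : Set (ℝ × ℝ)} (hvol : volume D = 1) {γ : ℝ → E3} {R₀ : ℝ → M3}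
    (hγ : IsFramedCurve L γ R₀) {W : ℝ → M3 → ℝ≥0∞} {V : ℝ → E3 × E3 × E3 → ℝ≥0∞}
    (hV : IsRegularPotential V) (hVW : ∀ᵐ s ∂volume.restrict (Ioo 0 L), ∀ F,
      W s F = V s (column (F * R₀ s) 0, column (F * R₀ s) 1, column (F * R₀ s) 2))
    {v : L2 L D} {u' : ℝ → E3} (hu : IsProfileDeriv L D v u') :
    I L D R₀ W v = ∫⁻ s in Ioo 0 L, relaxedDensity V s (u' s) := by
  have hv : ∃ u', IsProfileDeriv L D v u' := ⟨u', hu⟩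
  rw [I, dif_pos hv]
  refine lintegral_congr_ae ?_
  filter_upwards [ae_W₀_eq_fiberMin hγ hVW, hv.choose_spec.ae_unique hvol hu] with s h1 h2
  rw [h1, h2, hV.convexEnvelope_fiberMin]

/-- Weak derivatives in different directions commute, in the case of a vanishing one. -/
theorem IsWeakDeriv.eq_zero_of_comm {E : Type*} [NormedAddCommGroup E] [NormedSpace ℝ E]
    [MeasureSpace E] {U : Set E} {e e' : E} {v p : E → E3} (h : IsWeakDeriv U e v p)
    (h' : IsWeakDeriv U e' v 0) : IsWeakDeriv U e' p 0 := by
  intro φ hφ hc hs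
  have hd : ∀ a, ContDiff ℝ ∞ fun x => fderiv ℝ φ x a := fun a =>
    (hφ.fderiv_right (m := ∞) (by simp)).clm_apply contDiff_const
  have hdd : ∀ x a b, fderiv ℝ (fun x => fderiv ℝ φ x a) x b = fderiv ℝ (fderiv ℝ φ) x b a := by
    intro x a b
    have h1 : DifferentiableAt ℝ (fderiv ℝ φ) x :=
      ((hφ.fderiv_right (m := ∞) (by simp)).differentiable (by simp)).differentiableAt
    rw [fderiv_clm_apply h1 (differentiableAt_const a)]
    simp
  have h1 := h _ (hd e') (hc.fderiv_apply ℝ e') ((tsupport_fderiv_apply_subset ℝ e').trans hs)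
  have h2 := h' _ (hd e) (hc.fderiv_apply ℝ e) ((tsupport_fderiv_apply_subset ℝ e).trans hs)
  have h3 : ∀ x, fderiv ℝ (fun x => fderiv ℝ φ x e') x e =
      fderiv ℝ (fun x => fderiv ℝ φ x e) x e' := fun x => by
    rw [hdd, hdd]
    exact (contDiff_infty.1 hφ 2).contDiffAt.isSymmSndFDerivAt (by simp) _ _
  simp only [h3, h2, Pi.zero_apply, smul_zero, integral_zero, neg_zero] at h1
  simpa using h1.symm

theorem IsWeakDeriv.congr_ae {E : Type*} [NormedAddCommGroup E] [NormedSpace ℝ E]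
    [MeasureSpace E] {U : Set E} {e : E} {u u' g g' : E → E3} (h : IsWeakDeriv U e u g)
    (hu : u =ᵐ[volume.restrict U] u') (hg : g =ᵐ[volume.restrict U] g') :
    IsWeakDeriv U e u' g' := by
  intro φ hφ hc hs
  have e1 : ∫ x in U, fderiv ℝ φ x e • u x = ∫ x in U, fderiv ℝ φ x e • u' x := by
    refine integral_congr_ae ?_
    filter_upwards [hu] with x hx
    rw [hx]
  have e2 : ∫ x in U, φ x • g x = ∫ x in U, φ x • g' x := by
    refine integral_congr_ae ?_
    filter_upwards [hg] with x hx
    rw [hx]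
  rw [← e1, ← e2]
  exact h φ hφ hc hs

/-- The cross-sectional derivatives of `p = ∂_s v` vanish because they commute with `∂_s`, so `p` is
a function of `s` as well. Integrability passes to the profiles since `D` has measure one. -/
theorem exists_isProfileDeriv {L : ℝ} {D : Set (ℝ × ℝ)} (hD : IsOpen D) (hc : IsConnected D)
    (hvol : volume D = 1) {v p : L2 L D} (h0 : IsWeakDeriv (Omega L D) (dir 0) v p)
    (h1 : IsWeakDeriv (Omega L D) (dir 1) v 0) (h2 : IsWeakDeriv (Omega L D) (dir 2) v 0) :
    ∃ u', IsProfileDeriv L D v u' ∧ ∀ᵐ x ∂volume.restrict (Omega L D), p x = u' x.1 := by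
  have hmp := measurePreserving_fst_Omega L hvol
  have hmem : ∀ (q : L2 L D) (u : ℝ → E3), StronglyMeasurable u →
      (∀ᵐ x ∂volume.restrict (Omega L D), q x = u x.1) →
      MemLp u 2 (volume.restrict (Ioo 0 L)) := by
    intro q u hu hq
    refine ⟨hu.aestronglyMeasurable, ?_⟩
    have e : eLpNorm q 2 (volume.restrict (Omega L D)) = eLpNorm (u ∘ Prod.fst) 2 _ :=
      eLpNorm_congr_ae hq
    rw [← eLpNorm_comp_measurePreserving hu.aestronglyMeasurable hmp, ← e]
    exact Lp.eLpNorm_lt_top q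
  obtain ⟨u, hu, hvu⟩ := exists_profile hD hc hvol (L2.integrableOn hvol v) h1 h2
  obtain ⟨u', hu', hpu⟩ := exists_profile hD hc hvol (L2.integrableOn hvol p)
    (h0.eq_zero_of_comm h1) (h0.eq_zero_of_comm h2)
  have hm := hmem v u hu hvu
  have hm' := hmem p u' hu' hpu
  have : IsFiniteMeasure (volume.restrict (Ioo 0 L)) := ⟨by simp⟩
  refine ⟨u', ⟨u, hm, hm', ?_, hvu⟩, hpu⟩
  exact IsWeakDeriv.of_comp_fst hD hc.nonempty (hm.integrable (by norm_num))
    (hm'.integrable (by norm_num)) hvol (h0.congr_ae hvu hpu)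

theorem ENNReal_le_one_add_sq (a : ℝ≥0∞) : a ≤ 1 + a ^ 2 := by
  rcases le_total a 1 with h | h
  · exact h.trans le_self_add
  · refine le_trans ?_ le_add_self
    rw [sq]
    exact le_mul_of_one_le_left' h

theorem aestronglyMeasurable_framedGrad_fst {μ : Measure (ℝ × ℝ × ℝ)}
    {β : Fin 3 → ℝ × ℝ × ℝ → ℝ} (hβ : ∀ k, AEMeasurable (β k) μ) (h : ℝ)
    {g : Fin 3 → ℝ × ℝ × ℝ → E3} (hg : ∀ k, AEStronglyMeasurable (g k) μ) :
    AEStronglyMeasurable (fun x => (framedGrad β h g x).1) μ :=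
  AEStronglyMeasurable.smul
    (((hβ 0).const_mul h).const_add 1).inv.aestronglyMeasurable
    (((hg 0).sub ((hβ 1).aestronglyMeasurable.smul (hg 1))).sub
      ((hβ 2).aestronglyMeasurable.smul (hg 2)))

/-- The columns of the framed gradient determine the partial derivatives. -/
theorem eq_of_framedGrad {β : Fin 3 → ℝ × ℝ × ℝ → ℝ} {h : ℝ} (hh : h ≠ 0)
    {g : Fin 3 → ℝ × ℝ × ℝ → E3} {x : ℝ × ℝ × ℝ} (hx : 1 + h * β 0 x ≠ 0) :
    g 0 x = (framedGrad β h g x).1 + h • (β 0 x • (framedGrad β h g x).1 +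
      β 1 x • (framedGrad β h g x).2.1 + β 2 x • (framedGrad β h g x).2.2) ∧
    g 1 x = h • (framedGrad β h g x).2.1 ∧ g 2 x = h • (framedGrad β h g x).2.2 := by
  have h1 : g 1 x = h • (framedGrad β h g x).2.1 := by
    simp [framedGrad, smul_smul, mul_inv_cancel₀ hh]
  have h2 : g 2 x = h • (framedGrad β h g x).2.2 := by
    simp [framedGrad, smul_smul, mul_inv_cancel₀ hh]
  refine ⟨?_, h1, h2⟩
  have h0 : (1 + h * β 0 x) • (framedGrad β h g x).1 = g 0 x - β 1 x • g 1 x - β 2 x • g 2 x := by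
    simp [framedGrad, smul_smul, mul_inv_cancel₀ hx]
  rw [h1, h2] at h0
  rw [sub_sub, eq_sub_iff_add_eq] at h0
  rw [← h0]
  module

/-- Compactness and lower semicontinuity along a sequence of bounded energy. -/
theorem exists_limit_of_energy_le {L : ℝ} (hL : 0 < L) {D : Set (ℝ × ℝ)} (hD : IsOpen D)
    (hvol : volume D = 1) {γ : ℝ → E3} {R₀ : ℝ → M3} (hγ : IsFramedCurve L γ R₀)
    {W : ℝ → M3 → ℝ≥0∞} {V : ℝ → E3 × E3 × E3 → ℝ≥0∞} (hV : IsRegularPotential V)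
    (hVW : ∀ᵐ s ∂volume.restrict (Ioo 0 L), ∀ F,
      W s F = V s (column (F * R₀ s) 0, column (F * R₀ s) 1, column (F * R₀ s) 2))
    {K : ℝ≥0} (hK : ∀ᵐ s ∂volume.restrict (Ioo 0 L), ∀ p,
      ‖p.1‖ₑ ^ 2 + ‖p.2.1‖ₑ ^ 2 + ‖p.2.2‖ₑ ^ 2 ≤ K * (1 + V s p))
    {M : ℝ} (hM : ∀ k, ∀ x ∈ Omega L D, |shear L R₀ k x| ≤ M) {h : ℕ → ℝ}
    (hpos : ∀ n, 0 < h n) (hhM : ∀ n, h n * M ≤ 1 / 2) (hh : Tendsto h atTop (𝓝 0))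
    {y : ℕ → L2 L D} {v : L2 L D} (hy : Tendsto y atTop (𝓝 v)) {c : ℝ≥0∞} (hc : c ≠ ⊤)
    {g : ℕ → Fin 3 → ℝ × ℝ × ℝ → E3} (hg : ∀ n, IsWeakGradient L D (y n) (g n))
    (hE : ∀ n, energyOfGradient L D γ R₀ W (h n) (g n) ≤ c) :
    ∃ p : L2 L D, IsWeakDeriv (Omega L D) (dir 0) v p ∧ IsWeakDeriv (Omega L D) (dir 1) v 0 ∧
      IsWeakDeriv (Omega L D) (dir 2) v 0 ∧
      ∫⁻ x in Omega L D, relaxedDensity V x.1 (p x) ≤ c := by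
  have hΩ : MeasurableSet (Omega L D) := (isOpen_Ioo.prod hD).measurableSet
  have hfin := isFiniteMeasure_Omega L hvol
  set β := shear L R₀ with hβ
  set P : ℕ → ℝ × ℝ × ℝ → E3 × E3 × E3 := fun n => framedGrad β (h n) (g n) with hP
  have hβm : ∀ k, AEMeasurable (β k) (volume.restrict (Omega L D)) := fun k =>
    ((continuousOn_shear hL hγ k).mono (prod_mono Ioo_subset_Icc_self le_rfl)).aemeasurable hΩ
  have hdet : ∀ n, ∀ x ∈ Omega L D, 1 - h n * M ≤ 1 + h n * β 0 x := by
    intro n x hx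
    have h1 := mul_le_mul_of_nonneg_left (neg_le_of_abs_le (hM 0 x hx)) (hpos n).le
    linarith
  -- The factor `1 - h n * M` tends to one and is kept for the sharp final inequality; the cruder `2
  -- * c` below serves only for compactness.
  have hV1 : ∀ n, ENNReal.ofReal (1 - h n * M) * ∫⁻ x in Omega L D, V x.1 (P n x) ≤ c := by
    intro n
    refine le_trans ?_ (hE n)
    rw [energyOfGradient_eq hD hγ hVW hM (hpos n) ((hhM n).trans_lt (by norm_num)),
      ← lintegral_const_mul' _ _ ENNReal.ofReal_ne_top]
    refine setLIntegral_mono' hΩ fun x hx => ?_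
    rw [mul_comm]
    exact mul_le_mul_right (ENNReal.ofReal_le_ofReal (hdet n x hx)) _
  have hV2 : ∀ n, ∫⁻ x in Omega L D, V x.1 (P n x) ≤ 2 * c := by
    intro n
    have h1 : (1 : ℝ≥0∞) ≤ 2 * ENNReal.ofReal (1 - h n * M) := by
      rw [← ENNReal.ofReal_one, show (2 : ℝ≥0∞) = ENNReal.ofReal 2 by simp,
        ← ENNReal.ofReal_mul zero_le_two]
      exact ENNReal.ofReal_le_ofReal (by linarith [hhM n])
    calc _ = 1 * ∫⁻ x in Omega L D, V x.1 (P n x) := (one_mul _).symm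
      _ ≤ 2 * ENNReal.ofReal (1 - h n * M) * ∫⁻ x in Omega L D, V x.1 (P n x) :=
          mul_le_mul_left h1 _
      _ ≤ 2 * c := by
          rw [mul_assoc]
          exact mul_le_mul_right (hV1 n) _
  -- Since `a ≤ 1 + a ^ 2`, the function `T` dominates the norm of each column, with integral
  -- bounded independently of `n`. It measures the errors of order `h`.
  set T : ℕ → ℝ × ℝ × ℝ → ℝ≥0∞ := fun n x =>
    1 + (‖(P n x).1‖ₑ ^ 2 + ‖(P n x).2.1‖ₑ ^ 2 + ‖(P n x).2.2‖ₑ ^ 2) with hT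
  set S : ℝ≥0∞ := ENNReal.ofReal L + K * (ENNReal.ofReal L + 2 * c) with hS
  have hSt : S ≠ ⊤ := by
    rw [hS]
    finiteness
  have hTS : ∀ n, ∫⁻ x in Omega L D, T n x ≤ S := by
    intro n
    rw [hT, hS]
    dsimp only
    rw [lintegral_add_left measurable_const, setLIntegral_one, volume_Omega hvol]
    gcongr
    calc _ ≤ ∫⁻ x in Omega L D, K * (1 + V x.1 (P n x)) := by
          refine lintegral_mono_ae ?_
          filter_upwards [(measurePreserving_fst_Omega L hvol).quasiMeasurePreserving.ae hK]
            with x hx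
          exact hx (P n x)
      _ ≤ _ := by
          rw [lintegral_const_mul' _ _ ENNReal.coe_ne_top, lintegral_add_left measurable_const,
            setLIntegral_one, volume_Omega hvol]
          gcongr
          exact hV2 n
  have hle : ∀ n x, ‖(P n x).1‖ₑ ≤ T n x ∧ ‖(P n x).2.1‖ₑ ≤ T n x ∧ ‖(P n x).2.2‖ₑ ≤ T n x := by
    intro n x
    refine ⟨(ENNReal_le_one_add_sq _).trans ?_, (ENNReal_le_one_add_sq _).trans ?_,
      (ENNReal_le_one_add_sq _).trans ?_⟩
    · exact add_le_add_right (le_self_add.trans le_self_add) 1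
    · exact add_le_add_right (le_add_self.trans le_self_add) 1
    · exact add_le_add_right le_add_self 1
  have hq2 : ∀ n, eLpNorm (fun x => (P n x).1) 2 (volume.restrict (Omega L D)) ≤ 1 + S := by
    intro n
    refine (ENNReal_le_one_add_sq _).trans (add_le_add_right ?_ 1)
    rw [← lintegral_enorm_sq]
    refine le_trans (lintegral_mono fun x => ?_) (hTS n)
    exact (le_self_add.trans le_self_add).trans le_add_self
  have hq : ∀ n, MemLp (fun x => (P n x).1) 2 (volume.restrict (Omega L D)) := fun n =>
    ⟨aestronglyMeasurable_framedGrad_fst hβm _ fun k => (hg n k).1.1,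
      (hq2 n).trans_lt (by finiteness)⟩
  set z : ℕ → L2 L D := fun n => (hq n).toLp with hz
  have hzP : ∀ n, ∀ᵐ x ∂volume.restrict (Omega L D), z n x = (P n x).1 := fun n =>
    (hq n).coeFn_toLp
  have hzB : ∀ n, ‖z n‖ ≤ (1 + S).toReal := fun n => by
    rw [hz, Lp.norm_toLp]
    exact ENNReal.toReal_mono (by finiteness) (hq2 n)
  obtain ⟨p, hp⟩ := exists_mem_of_eventually_mem hzB
  have hgi : ∀ n k, IntegrableOn (g n k) (Omega L D) := fun n k =>
    (hg n k).1.integrable (by norm_num)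
  have hne : ∀ n, ∀ x ∈ Omega L D, 1 + h n * β 0 x ≠ 0 := fun n x hx =>
    (lt_of_lt_of_le (by linarith [hhM n]) (hdet n x hx)).ne'
  have hgP : ∀ n, ∀ x ∈ Omega L D, g n 0 x = (P n x).1 + h n • (β 0 x • (P n x).1 +
      β 1 x • (P n x).2.1 + β 2 x • (P n x).2.2) ∧
      g n 1 x = h n • (P n x).2.1 ∧ g n 2 x = h n • (P n x).2.2 := fun n x hx =>
    eq_of_framedGrad (hpos n).ne' (hne n x hx)
  refine ⟨p, ?_, ?_, ?_, ?_⟩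
  -- The axial derivative differs from the first column by `h` times three shear terms, each of norm
  -- at most `M * T`.
  · refine IsWeakDeriv.of_tendsto hvol hy (fun n => hgi n 0) (fun n => (hg n 0).2) hp hh
      (G := fun n x => ENNReal.ofReal M * (3 * T n x)) (B := ENNReal.ofReal M * (3 * S))
      (by finiteness) (fun n => ?_) fun n => ?_
    · rw [lintegral_const_mul' _ _ ENNReal.ofReal_ne_top,
        lintegral_const_mul' _ _ (by norm_num)]
      gcongr
      exact hTS n
    · filter_upwards [hzP n, ae_restrict_mem hΩ] with x hx hxΩ
      rw [hx, (hgP n x hxΩ).1, sub_add_cancel_left, enorm_neg,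
        enorm_smul]
      have hn : ∀ t : ℝ, |t| ≤ M → ∀ a : E3, ‖a‖ₑ ≤ T n x → ‖t • a‖ₑ ≤
          ENNReal.ofReal M * T n x := by
        intro t ht a ha
        rw [enorm_smul]
        gcongr
        rw [← ofReal_norm]
        exact ENNReal.ofReal_le_ofReal ht
      rw [← ofReal_norm, Real.norm_of_nonneg (hpos n).le]
      gcongr
      refine ((enorm_add_le _ _).trans (add_le_add_left (enorm_add_le _ _) _)).trans ?_
      refine (add_le_add (add_le_add (hn _ (hM 0 x hxΩ) _ (hle n x).1)
        (hn _ (hM 1 x hxΩ) _ (hle n x).2.1)) (hn _ (hM 2 x hxΩ) _ (hle n x).2.2)).trans_eq ?_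
      ring
  -- The derivative is `h` times a column, so it is compared with the zero sequence; any set
  -- eventually containing that sequence contains its limit `0`.
  · refine (IsWeakDeriv.of_tendsto hvol hy (z := 0) (p := 0) (fun n => hgi n 1)
      (fun n => (hg n 1).2) (fun C _ _ hC => hC.exists.choose_spec) hh hSt hTS
      fun n => ?_).congr_ae ae_eq_rfl (Lp.coeFn_zero _ _ _)
    filter_upwards [Lp.coeFn_zero E3 2 (volume.restrict (Omega L D)), ae_restrict_mem hΩ]
      with x hx hxΩ
    rw [Pi.zero_apply, hx, (hgP n x hxΩ).2.1, Pi.zero_apply,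
      zero_sub, enorm_neg, enorm_smul, ← ofReal_norm, Real.norm_of_nonneg (hpos n).le]
    exact mul_le_mul_right (hle n x).2.1 _
  · refine (IsWeakDeriv.of_tendsto hvol hy (z := 0) (p := 0) (fun n => hgi n 2)
      (fun n => (hg n 2).2) (fun C _ _ hC => hC.exists.choose_spec) hh hSt hTS
      fun n => ?_).congr_ae ae_eq_rfl (Lp.coeFn_zero _ _ _)
    filter_upwards [Lp.coeFn_zero E3 2 (volume.restrict (Omega L D)), ae_restrict_mem hΩ]
      with x hx hxΩ
    rw [Pi.zero_apply, hx, (hgP n x hxΩ).2.2, Pi.zero_apply,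
      zero_sub, enorm_neg, enorm_smul, ← ofReal_norm, Real.norm_of_nonneg (hpos n).le]
    exact mul_le_mul_right (hle n x).2.2 _
  -- For `c' > c` the determinant factor is eventually absorbed, and the relaxed density lies below
  -- `V`; so the first columns eventually lie in the sublevel set of `c'`, and hence so does `p`.
  · refine le_of_forall_gt_imp_ge_of_dense fun c' hc' => ?_
    refine hp _ (hV.isClosed_sublevel L D c') (hV.convex_sublevel L D c') ?_
    have hlim : Tendsto (fun n => c' * ENNReal.ofReal (1 - h n * M)) atTop (𝓝 c') := by
      have h1 : Tendsto (fun n => 1 - h n * M) atTop (𝓝 1) := by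
        simpa using (hh.mul_const M).const_sub 1
      have h2 := ENNReal.tendsto_ofReal h1
      rw [ENNReal.ofReal_one] at h2
      simpa using ENNReal.Tendsto.const_mul (a := c') h2 (Or.inl one_ne_zero)
    filter_upwards [hlim.eventually_const_le hc'] with n hn
    have h0 : ENNReal.ofReal (1 - h n * M) ≠ 0 :=
      (ENNReal.ofReal_pos.2 (by linarith [hhM n])).ne'
    have h1 : ∫⁻ x in Omega L D, V x.1 (P n x) ≤ c' := by
      rw [← ENNReal.mul_le_mul_iff_right h0 ENNReal.ofReal_ne_top, mul_comm _ c']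
      exact (hV1 n).trans hn
    refine le_trans (lintegral_mono_ae ?_) h1
    filter_upwards [hzP n] with x hx
    rw [hx]
    exact relaxedDensity_le V x.1 (P n x)

/-- The lower bound tested at an arbitrary level: arbitrarily small thicknesses with energy below
`c` suffice, because a sequence can be extracted from them. -/
theorem I_le_of_frequently_lt {L : ℝ} (hL : 0 < L) {D : Set (ℝ × ℝ)} (hD : IsCrossSection D)
    {γ : ℝ → E3} {R₀ : ℝ → M3} (hγ : IsFramedCurve L γ R₀) {W : ℝ → M3 → ℝ≥0∞}
    (hW : IsStoredEnergy L W) {y : ℝ → L2 L D} {v : L2 L D} (hy : Tendsto y (𝓝[>] 0) (𝓝 v))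
    {c : ℝ≥0∞} (hc : ∃ᶠ h in 𝓝[>] 0, J L D γ R₀ W h (y h) < c) : I L D R₀ W v ≤ c := by
  rcases eq_or_ne c ⊤ with rfl | hct
  · exact le_top
  have hvol := hD.volume_eq_one
  obtain ⟨V, hV, hVW⟩ := exists_regularPotential hL hγ hW
  obtain ⟨K, hK⟩ := exists_coercive hγ hW hVW
  obtain ⟨M, hM0, hM⟩ := exists_shear_bound hL hD.isBounded hγ
  have hsmall : ∀ᶠ h in 𝓝[>] (0 : ℝ), 0 < h ∧ h * M ≤ 1 / 2 := by
    filter_upwards [Ioo_mem_nhdsGT (show (0 : ℝ) < 1 / 2 / M by positivity)] with h hh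
    exact ⟨hh.1, ((lt_div_iff₀ hM0).1 hh.2).le⟩
  obtain ⟨h, hh, hJ⟩ := exists_seq_forall_of_frequently (hc.and_eventually hsmall)
  have hgrad : ∀ n, ∃ g, IsWeakGradient L D (y (h n)) g ∧
      energyOfGradient L D γ R₀ W (h n) g ≤ c := by
    intro n
    have h1 := (hJ n).1
    rw [J] at h1
    split_ifs at h1 with hv
    · exact ⟨_, hv.choose_spec, h1.le⟩
    · exact absurd h1 not_top_lt
  choose g hg hgE using hgrad
  obtain ⟨p, hp0, hp1, hp2, hpc⟩ := exists_limit_of_energy_le hL hD.isOpen hvol hγ hV hVW hK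
    hM (fun n => (hJ n).2.1) (fun n => (hJ n).2.2) (tendsto_nhds_of_tendsto_nhdsWithin hh)
    (hy.comp hh) hct hg hgE
  obtain ⟨u', hu', hpu⟩ := exists_isProfileDeriv hD.isOpen hD.isConnected hvol hp0 hp1 hp2
  rw [I_eq hvol hγ hV hVW hu']
  refine le_trans (le_of_eq ?_) hpc
  obtain ⟨u, -, hu2, -, -⟩ := hu'
  have h1 : AEMeasurable (fun s => relaxedDensity V s (u' s)) (volume.restrict (Ioo 0 L)) :=
    Measurable.comp_aemeasurable (g := fun q : E3 × ℝ => relaxedDensity V q.2 q.1)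
      (f := fun s => (u' s, s)) hV.measurable_relaxedDensity
      (hu2.1.aemeasurable.prodMk aemeasurable_id)
  have hmp := measurePreserving_fst_Omega L hvol
  rw [← hmp.map_eq] at h1
  rw [← hmp.map_eq, lintegral_map' h1 measurable_fst.aemeasurable]
  refine lintegral_congr_ae ?_
  filter_upwards [hpu] with x hx
  rw [hx]

theorem I_le_liminf_J {L : ℝ} (hL : 0 < L) {D : Set (ℝ × ℝ)} (hD : IsCrossSection D)
    {γ : ℝ → E3} {R₀ : ℝ → M3} (hγ : IsFramedCurve L γ R₀) {W : ℝ → M3 → ℝ≥0∞}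
    (hW : IsStoredEnergy L W) {y : ℝ → L2 L D} {v : L2 L D} (hy : Tendsto y (𝓝[>] 0) (𝓝 v)) :
    I L D R₀ W v ≤ liminf (fun h => J L D γ R₀ W h (y h)) (𝓝[>] 0) :=
  le_of_forall_gt_imp_ge_of_dense fun _ hc =>
    I_le_of_frequently_lt hL hD hγ hW hy (frequently_lt_of_liminf_lt (h := hc))

/-! ### Upper bound -/

theorem exists_isWeakGradient_of_contDiff (L : ℝ) {D : Set (ℝ × ℝ)} (hD : Bornology.IsBounded D)
    (hvol : volume D = 1) {f : ℝ × ℝ × ℝ → E3} (hf : ContDiff ℝ 1 f) (hDo : IsOpen D) :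
    ∃ y : L2 L D, y =ᵐ[volume.restrict (Omega L D)] f ∧
      IsWeakGradient L D y fun k x => fderiv ℝ f x (dir k) := by
  have hfin := isFiniteMeasure_Omega L hvol
  have hΩ : MeasurableSet (Omega L D) := (isOpen_Ioo.prod hDo).measurableSet
  have hmem : ∀ f : ℝ × ℝ × ℝ → E3, Continuous f → MemLp f 2 (volume.restrict (Omega L D)) := by
    intro f hf
    obtain ⟨B, hB⟩ := ((isCompact_Icc (a := 0) (b := L)).prod
      hD.isCompact_closure).exists_bound_of_continuousOn hf.continuousOn
    refine MemLp.of_bound hf.aestronglyMeasurable B ?_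
    filter_upwards [ae_restrict_mem hΩ] with x hx
    exact hB x ⟨Ioo_subset_Icc_self hx.1, subset_closure hx.2⟩
  refine ⟨(hmem f hf.continuous).toLp, (hmem f hf.continuous).coeFn_toLp, fun k => ⟨?_, ?_⟩⟩
  · exact hmem _ ((hf.continuous_fderiv one_ne_zero).clm_apply continuous_const)
  · exact (isWeakDeriv_of_contDiff hf).congr_ae (hmem f hf.continuous).coeFn_toLp.symm ae_eq_rfl

/-- Weak gradients are unique almost everywhere, so the gradient picked by choice in `J` may be
replaced by any explicit one. -/
theorem J_eq {L : ℝ} {D : Set (ℝ × ℝ)} (hD : IsOpen D) (hvol : volume D = 1) (γ : ℝ → E3)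
    (R₀ : ℝ → M3) (W : ℝ → M3 → ℝ≥0∞) (h : ℝ) {y : L2 L D} {g : Fin 3 → ℝ × ℝ × ℝ → E3}
    (hg : IsWeakGradient L D y g) : J L D γ R₀ W h y = energyOfGradient L D γ R₀ W h g := by
  have hfin := isFiniteMeasure_Omega L hvol
  have hy : ∃ g, IsWeakGradient L D y g := ⟨g, hg⟩
  rw [J, dif_pos hy]
  have hae : ∀ k, hy.choose k =ᵐ[volume.restrict (Omega L D)] g k := fun k =>
    (hy.choose_spec k).2.ae_unique (isOpen_Ioo.prod hD)
      ((hy.choose_spec k).1.integrable (by norm_num)) ((hg k).1.integrable (by norm_num)) (hg k).2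
  refine lintegral_congr_ae ?_
  filter_upwards [hae 0, hae 1, hae 2] with x h0 h1 h2
  simp only [scaledGrad, h0, h1, h2]

/-- Recovery families from almost optimal competitors. -/
theorem exists_tendsto_limsup_le {X : Type*} [PseudoMetricSpace X] {F : ℝ → X → ℝ≥0∞} {x : X}
    {c : ℝ≥0∞} (hF : ∀ ε : ℝ, 0 < ε → ∀ᶠ t in 𝓝[>] (0 : ℝ),
      ∃ y, dist y x < ε ∧ F t y ≤ c + ENNReal.ofReal ε) :
    ∃ y : ℝ → X, Tendsto y (𝓝[>] 0) (𝓝 x) ∧ limsup (fun t => F t (y t)) (𝓝[>] 0) ≤ c := by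
  -- `m t` is the least combined defect in distance and energy. It tends to zero, and choosing `y t`
  -- within `t` of the infimum performs the diagonal argument at once.
  set m : ℝ → ℝ≥0∞ := fun t => ⨅ y, max (edist y x) (F t y - c) with hm
  have hm0 : Tendsto m (𝓝[>] 0) (𝓝 0) := by
    rw [ENNReal.tendsto_nhds_zero]
    intro ε hε
    obtain ⟨r, hr0, hr⟩ : ∃ r : ℝ, 0 < r ∧ ENNReal.ofReal r ≤ ε := by
      rcases eq_or_ne ε ⊤ with rfl | h
      · exact ⟨1, one_pos, le_top⟩
      · exact ⟨ε.toReal, ENNReal.toReal_pos hε.ne' h, ENNReal.ofReal_toReal_le⟩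
    filter_upwards [hF r hr0] with t ⟨y, hy, hyF⟩
    refine (iInf_le _ y).trans (max_le ?_ ?_)
    · rw [edist_dist]
      exact (ENNReal.ofReal_le_ofReal hy.le).trans hr
    · exact (tsub_le_iff_left.2 hyF).trans hr
  have hex : ∀ t, ∃ y, m t ≠ ⊤ → 0 < t → max (edist y x) (F t y - c) ≤ m t + ENNReal.ofReal t := by
    intro t
    by_cases ht : m t ≠ ⊤ ∧ 0 < t
    · obtain ⟨y, hy⟩ := iInf_lt_iff.1
        (ENNReal.lt_add_right ht.1 (ENNReal.ofReal_pos.2 ht.2).ne' : m t < m t + ENNReal.ofReal t)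
      exact ⟨y, fun _ _ => hy.le⟩
    · exact ⟨x, fun h1 h2 => absurd ⟨h1, h2⟩ ht⟩
  choose y hy using hex
  have hlim : Tendsto (fun t => m t + ENNReal.ofReal t) (𝓝[>] 0) (𝓝 0) := by
    have h1 : Tendsto (fun t : ℝ => ENNReal.ofReal t) (𝓝[>] 0) (𝓝 0) := by
      simpa using (ENNReal.tendsto_ofReal (tendsto_id (x := 𝓝 (0 : ℝ)))).mono_left
        nhdsWithin_le_nhds
    simpa using hm0.add h1
  have hev : ∀ᶠ t in 𝓝[>] (0 : ℝ),
      max (edist (y t) x) (F t (y t) - c) ≤ m t + ENNReal.ofReal t := by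
    filter_upwards [hm0.eventually_lt_const ENNReal.zero_lt_top, self_mem_nhdsWithin] with t h1 h2
    exact hy t h1.ne h2
  refine ⟨y, ?_, ?_⟩
  · rw [tendsto_iff_edist_tendsto_0]
    refine tendsto_of_tendsto_of_tendsto_of_le_of_le' tendsto_const_nhds hlim
      (Eventually.of_forall fun _ => zero_le) ?_
    filter_upwards [hev] with t ht using (le_max_left _ _).trans ht
  · have h1 : Tendsto (fun t => c + (m t + ENNReal.ofReal t)) (𝓝[>] 0) (𝓝 c) := by
      simpa using hlim.const_add c
    rw [← h1.limsup_eq]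
    refine limsup_le_limsup ?_
    filter_upwards [hev] with t ht
    exact tsub_le_iff_left.1 ((le_max_right _ _).trans ht)

/-- The three-dimensional deformation built from a curve `w` and two directors `b`, `d`. -/
def directorAnsatz (w b d : ℝ → E3) (h : ℝ) (x : ℝ × ℝ × ℝ) : E3 :=
  w x.1 + h • (x.2.1 • b x.1 + x.2.2 • d x.1)

theorem contDiff_directorAnsatz {w b d : ℝ → E3} (hw : ContDiff ℝ 1 w) (hb : ContDiff ℝ 1 b)
    (hd : ContDiff ℝ 1 d) (h : ℝ) : ContDiff ℝ 1 (directorAnsatz w b d h) := by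
  unfold directorAnsatz
  fun_prop

theorem fderiv_directorAnsatz {w b d : ℝ → E3} (hw : ContDiff ℝ 1 w) (hb : ContDiff ℝ 1 b)
    (hd : ContDiff ℝ 1 d) (h : ℝ) (x : ℝ × ℝ × ℝ) :
    fderiv ℝ (directorAnsatz w b d h) x (dir 0) =
      deriv w x.1 + h • (x.2.1 • deriv b x.1 + x.2.2 • deriv d x.1) ∧
    fderiv ℝ (directorAnsatz w b d h) x (dir 1) = h • b x.1 ∧
    fderiv ℝ (directorAnsatz w b d h) x (dir 2) = h • d x.1 := by
  have h1 : ∀ f : ℝ → E3, ContDiff ℝ 1 f → HasFDerivAt (fun x : ℝ × ℝ × ℝ => f x.1)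
      ((ContinuousLinearMap.toSpanSingleton ℝ (deriv f x.1)).comp
        (ContinuousLinearMap.fst ℝ ℝ (ℝ × ℝ))) x := fun f hf =>
    ((hf.differentiable one_ne_zero).differentiableAt.hasDerivAt.hasFDerivAt).comp x hasFDerivAt_fst
  have h2 : HasFDerivAt (fun x : ℝ × ℝ × ℝ => x.2.1) ((ContinuousLinearMap.fst ℝ ℝ ℝ).comp
      (ContinuousLinearMap.snd ℝ ℝ (ℝ × ℝ))) x := hasFDerivAt_fst.comp x hasFDerivAt_snd
  have h3 : HasFDerivAt (fun x : ℝ × ℝ × ℝ => x.2.2) ((ContinuousLinearMap.snd ℝ ℝ ℝ).comp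
      (ContinuousLinearMap.snd ℝ ℝ (ℝ × ℝ))) x := hasFDerivAt_snd.comp x hasFDerivAt_snd
  have e : fderiv ℝ (directorAnsatz w b d h) x = _ :=
    ((h1 w hw).add (((h2.smul (h1 b hb)).add (h3.smul (h1 d hd))).const_smul h)).fderiv
  rw [e]
  simp [dir]

/-- The energies of the director ansatz converge to the energy of its framed limit gradient. -/
theorem tendsto_energyOfGradient_directorAnsatz {L : ℝ} (hL : 0 < L) {D : Set (ℝ × ℝ)}
    (hD : IsCrossSection D) {γ : ℝ → E3} {R₀ : ℝ → M3} (hγ : IsFramedCurve L γ R₀)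
    {W : ℝ → M3 → ℝ≥0∞} {V : ℝ → E3 × E3 × E3 → ℝ≥0∞} (hV : IsRegularPotential V)
    (hVW : ∀ᵐ s ∂volume.restrict (Ioo 0 L), ∀ F,
      W s F = V s (column (F * R₀ s) 0, column (F * R₀ s) 1, column (F * R₀ s) 2))
    {w b d : ℝ → E3} (hw : ContDiff ℝ 1 w) (hb : ContDiff ℝ 1 b) (hd : ContDiff ℝ 1 d) :
    Tendsto (fun h => energyOfGradient L D γ R₀ W h
      fun k x => fderiv ℝ (directorAnsatz w b d h) x (dir k)) (𝓝[>] 0)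
      (𝓝 (∫⁻ s in Ioo 0 L, V s (deriv w s, b s, d s))) := by
  have hvol := hD.volume_eq_one
  have hfin := isFiniteMeasure_Omega L hvol
  have hΩ : MeasurableSet (Omega L D) := (isOpen_Ioo.prod hD.isOpen).measurableSet
  obtain ⟨M, hM0, hM⟩ := exists_shear_bound hL hD.isBounded hγ
  set β := shear L R₀ with hβ
  have hβm : ∀ k, AEMeasurable (β k) (volume.restrict (Omega L D)) := fun k =>
    ((continuousOn_shear hL hγ k).mono (prod_mono Ioo_subset_Icc_self le_rfl)).aemeasurable hΩ
  have hcw := hw.continuous_deriv le_rfl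
  have hcb := hb.continuous_deriv le_rfl
  have hcd := hd.continuous_deriv le_rfl
  have hbound : ∀ f : ℝ × ℝ × ℝ → E3, Continuous f → ∃ B, ∀ x ∈ Omega L D, ‖f x‖ ≤ B := by
    intro f hf
    obtain ⟨B, hB⟩ := ((isCompact_Icc (a := 0) (b := L)).prod
      hD.isBounded.isCompact_closure).exists_bound_of_continuousOn hf.continuousOn
    exact ⟨B, fun x hx => hB x ⟨Ioo_subset_Icc_self hx.1, subset_closure hx.2⟩⟩
  obtain ⟨B₀, hB₀⟩ := hbound (fun x => deriv w x.1) (hcw.comp continuous_fst)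
  obtain ⟨B₁, hB₁⟩ := hbound (fun x => b x.1) (hb.continuous.comp continuous_fst)
  obtain ⟨B₂, hB₂⟩ := hbound (fun x => d x.1) (hd.continuous.comp continuous_fst)
  obtain ⟨B₃, hB₃⟩ := hbound (fun x => x.2.1 • deriv b x.1 + x.2.2 • deriv d x.1) (by fun_prop)
  set P : ℝ → ℝ × ℝ × ℝ → E3 × E3 × E3 := fun h =>
    framedGrad β h fun k x => fderiv ℝ (directorAnsatz w b d h) x (dir k) with hP
  have hPeq : ∀ h ≠ 0, ∀ x, P h x = ((1 + h * β 0 x)⁻¹ • (deriv w x.1 +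
      h • ((x.2.1 • deriv b x.1 + x.2.2 • deriv d x.1) - β 1 x • b x.1 - β 2 x • d x.1)),
      b x.1, d x.1) := by
    intro h hh x
    obtain ⟨e0, e1, e2⟩ := fderiv_directorAnsatz hw hb hd h x
    simp only [hP, framedGrad, e0, e1, e2]
    refine Prod.ext ?_ (Prod.ext ?_ ?_)
    · dsimp only
      congr 1
      module
    · exact inv_smul_smul₀ hh _
    · exact inv_smul_smul₀ hh _
  have hsmall : ∀ᶠ h in 𝓝[>] (0 : ℝ), 0 < h ∧ h * M ≤ 1 / 2 ∧ h ≤ 1 := by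
    filter_upwards [Ioo_mem_nhdsGT (show (0 : ℝ) < 1 / 2 / M by positivity),
      Ioo_mem_nhdsGT (one_pos (α := ℝ))] with h hh hh1
    exact ⟨hh.1, ((lt_div_iff₀ hM0).1 hh.2).le, hh1.2.le⟩
  have hlimit : ∫⁻ s in Ioo 0 L, V s (deriv w s, b s, d s) =
      ∫⁻ x in Omega L D, V x.1 (deriv w x.1, b x.1, d x.1) := by
    have h1 : Measurable fun s => V s (deriv w s, b s, d s) :=
      hV.measurable_uncurry.comp ((hcw.measurable.prodMk
        (hb.continuous.measurable.prodMk hd.continuous.measurable)).prodMk measurable_id)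
    rw [← (measurePreserving_fst_Omega L hvol).map_eq, lintegral_map h1 measurable_fst]
  rw [hlimit]
  have hcongr : ∀ᶠ h in 𝓝[>] (0 : ℝ), ∫⁻ x in Omega L D,
      V x.1 (P h x) * ENNReal.ofReal (1 + h * β 0 x) = energyOfGradient L D γ R₀ W h
        fun k x => fderiv ℝ (directorAnsatz w b d h) x (dir k) := by
    filter_upwards [hsmall] with h hh
    exact (energyOfGradient_eq hD.isOpen hγ hVW hM hh.1
      (hh.2.1.trans_lt (by norm_num)) _).symm
  refine Tendsto.congr' hcongr ?_
  obtain ⟨C, hC⟩ := hV.bound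
  -- When `h * M ≤ 1 / 2` the inverse determinant is at most `2`, and for `h ≤ 1` the correction to
  -- the axial derivative is at most `B₃ + M * B₁ + M * B₂`.
  set N : ℝ := 2 * (B₀ + (B₃ + M * B₁ + M * B₂)) with hN
  refine tendsto_lintegral_filter_of_dominated_convergence'
    (fun _ => C * (1 + ENNReal.ofReal N ^ 2 + ENNReal.ofReal B₁ ^ 2 + ENNReal.ofReal B₂ ^ 2) *
      ENNReal.ofReal 2) ?_ ?_ ?_ ?_
  · refine Eventually.of_forall fun h => ?_
    have hg : ∀ k, Continuous fun x => fderiv ℝ (directorAnsatz w b d h) x (dir k) := fun k =>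
      ((contDiff_directorAnsatz hw hb hd h).continuous_fderiv one_ne_zero).clm_apply
        continuous_const
    have h1 : AEMeasurable (P h) (volume.restrict (Omega L D)) :=
      (aestronglyMeasurable_framedGrad_fst hβm h
        fun k => (hg k).aestronglyMeasurable).aemeasurable.prodMk
        (((hg 1).const_smul h⁻¹).measurable.prodMk
          ((hg 2).const_smul h⁻¹).measurable).aemeasurable
    exact (hV.measurable_uncurry.comp_aemeasurable (h1.prodMk measurable_fst.aemeasurable)).mul
      (((hβm 0).const_mul h).const_add 1).ennreal_ofReal
  · filter_upwards [hsmall] with h hh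
    filter_upwards [ae_restrict_mem hΩ] with x hx
    have hb0 := abs_le.1 (hM 0 x hx)
    have hlow : 1 / 2 ≤ 1 + h * β 0 x := by
      nlinarith [mul_le_mul_of_nonneg_left hb0.1 hh.1.le, hh.2.1]
    have hupp : 1 + h * β 0 x ≤ 2 := by
      nlinarith [mul_le_mul_of_nonneg_left hb0.2 hh.1.le, hh.2.1]
    refine mul_le_mul' ((hC x.1 (P h x)).trans ?_) (ENNReal.ofReal_le_ofReal hupp)
    rw [hPeq h hh.1.ne' x]
    have h0 : ‖(1 + h * β 0 x)⁻¹ • (deriv w x.1 + h • ((x.2.1 • deriv b x.1 +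
        x.2.2 • deriv d x.1) - β 1 x • b x.1 - β 2 x • d x.1))‖ ≤ N := by
      rw [norm_smul, norm_inv, Real.norm_of_nonneg (by linarith)]
      have hinv : (1 + h * β 0 x)⁻¹ ≤ 2 := by
        rw [inv_le_comm₀ (by linarith) two_pos]
        linarith
      have hsm : ∀ k, ∀ a : E3, ∀ B, ‖a‖ ≤ B → ‖β k x • a‖ ≤ M * B := fun k a B ha => by
        rw [norm_smul]
        exact mul_le_mul (hM k x hx) ha (norm_nonneg _) hM0.le
      refine mul_le_mul hinv ((norm_add_le _ _).trans (add_le_add (hB₀ x hx) ?_))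
        (norm_nonneg _) two_pos.le
      rw [norm_smul, Real.norm_of_nonneg hh.1.le]
      refine (mul_le_of_le_one_left (norm_nonneg _) hh.2.2).trans ?_
      exact (norm_sub_le _ _).trans (add_le_add ((norm_sub_le _ _).trans
        (add_le_add (hB₃ x hx) (hsm 1 _ _ (hB₁ x hx)))) (hsm 2 _ _ (hB₂ x hx)))
    have he : ∀ (a : E3) (B : ℝ), ‖a‖ ≤ B → ‖a‖ₑ ≤ ENNReal.ofReal B := fun a B ha => by
      rw [← ofReal_norm]
      exact ENNReal.ofReal_le_ofReal ha
    gcongr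
    · exact he _ _ h0
    · exact he _ _ (hB₁ x hx)
    · exact he _ _ (hB₂ x hx)
  · rw [lintegral_const]
    finiteness
  · refine Eventually.of_forall fun x => ?_
    have hid : Tendsto (fun h : ℝ => h) (𝓝[>] 0) (𝓝 0) := nhdsWithin_le_nhds
    have h1 : Tendsto (fun h : ℝ => 1 + h * β 0 x) (𝓝[>] 0) (𝓝 1) := by
      simpa using (hid.mul_const (β 0 x)).const_add 1
    have h2 : Tendsto (fun h : ℝ => deriv w x.1 + h • ((x.2.1 • deriv b x.1 +
        x.2.2 • deriv d x.1) - β 1 x • b x.1 - β 2 x • d x.1)) (𝓝[>] 0) (𝓝 (deriv w x.1)) := by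
      simpa using (hid.smul_const ((x.2.1 • deriv b x.1 +
        x.2.2 • deriv d x.1) - β 1 x • b x.1 - β 2 x • d x.1)).const_add (deriv w x.1)
    have h3 : Tendsto (fun h => P h x) (𝓝[>] 0) (𝓝 (deriv w x.1, b x.1, d x.1)) := by
      have h4 := (h1.inv₀ one_ne_zero).smul h2
      rw [inv_one, one_smul] at h4
      refine Tendsto.congr' ?_ (h4.prodMk_nhds (tendsto_const_nhds (x := (b x.1, d x.1))))
      filter_upwards [self_mem_nhdsWithin] with h hh
      exact (hPeq h (ne_of_gt hh) x).symm
    have h5 := ENNReal.Tendsto.mul (((hV.continuous x.1).tendsto _).comp h3)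
      (Or.inr (by simp)) (ENNReal.tendsto_ofReal h1) (Or.inl (by simp))
    simpa using h5

theorem contDiff_primitive {z : ℝ → E3} (hz : Continuous z) (c : E3) :
    ContDiff ℝ 1 (fun s => c + ∫ t in 0..s, z t) ∧
      deriv (fun s => c + ∫ t in 0..s, z t) = z := by
  have h1 : ∀ s, HasDerivAt (fun s => c + ∫ t in 0..s, z t) (z s) s := fun s =>
    (hz.integral_hasStrictDerivAt 0 s).hasDerivAt.const_add c
  have h2 : deriv (fun s => c + ∫ t in 0..s, z t) = z := funext fun s => (h1 s).deriv
  refine ⟨contDiff_one_iff_deriv.2 ⟨fun s => (h1 s).differentiableAt, ?_⟩, h2⟩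
  rw [h2]
  exact hz

/-- For finite `I v`, the derivative of the profile is replaced by a smooth competitor with nearly
the relaxed energy. Its primitive stays close to `v`, and its last two components serve as
directors. -/
theorem eventually_exists_J_le {L : ℝ} (hL : 0 < L) {D : Set (ℝ × ℝ)} (hD : IsCrossSection D)
    {γ : ℝ → E3} {R₀ : ℝ → M3} (hγ : IsFramedCurve L γ R₀) {W : ℝ → M3 → ℝ≥0∞}
    (hW : IsStoredEnergy L W) (v : L2 L D) {ε : ℝ} (hε : 0 < ε) :
    ∀ᶠ h in 𝓝[>] (0 : ℝ), ∃ y, dist y v < ε ∧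
      J L D γ R₀ W h y ≤ I L D R₀ W v + ENNReal.ofReal ε := by
  have hvol := hD.volume_eq_one
  have hfin := isFiniteMeasure_Omega L hvol
  have hΩ : MeasurableSet (Omega L D) := (isOpen_Ioo.prod hD.isOpen).measurableSet
  rcases eq_or_ne (I L D R₀ W v) ⊤ with hI | hI
  · exact Eventually.of_forall fun h => ⟨v, by simpa using hε, by simp [hI]⟩
  obtain ⟨u', hu'⟩ : ∃ u', IsProfileDeriv L D v u' := by
    by_contra h
    exact hI (by rw [I, dif_neg h])
  obtain ⟨V, hV, hVW⟩ := exists_regularPotential hL hγ hW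
  have hIeq := I_eq hvol hγ hV hVW hu'
  obtain ⟨u, hu2, hu2', hd, hvu⟩ := hu'
  have : IsFiniteMeasure (volume.restrict (Ioo 0 L)) := ⟨by simp⟩
  obtain ⟨c, hc⟩ := hd.exists_ae_eq_primitive hL (hu2.integrable (by norm_num))
    (hu2'.integrable (by norm_num))
  set m : ℝ := measureUnivNNReal (volume.restrict (Omega L D)) ^ ((2 : ℝ≥0∞).toReal)⁻¹ with hm
  have hm0 : 0 ≤ m := by positivity
  -- The first bound makes the energy defect less than `ε`. The second does so for the `L²`
  -- distance, which is at most `2 * m * η ≤ ε / 2`, with `m` the square root of the volume of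
  -- `Omega`.
  set η : ℝ := min (ε / 2) (ε / (4 * (m + 1))) with hη
  have hη0 : 0 < η := lt_min (by positivity) (by positivity)
  obtain ⟨p, hp, hpc, hpd, hpE⟩ := hV.exists_smooth_recovery hu2' hη0
  have hp1 : ContDiff ℝ 1 p := hp.of_le (by simp)
  obtain ⟨hw, hdw⟩ := contDiff_primitive (hp1.continuous.fst) c
  set w : ℝ → E3 := fun s => c + ∫ t in 0..s, (p t).1 with hwdef
  have hb : ContDiff ℝ 1 fun s => (p s).2.1 := hp1.snd.fst
  have hd : ContDiff ℝ 1 fun s => (p s).2.2 := hp1.snd.snd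
  have hconv := tendsto_energyOfGradient_directorAnsatz hL hD hγ hV hVW hw hb hd
  rw [hdw] at hconv
  have hlt : ∫⁻ s in Ioo 0 L, V s (p s) < I L D R₀ W v + ENNReal.ofReal ε := by
    rw [hIeq] at hI ⊢
    refine hpE.trans_lt (ENNReal.add_lt_add_left hI ?_)
    exact (ENNReal.ofReal_lt_ofReal_iff hε).2 ((min_le_left _ _).trans_lt (by linarith))
  have hE := hconv.eventually_lt_const hlt
  obtain ⟨B, hB⟩ := ((isCompact_Icc (a := 0) (b := L)).prod
    hD.isBounded.isCompact_closure).exists_bound_of_continuousOn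
    (f := fun x : ℝ × ℝ × ℝ => x.2.1 • (p x.1).2.1 + x.2.2 • (p x.1).2.2)
    (((continuous_fst.comp continuous_snd).smul (hb.continuous.comp continuous_fst)).add
      ((continuous_snd.comp continuous_snd).smul (hd.continuous.comp continuous_fst))).continuousOn
  have hBη : ∀ᶠ h in 𝓝[>] (0 : ℝ), h * B < η := by
    have h1 : Tendsto (fun h : ℝ => h * B) (𝓝[>] 0) (𝓝 (0 * B)) :=
      (tendsto_id.mono_left nhdsWithin_le_nhds).mul_const B
    rw [zero_mul] at h1
    exact h1.eventually_lt_const hη0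
  filter_upwards [hE, hBη, self_mem_nhdsWithin] with h h1 h2 h3
  obtain ⟨y, hy, hyg⟩ := exists_isWeakGradient_of_contDiff L hD.isBounded hvol
    (contDiff_directorAnsatz hw hb hd h) hD.isOpen
  refine ⟨y, ?_, ?_⟩
  · have hdist : ‖y - v‖ ≤ m * (2 * η) := by
      refine Lp.norm_le_of_ae_bound (by positivity) ?_
      filter_upwards [Lp.coeFn_sub y v, hy, hvu, ae_restrict_mem hΩ,
        (measurePreserving_fst_Omega L hvol).quasiMeasurePreserving.ae hc] with x e1 e2 e3 hx e4
      rw [e1, Pi.sub_apply, e2, e3, e4, directorAnsatz]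
      have hxI := Ioo_subset_Icc_self hx.1
      calc _ = ‖((∫ t in 0..x.1, (p t).1) - ∫ t in 0..x.1, u' t) +
            h • (x.2.1 • (p x.1).2.1 + x.2.2 • (p x.1).2.2)‖ := by
            congr 1
            simp only [hwdef]
            abel
        _ ≤ η + h * B := by
            refine (norm_add_le _ _).trans (add_le_add (hpd x.1 hxI) ?_)
            rw [norm_smul, Real.norm_of_nonneg (le_of_lt h3)]
            exact mul_le_mul_of_nonneg_left (hB x ⟨hxI, subset_closure hx.2⟩) (le_of_lt h3)
        _ ≤ 2 * η := by linarith
    rw [dist_eq_norm]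
    refine hdist.trans_lt ?_
    have h4 : (m + 1) * η ≤ ε / 4 := by
      calc (m + 1) * η ≤ (m + 1) * (ε / (4 * (m + 1))) :=
            mul_le_mul_of_nonneg_left (min_le_right _ _) (by positivity)
        _ = ε / 4 := by field_simp
    nlinarith
  · rw [J_eq hD.isOpen hvol γ R₀ W h hyg]
    exact h1.le

theorem gammaConverges_J {L : ℝ} (hL : 0 < L) {D : Set (ℝ × ℝ)} (hD : IsCrossSection D)
    {γ : ℝ → E3} {R₀ : ℝ → M3} (hγ : IsFramedCurve L γ R₀) {W : ℝ → M3 → ℝ≥0∞}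
    (hW : IsStoredEnergy L W) :
    GammaConverges (fun h : ℝ => J L D γ R₀ W h) (I L D R₀ W) :=
  ⟨fun _ _ hy => I_le_liminf_J hL hD hγ hW hy, fun v =>
    exists_tendsto_limsup_le fun _ hε => eventually_exists_J_le hL hD hγ hW v hε⟩

end CurvedBeam

end

theorem mainTheorem4 (L : ℝ) (hL : 0 < L) (D : Set (ℝ × ℝ)) (hD : CurvedBeam.IsCrossSection D)
    (γ : ℝ → CurvedBeam.E3) (R₀ : ℝ → CurvedBeam.M3) (hγ : CurvedBeam.IsFramedCurve L γ R₀)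
    (W : ℝ → CurvedBeam.M3 → ENNReal) (hW : CurvedBeam.IsStoredEnergy L W) :
    CurvedBeam.GammaConverges (fun h : ℝ => CurvedBeam.J L D γ R₀ W h)
      (CurvedBeam.I L D R₀ W) := by
  exact CurvedBeam.gammaConverges_J hL hD hγ hW
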